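/- **Conventions.** A finite multigraph is given by its edges; its Tutte polynomial $T(G)\in\mathbb Z[x,y]$ is $1$ if there are no edges, $xT(G/e)$ if $e$ is a bridge, $yT(G-e)$ if $e$ is a loop, and $T(G-e)+T(G/e)$ otherwise. Link diagrams are written in Conway notation. A tangle has four ends NW, SW, SE, NE. The tangle $1$ is a crossing whose upper strand runs from SW to NE, $-1$ is the opposite crossing; for an integer $n\neq0$ the tangle $n$ is a horizontal row of $|n|$ crossings equal to $1$ (if $n>0$) or $-1$ (if $n<0$). $t\,0$ is the reflection of $t$ in the plane through the NW–SE diagonal that is perpendicular to the projection plane (the ends SW and NE are exchanged, upper strands stay upper; the tangle $1$ is unchanged), $s+t$ is horizontal addition, $s\,t=s\,0+t$ (products of several tangles are bracketed to the left), $t_1,\dots,t_n=t_1\,0+\dots+t_n\,0$, and a final $+$ (respectively $+k$) means that the tangle $1$ (respectively $k$) is added. The link of a tangle is obtained by joining NW with NE and SW with SE. For polyhedral symbols, tangles are substituted for vertices of a basic polyhedron in order, separated by dots; omitted tangles are $1$, $:$ stands for $.1.$, $:.$ for $.1.1.$ and $::$ for $.1.1.1.$ . The basic polyhedron $(2n)^*$,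 $n\ge3$, is the graph of the $n$-gonal antiprism, with vertices $1,\dots,2n$ numbered in zigzag order, so that $i$ is joined to $i\pm1$ and $i\pm2$ (mod $2n$). In $6^*$ and $8^*$ the tangle $t$ belonging to an even vertex $i$ is inserted with its ends NW, SW, SE, NE on the edges to $i+1,i+2,i-2,i-1$; for an odd vertex $i$ the tangle $t\,0$ is inserted with its ends NW, SW, SE, NE on the edges to $i-2,i+2,i+1,i-1$. A symbol with dots or colons, but without an initial dot and without the name of a basic polyhedron, refers to $6^*$. A symbol with an initial dot, $.a.b.c.d$, is $6^{**}1.a.b.c.d.1$: the tangles sit at the vertices $1,2,4,5$ (a 4-cycle) of the octahedron $6^*$, and $c$ and $d$ are replaced there by $c\,0$ and $d\,0$. The basic polyhedron $9^*$ is the medial graph of the triangular bipyramid; the first tangle $t$ belongs to an edge $e$ at an apex, where $t\,0$ is inserted with its East corner at the apex, and the second tangle $u$ belongs to an equatorial edge $e'$ adjacent to $e$, where $u$ is inserted with its West corner at the common vertex of $e$ and $e'$ and its North corner in a common face of $e$ and $e'$. The two classes of regions of the checkerboard colouring are called WE and NS: WE is the class of the regions to the West and East of the tangles $t$, $t\,0$,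 $u$ so placed (hence, inside a tangle, the class of the regions to the West and East of each crossing as drawn). For a chosen colour, the graph $G(D)$ of a diagram $D$ has the regions of that colour as vertices and one edge for each crossing, joining the two regions of that colour that meet there. The Jones polynomial of an oriented diagram $L$ with writhe $w$ is $V_L=(-A^3)^{-w}\langle L\rangle$, where $\langle\cdot\rangle$ is the Kauffman bracket (value $1$ on the unknot circle) and $t=A^{-4}$. Write $f\doteq g$ if $f=\pm A^mg$ for some $m\in\mathbb Z$. For a diagram $D$ with the chosen colour let $D^\circ$ be $D$ if the colour is NS and the mirror image of $D$ if it is WE. **Notation for the formulas.** For integers $n$ put $[n]_x=\frac{x^n-1}{x-1}$ and $[n]_y=\frac{y^n-1}{y-1}$. All formulas below are elements of $\mathbb Q(x,y)$ depending on integers $p,q,r,s,t$; the letter $t$ in the list is always an integer parameter. An overline exchanges $x$ and $y$: $\overline F(\dots)(x,y)=F(\dots)(y,x)$. Auxiliary functions: $H(p,r,s)=[p]_x\overline F_1(r)\overline F_1(s)+\overline F_1(r+s)$, $J(q,r,s)=\overline F_1(r)\overline F_1(s)+(y[q-1]_y+1)\overline F_1(r+s)$, $K(p,q,r,s)=[p]_x\overline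 F_1(q)\overline F_1(r)\overline F_1(s)+J(q,r,s)$, $M(p,q,r,s)=[q]_y\,F_{6}(p,r,s)+x^pF_1(r+s)$, $N(p,q,r,s)=[q]_y\,F_1(p)F_{2}(r,s)+F_{2}(p+r,s)$. **Theorem.** Let $D$ run through the diagrams of one of the 178 families listed below (these, together with the antiprismatic basic polyhedra, are the families of knots and links derived from source links with at most $10$ crossings), with the colour listed there, and let $F$ be the listed function. (1) If all parameters are positive integers, then $T(G(D))(x,y)=F(x,y)$. (2) If all parameters are positive integers (alternating links), then for every orientation $V_{D^\circ}\doteq T(G(D))(-t,-t^{-1})$. (3) If all parameters are nonzero integers (positive or negative; alternating and non-alternating links), then for every orientation $V_{D^\circ}\doteq F(-t,-t^{-1})$. (4) For $n\ge3$ and either colour, the graph of the basic polyhedron $(2n)^*$ (a wheel with $n$ spokes) satisfies $$T(G((2n)^*))=W_n(x,y):=\Bigl(\tfrac{1+x+y+\sqrt{(1+x+y)^2-4xy}}2\Bigr)^n+\Bigl(\tfrac{1+x+y-\sqrt{(1+x+y)^2-4xy}}2\Bigr)^n+xy-x-y-1,$$ and $V_{((2n)^*)^\circ}\doteq W_n(-t,-t^{-1})$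 for every orientation. (These hold over every field of characteristic $0$, for every choice of the square root and every $A\ne0$.) **The families.** (Each line: symbol, colour, function of the parameters in alphabetical order.) 1. $p$ (WE): $F_{1}(p)=[p]_x+y-1$. 2. $p\,q$ (NS): $F_{2}(p,q)=[p]_x [q]_y+x^{p}+y^{q}-1$. 3. $p\,1\,q$ (WE): $F_{3}(p,q)=x [p]_x [q]_x+\frac{(x^{p}+x^{q}+x y-x-y-1) y}{x-1}$. 4. $p\,q\,r$ (WE): $F_{4}(p,q,r)=(x+y) [p]_x [r]_x+\frac{y^{q} (x^{r+1}+x^{p}-x-1)}{x-1}+\frac{[p]_x [r]_x (y^{q}-y^{2})}{y-1}-(x^{r}-y) y^{q}$. 5. $p\,1\,1\,q$ (NS): $F_{5}(p,q)=F_{2}(p,q+1)+F_{1}(p+1) \overline F_{1}(q)$. 6. $p,q,r$ (NS): $F_{6}(p,q,r)=\frac{x^{p+q+r}+(x^{p+1}+x^{q+1}+x^{r+1}) (y-1)-(x^{p}+x^{q}+x^{r}) y}{(x-1)^{2}}+\frac{(x y-x-y) (x y-x-y-1)}{(x-1)^{2}}$. 7. $.p$ (NS): $F_{7}(p)=\frac{x^{p}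 (2 x^{3}+2 x^{2}+y^{2}+2 x y+y)-2 x^{2}-2 x-y^{2}-y-2 x y}{x-1}-x^{p+1} (x+1)+y+2 x y+2 y^{2}+y^{3}$. 8. $p\,q\,1\,r$ (NS): $F_{8}(p,q,r)=(\overline F_{1}(r+1) [q]_y+x \overline F_{1}(r)) [p]_x+y^{q} \overline F_{1}(r+1)$. 9. $p\,1,q,r$ (WE): $F_{9}(p,q,r)=(\overline F_{1}(r+1) [q]_y+x \overline F_{1}(r)) [p]_x+y \overline F_{1}(q+r)$. 10. $p,q,r+$ (NS): $F_{10}(p,q,r)=F_{6}(p,q,r)+F_{1}(p) F_{1}(q) F_{1}(r)$. 11. $p\,1\,1\,1\,q$ (WE): $F_{11}(p,q)=F_{4}(p,2,q)+F_{1}(p+1) F_{1}(q+1)$. 12. $.p\,1$ (WE): $F_{12}(p)=F_{7}(p)+(x+x^{2}+y+2 x y+2 y^{2}+y^{3}) F_{1}(p)$. 13. $.p:q$ (NS): $F_{13}(p,q)=\frac{[q]_x}{x-1} (x^{p} (x^{3}+x^{2}+x+y)+(2 x+y+1) (x y-x-y))+[p]_x (x+y)^{2}+x+y+y^{2}+y^{3}$.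 14. $.p.q$ (NS): $F_{14}(p,q)=[p]_x \frac{(1+2 x+x^{2}+y) (x y-x-y)+y^{q} (x+x^{2}+y+x y+y^{2})}{y-1}+2 y [q+2]_y-y-y^{q+2}+x y [q]_y+x y+x+x^{2}$. 15. $.p:q\,0$ (NS): $F_{15}(p,q)=[p]_x ([q]_y (x+y)^{2}+x+x^{2}+x^{3}+y)+2 y [q+2]_y-2 y-y^{q+2}-x y^{q}+x y [q]_y+2 x y+x+x^{2}+[q+1]_y-1$. 16. $.p.q\,0$ (NS): $F_{16}(p,q)=F_{3}(p+q,2)+F_{11}(p,q)$. 17. $p\,1,q\,1,r$ (WE): $F_{17}(p,q,r)=F_{4}(p,2,q) [r]_y+F_{1}(p+1) F_{1}(q+1)$. 18. $p\,1,q,r+$ (WE): $F_{18}(p,q,r)=F_{9}(p,q,r)+F_{1}(p+1) \overline F_{1}(q) \overline F_{1}(r)$. 19. $p\,1\,1,q,r$ (NS): $F_{19}(p,q,r)=F_{6}(p+1,q,r)+F_{6}(1,q,r) F_{1}(p)$. 20. $p\,1\,q\,1\,r$ (WE): $F_{20}(p,q,r)=F_{3}(p+q,r)+F_{3}(q,r)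 F_{1}(p)$. 21. $p,q,r,s$ (NS): $F_{21}(p,q,r,s)=[s]_x F_{6}(p,q,r)+F_{1}(p) F_{1}(q) F_{1}(r)$. 22. $p\,1\,1\,1\,1\,q$ (NS): $F_{22}(p,q)=F_{5}(p+1,q)+\overline F_{3}(q,2) F_{1}(p)$. 23. $p\,q\,1\,1\,r$ (WE): $F_{23}(p,q,r)=F_{4}(p,q+1,r)+F_{2}(p,q) F_{1}(r+1)$. 24. $p\,q\,r\,s$ (NS): $F_{24}(p,q,r,s)=[s]_y F_{4}(p,q,r)+x^{r} F_{1}(p+1)+x^{r} y [q-1]_y F_{1}(p)$. 25. $p\,q,r,s$ (WE): $F_{25}(p,q,r,s)=H(p,r,s)+[q]_y F_{1}(p) \overline F_{1}(r+s)$. 26. $p,q,r+s$ (NS): $F_{26}(p,q,r,s)=[s]_y F_{1}(p) F_{1}(q) F_{1}(r)+F_{6}(p,q,r)$. 27. $(p,q)\,(r,s)$ (WE): $F_{27}(p,q,r,s)=[q]_x H(p,r,s)+F_{1}(p) \overline F_{1}(r+s)$. 28. $p\,q\,1\,r\,s$ (WE): $F_{28}(p,q,r,s)=F_{4}(p,q+r,s)+F_{2}(p,q)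 F_{2}(s,r)$. 29. $p\,q\,r\,1\,s$ (WE): $F_{29}(p,q,r,s)=F_{4}(p,q,r+s)+F_{4}(p,q,r) F_{1}(s)$. 30. $p\,1\,q\,1\,1\,r$ (NS): $F_{30}(p,q,r)=F_{5}(p+q,r)+F_{5}(q,r) F_{1}(p)$. 31. $p\,q\,1\,1\,1\,r$ (NS): $F_{31}(p,q,r)=F_{8}(p,q+1,r)+F_{2}(p,q) F_{2}(2,r)$. 32. $p\,1\,1\,1\,1\,1\,q$ (WE): $F_{32}(p,q)=F_{11}(p,q+1)+F_{5}(p,2) F_{1}(q)$. 33. $p\,1,q\,1,r\,1$ (WE): $F_{33}(p,q,r)=F_{20}(p,q,r)+F_{4}(p,2,r) F_{1}(q)$. 34. $p\,1\,q,r,s$ (NS): $F_{34}(p,q,r,s)=F_{6}(p+q,r,s)+F_{6}(q,r,s) F_{1}(p)$. 35. $p\,q\,1,r,s$ (NS): $F_{35}(p,q,r,s)=F_{26}(p,r,s,q)+F_{2}(p,q) F_{1}(r+s)$. 36. $p\,1\,1\,1,q,r$ (WE): $F_{36}(p,q,r)=F_{25}(p,2,q,r)+\overline F_{3}(q,r)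 F_{1}(p+1)$. 37. $p\,1,q,r,s$ (WE): $F_{37}(p,q,r,s)=K(p,q,r,s)+J(q,r,s) F_{1}(p)$. 38. $p\,q,r\,1,s$ (WE): $F_{38}(p,q,r,s)=F_{24}(p,q,r,s)+F_{2}(p,q+s) F_{1}(r)$. 39. $p\,1\,1,q\,1,r$ (NS): $F_{39}(p,q,r)=F_{23}(r,q,p)+F_{3}(p,r+1) \overline F_{1}(q)$. 40. $p\,1,q,r+s$ (WE): $F_{40}(p,q,r,s)=H(p+s,q,r)+H(s,q,r) F_{1}(p)$. 41. $p,q,r,s+$ (NS): $F_{41}(p,q,r,s)=F_{21}(p,q,r,s)+F_{1}(p) F_{1}(q) F_{1}(r) F_{1}(s)$. 42. $p\,q,r,s+$ (WE): $F_{42}(p,q,r,s)=F_{25}(p,q,r,s)+F_{2}(p,q) \overline F_{1}(r) \overline F_{1}(s)$. 43. $p\,1\,1,q,r+$ (NS): $F_{43}(p,q,r)=F_{26}(p,q,r,2)+F_{3}(q,r) F_{1}(p+1)$. 44. $(p,q+)\,(r,s)$ (WE): $F_{44}(p,q,r,s)=F_{27}(p,q,r,s)+F_{1}(p) F_{1}(q)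 \overline F_{1}(r+s)$. 45. $(p,q)\,1\,(r,s)$ (NS): $F_{45}(p,q,r,s)=F_{21}(p,q,r,s)+F_{1}(p+q) F_{1}(r+s)$. 46. $p\,1,q\,1,r+$ (WE): $F_{46}(p,q,r)=F_{17}(p,q,r)+F_{1}(p+1) F_{1}(q+1) \overline F_{1}(r)$. 47. $(p\,1,q)\,(r,s)$ (NS): $F_{47}(p,q,r,s)=M(p,q,r,s)+F_{4}(s,q,r) F_{1}(p)$. 48. $.p\,q$ (WE): $F_{48}(p,q)=F_{25}(p,q,2,2)+F_{26}(p,2,2,q)$. 49. $.p\,1\,1$ (NS): $F_{49}(p)=F_{12}(p)+F_{1}(p+1) (x+2 x^{2}+x^{3}+y+2 x y+y^{2})$. 50. $.p\,1:q$ (WE): $F_{50}(p,q)=F_{15}(p,q)+F_{1}(p) \overline F_{6}(q,2,2)$. 51. $.p\,1.q$ (WE): $F_{51}(p,q)=F_{17}(p,q,2)+F_{21}(p,q+1,2,1)$. 52. $.p\,1:q\,0$ (WE): $F_{52}(p,q)=F_{13}(p,q)+([q]_x (x+y)^{2}+[4]_y+x-1) F_{1}(p)$. 53. $.p\,1.q\,0$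 (WE): $F_{53}(p,q)=F_{14}(p,q)+(\overline F_{1}(q+1) (x+y)+\overline F_{1}(q+3)) F_{1}(p)$. 54. $.p.q\,0.r$ (NS): $F_{54}(p,q,r)=F_{6}(p+1,q,r+1)+F_{6}(p+q,r,1)+F_{6}(q,r,1) F_{1}(p)$. 55. $p:q\,0:r\,0$ (NS): $F_{55}(p,q,r)=H(p,q+1,r+1)+F_{27}(p,2,q,r)$. 56. $p\,0:q\,0:r\,0$ (WE): $F_{56}(p,q,r)=F_{6}(p+1,q,r+1)+F_{6}(p,q+1,r)+y F_{6}(p,q,r)$. 57. $.p.q.r$ (NS): $F_{57}(p,q,r)=F_{24}(p+1,1,r,q)+F_{23}(p,q,r)$. 58. $p:q:r$ (NS): $F_{58}(p,q,r)=F_{6}(p+r,2,q)+F_{20}(p,q,r)$. 59. $.p.q.r\,0$ (NS): $F_{59}(p,q,r)=F_{9}(p+1,q,r)+F_{25}(p,q,r+1,1)$. 60. $p:q:r\,0$ (NS): $F_{60}(p,q,r)=F_{4}(p+q,r,2)+F_{17}(p,q,r)$. 61. $.(p,q)$ (WE): $F_{61}(p,q)=F_{21}(p,2,2,q)+F_{27}(p,q,2,2)$.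 62. $8^*p$ (NS): $F_{62}(p)=F_{20}(2,p,2)+F_{15}(p,2)$. 63. $8^*p\,0$ (WE): $F_{63}(p)=F_{11}(p+1,2)+F_{12}(p)$. 64. $p\,q\,r\,s\,t$ (WE): $F_{64}(p,q,r,s,t)=[q]_y F_{1}(p) F_{4}(r,s,t)+F_{4}(p+r,s,t)$. 65. $p\,1\,q\,r\,1\,s$ (NS): $F_{65}(p,q,r,s)=F_{8}(p+q,r,s)+F_{8}(q,r,s) F_{1}(p)$. 66. $p\,q\,1\,1\,r\,s$ (NS): $F_{66}(p,q,r,s)=N(p,q+1,r,s)+F_{2}(p,q) F_{2}(r+1,s)$. 67. $p\,q\,1\,r\,1\,s$ (NS): $F_{67}(p,q,r,s)=F_{8}(p,q,r+s)+F_{8}(p,q,r) \overline F_{1}(s)$. 68. $p\,q\,r\,1\,1\,s$ (NS): $F_{68}(p,q,r,s)=N(p,q,r+1,s)+F_{4}(p,q,r) \overline F_{1}(s+1)$. 69. $p\,1\,1\,q\,1\,1\,r$ (WE): $F_{69}(p,q,r)=F_{23}(p+1,q,r)+F_{5}(r,q+1) F_{1}(p)$. 70. $p\,1\,q\,1\,1\,1\,r$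 (WE): $F_{70}(p,q,r)=F_{11}(p+q,r)+F_{11}(q,r) F_{1}(p)$. 71. $p\,q\,1\,1\,1\,1\,r$ (WE): $F_{71}(p,q,r)=F_{23}(p,q,r+1)+F_{23}(p,q,1) F_{1}(r)$. 72. $p\,1\,1\,1\,1\,1\,1\,q$ (NS): $F_{72}(p,q)=F_{22}(p+1,q)+\overline F_{11}(2,q) F_{1}(p)$. 73. $p,q,r,s,t$ (NS): $F_{73}(p,q,r,s,t)=[t]_x F_{21}(p,q,r,s)+F_{1}(p) F_{1}(q) F_{1}(r) F_{1}(s)$. 74. $p\,1,q,r\,1,s$ (WE): $F_{74}(p,q,r,s)=[s]_y F_{17}(p,r,q)+F_{1}(p+1) \overline F_{1}(q) F_{1}(r+1)$. 75. $p\,q\,r,s,t$ (NS): $F_{75}(p,q,r,s,t)=[t]_x F_{4}(p,q,r+s)+F_{4}(p,q,r) F_{1}(s)$. 76. $p\,1\,1\,q,r,s$ (WE): $F_{76}(p,q,r,s)=F_{25}(p+1,q,r,s)+J(q+1,r,s) F_{1}(p)$. 77. $p\,1\,q\,1,r,s$ (WE): $F_{77}(p,q,r,s)=F_{9}(p+q,r,s)+F_{9}(q,r,s)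 F_{1}(p)$. 78. $p\,q\,1\,1,r,s$ (WE): $F_{78}(p,q,r,s)=F_{25}(p,q+1,s,r)+\overline F_{3}(s,r) F_{2}(p,q)$. 79. $p\,1\,1\,1\,1,q,r$ (NS): $F_{79}(p,q,r)=F_{43}(p,q,r)+F_{3}(p,2) F_{1}(q+r)$. 80. $p\,q,r\,s,t$ (WE): $F_{80}(p,q,r,s,t)=[t]_y F_{4}(p,q+s,r)+F_{2}(p,q) F_{2}(r,s)$. 81. $p\,1\,1,q\,1\,1,r$ (NS): $F_{81}(p,q,r)=F_{43}(q,p,r)+F_{3}(q,r+1) F_{1}(p+1)$. 82. $p\,q,r\,1,s\,1$ (WE): $F_{82}(p,q,r,s)=F_{29}(p,q,r,s)+F_{4}(p,q+1,s) F_{1}(r)$. 83. $p\,1\,1,q\,1,r\,1$ (NS): $F_{83}(p,q,r)=F_{5}(p,q+r)+F_{5}(p,q) \overline F_{1}(r)+F_{24}(p,1,2,r) \overline F_{1}(q)$. 84. $p\,q,r,s,t$ (WE): $F_{84}(p,q,r,s,t)=[t]_y F_{25}(p,q,r,s)+\overline F_{1}(r) \overline F_{1}(s) F_{2}(p,q)$.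 85. $p\,1\,1,q,r,s$ (NS): $F_{85}(p,q,r,s)=F_{21}(p+1,q,r,s)+F_{6}(q,r,s) F_{1}(p)+F_{1}(p) F_{1}(q) F_{1}(r) F_{1}(s)$. 86. $p\,1,q\,1,r,s$ (WE): $F_{86}(p,q,r,s)=H(p+q,r,s)+F_{9}(p,r,s) F_{1}(q)+H(q,r,s) F_{1}(p)$. 87. $p\,1\,q,r\,1,s$ (NS): $F_{87}(p,q,r,s)=F_{29}(s,r,q,p)+F_{6}(s+q,1,p) \overline F_{1}(r)$. 88. $p\,q\,1,r\,1,s$ (NS): $F_{88}(p,q,r,s)=F_{4}(p,q+r,s)+F_{2}(p,q) F_{2}(s+1,r)+F_{4}(p,q,s) \overline F_{1}(r)$. 89. $p\,1\,1\,1,q\,1,r$ (WE): $F_{89}(p,q,r)=F_{17}(p+1,q,r)+F_{9}(q,2,r) F_{1}(p)$. 90. $p\,1\,1,q\,r,s$ (NS): $F_{90}(p,q,r,s)=\overline F_{25}(q,r,s,p+1)+F_{2}(r+s,q) F_{1}(p)+F_{2}(r,q) F_{1}(s) F_{1}(p)$. 91. $p,q,r,s+t$ (NS): $F_{91}(p,q,r,s,t)=[t]_y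 F_{1}(p) F_{1}(q) F_{1}(r) F_{1}(s)+F_{21}(p,q,r,s)$. 92. $p\,q,r,s+t$ (WE): $F_{92}(p,q,r,s,t)=[t]_x F_{2}(p,q) \overline F_{1}(r) \overline F_{1}(s)+F_{25}(p,q,r,s)$. 93. $p\,1\,1,q,r+s$ (NS): $F_{93}(p,q,r,s)=\overline K(s,q,r,p+1)+F_{4}(q,s+1,r) F_{1}(p)$. 94. $p\,1,q\,1,r+s$ (WE): $F_{94}(p,q,r,s)=F_{40}(q,r,1,p+s-1)+F_{40}(q,r,1,s-1) F_{1}(p)$. 95. $p\,1,q\,1,r\,1+$ (WE): $F_{95}(p,q,r)=F_{20}(p,r+1,q)+F_{11}(p,q) F_{1}(r)$. 96. $p\,1\,q,r,s+$ (NS): $F_{96}(p,q,r,s)=F_{21}(p+q,1,r,s)+F_{21}(q,1,r,s) F_{1}(p)$. 97. $p\,q\,1,r,s+$ (NS): $F_{97}(p,q,r,s)=\overline K(q+1,r,s,p)+F_{2}(p,q) F_{6}(1,r,s)$. 98. $p\,1\,1\,1,q,r+$ (WE): $F_{98}(p,q,r)=F_{36}(p,q,r)+F_{3}(p,2) \overline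 F_{1}(q) \overline F_{1}(r)$. 99. $p\,1,q,r,s+$ (WE): $F_{99}(p,q,r,s)=F_{37}(p,q,r,s)+F_{1}(p+1) \overline F_{1}(q) \overline F_{1}(r) \overline F_{1}(s)$. 100. $p\,q,r\,1,s+$ (WE): $F_{100}(p,q,r,s)=F_{38}(p,q,r,s)+F_{2}(p,q) F_{1}(r+1) \overline F_{1}(s)$. 101. $p\,1\,1,q\,1,r+$ (NS): $F_{101}(p,q,r)=F_{23}(r,q+1,p)+F_{11}(p,r) \overline F_{1}(q)$. 102. $(p\,q,r)\,(s,t)$ (NS): $F_{102}(p,q,r,s,t)=[t]_x F_{24}(p,q,s,r)+F_{2}(p,q+r) F_{1}(s)$. 103. $(p\,1\,1,q)\,(r,s)$ (WE): $F_{103}(p,q,r,s)=F_{27}(p+1,q,r,s)+F_{27}(1,q,r,s) F_{1}(p)$. 104. $(p\,1,q\,1)\,(r,s)$ (NS): $F_{104}(p,q,r,s)=[s]_x F_{20}(p,r,q)+F_{4}(p,2,q) F_{1}(r)$. 105. $(p\,1,q)\,(r\,1,s)$ (NS): $F_{105}(p,q,r,s)=F_{38}(s,r,p,q)+F_{24}(p,1,s,q)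 \overline F_{1}(r)$. 106. $(p,q,r)\,(s,t)$ (WE): $F_{106}(p,q,r,s,t)=[p]_x F_{27}(q,r,s,t)+\overline F_{1}(s+t) F_{1}(q) F_{1}(r)$. 107. $(p\,1,q+)\,(r,s)$ (NS): $F_{107}(p,q,r,s)=F_{47}(p,q,r,s)+F_{1}(r+s) F_{1}(p+1) \overline F_{1}(q)$. 108. $(p,q+)\,(r\,1,s)$ (WE): $F_{108}(p,q,r,s)=F_{47}(r,s,p,q)+F_{2}(r,s+1) F_{1}(p) F_{1}(q)$. 109. $(p,q+)\,(r,s+)$ (WE): $F_{109}(p,q,r,s)=F_{44}(p,q,r,s)+F_{6}(p,q,1) \overline F_{1}(r) \overline F_{1}(s)$. 110. $(p,q+r)\,(s,t)$ (WE): $F_{110}(p,q,r,s,t)=[t]_y F_{4}(p,r+s,q)+F_{4}(p,r,q) \overline F_{1}(s)$. 111. $(p,q)\,r\,(s,t)$ (NS): $F_{111}(p,q,r,s,t)=[t]_x F_{6}(p,q,r+s)+F_{6}(p,q,r) F_{1}(s)$. 112. $(p\,1,q)\,1\,(r,s)$ (WE): $F_{112}(p,q,r,s)=F_{37}(p,q,r,s)+F_{2}(p,q+1)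 \overline F_{1}(r+s)$. 113. $(p,q)\,1\,1\,(r,s)$ (WE): $F_{113}(p,q,r,s)=F_{44}(p,q,r,s)+\overline F_{3}(r,s) F_{1}(p+q)$. 114. $(p,q+)\,1\,(r,s)$ (NS): $F_{114}(p,q,r,s)=F_{73}(p,q,r,s,1)+F_{6}(p,q,1) F_{1}(r+s)$. 115. $(p,q),r,(s,t)$ (WE): $F_{115}(p,q,r,s,t)=[r]_y F_{21}(p,q,s,t)+F_{1}(p+q) F_{1}(s+t)$. 116. $.p\,1\,q$ (NS): $F_{116}(p,q)=F_{7}(p+q)+F_{7}(q) F_{1}(p)$. 117. $.p\,q\,1$ (NS): $F_{117}(p,q)=[q]_y F_{1}(p) (2 x+3 x^{2}+x^{3}+2 y+4 x y+3 y^{2}+y^{3})+F_{7}(p+1)$. 118. $.p\,1\,1\,1$ (WE): $F_{118}(p)=F_{12}(p+1)+(2 x+3 x^{2}+x^{3}+2 y+5 x y+x^{2} y+4 y^{2}+2 x y^{2}+3 y^{3}+y^{4}) F_{1}(p)$. 119. $.p\,q:r$ (WE): $F_{119}(p,q,r)=[q]_y F_{1}(p) F_{25}(1,r-1,2,2)+F_{15}(p,r)$.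 120. $.p\,q.r$ (WE): $F_{120}(p,q,r)=F_{23}(p,q,r+1)+F_{4}(p,q+2,r)+F_{4}(p,q,r) F_{1}(2)$. 121. $.p\,q:r\,0$ (WE): $F_{121}(p,q,r)=[p]_x F_{15}(r,q)+y^{q} H(r,2,2)$. 122. $.p\,q.r\,0$ (WE): $F_{122}(p,q,r)=F_{28}(2,r,q,p)+F_{110}(p,1,q,r,2)$. 123. $.p\,1\,1:q$ (NS): $F_{123}(p,q)=F_{52}(p,q)+F_{6}(2,q,2) F_{1}(p+1)$. 124. $.p\,1\,1.q$ (NS): $F_{124}(p,q)=F_{60}(p+1,1,q)+F_{15}(1,q) F_{1}(p)$. 125. $.p\,1\,1:q\,0$ (NS): $F_{125}(p,q)=F_{50}(p,q)+F_{4}(2,q,2) F_{1}(p+1)$. 126. $.p\,1\,1.q\,0$ (NS): $F_{126}(p,q)=F_{17}(p,q,2)+F_{21}(p,q+1,2,1)+F_{3}(q+1,2) F_{1}(p+1)$. 127. $.p\,1.q\,0.r$ (WE): $F_{127}(p,q,r)=F_{59}(p,q,r)+\overline F_{6}(q+1,r,2) F_{1}(p)$. 128. $.p\,1:q\,1$ (WE):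 $F_{128}(p,q)=F_{52}(q,p)+F_{9}(q,2,2) F_{1}(p)$. 129. $.p\,1.q\,1$ (WE): $F_{129}(p,q)=F_{53}(p,q)+F_{11}(p,2) \overline F_{1}(q)$. 130. $.p\,1:q\,1\,0$ (WE): $F_{130}(p,q)=F_{50}(p,q)+F_{21}(p,2,2,1) \overline F_{1}(q)$. 131. $.p\,1.q\,1\,0$ (WE): $F_{131}(p,q)=F_{51}(q,p)+F_{8}(q,2,2) F_{1}(p)$. 132. $.p\,1\,0.q.r$ (NS): $F_{132}(p,q,r)=F_{57}(r,q,p)+H(r,q+1,2) F_{1}(p)$. 133. $.p\,1.q.r$ (WE): $F_{133}(p,q,r)=F_{145}(p,1,r,q)+F_{9}(q,r,2) F_{1}(p)$. 134. $.p.q\,1\,0.r$ (NS): $F_{134}(p,q,r)=F_{57}(p,q,r)+F_{3}(p+1,r+1) \overline F_{1}(q)$. 135. $.p.q\,1.r$ (NS): $F_{135}(p,q,r)=F_{54}(p,q,r)+F_{11}(p,r) F_{1}(q)$. 136. $.p.q\,1.r\,0$ (NS): $F_{136}(p,q,r)=F_{24}(p+1,1,q,r)+F_{27}(p,q,1,r+1)+F_{5}(p,r+1)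 F_{1}(q)$. 137. $.p\,1.q.r\,0$ (WE): $F_{137}(p,q,r)=F_{11}(p,q+r)+F_{43}(r,q,p)$. 138. $p\,1\,0:q\,0:r\,0$ (NS): $F_{138}(p,q,r)=F_{9}(p,q+1,r+1)+F_{44}(p,2,q,r)$. 139. $p\,1:q:r$ (WE): $F_{139}(p,q,r)=F_{8}(p,q,r)+H(p,q+r,2)+F_{2}(p+1,r) \overline F_{1}(q)+\overline F_{3}(q+1,r+1) F_{1}(p)$. 140. $p\,1:q\,0:r\,0$ (WE): $F_{140}(p,q,r)=F_{56}(p,q,r)+F_{11}(q,r) F_{1}(p)$. 141. $p:q:r\,1\,0$ (NS): $F_{141}(p,q,r)=F_{33}(p,q,r)+F_{21}(p+q,r,2,1)$. 142. $p\,1:q:r\,0$ (WE): $F_{142}(p,q,r)=F_{23}(r+1,q,p)+F_{44}(p,r,2,q)$. 143. $p\,1\,0:q:r\,0$ (NS): $F_{143}(p,q,r)=F_{60}(p,q,r)+F_{8}(q,r,2) F_{1}(p)$. 144. $.p.q.r.s$ (NS): $F_{144}(p,q,r,s)=[r]_x (F_{8}(p,q,s)+F_{2}(p+1,s) \overline F_{1}(q))+H(p,q+1,s+1)$.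 145. $.p.q.r\,0.s\,0$ (NS): $F_{145}(p,q,r,s)=F_{28}(p,q,r,s)+F_{9}(p+s,q,r)$. 146. $.p.q.r.s\,0$ (NS): $F_{146}(p,q,r,s)=F_{24}(r+s,1,p,q)+F_{26}(p,r,s,q)+F_{2}(r,q) F_{1}(p+s)$. 147. $.p.q\,0.r.s\,0$ (NS): $F_{147}(p,q,r,s)=F_{21}(p,q,r,s)+F_{3}(p+q,r+s)+F_{1}(p+s) F_{1}(q+r)$. 148. $p\,0.q.r\,0.s\,0$ (WE): $F_{148}(p,q,r,s)=F_{29}(r,s,q,p)+F_{4}(p+r,s,q)+F_{1}(p+q+r) \overline F_{1}(s)$. 149. $p\,0.q.r.s\,0$ (WE): $F_{149}(p,q,r,s)=F_{8}(p+q,r,s)+F_{38}(q,s,p,r)$. 150. $p.q\,0.r.s\,0$ (NS): $F_{150}(p,q,r,s)=F_{6}(p,q,r+s)+F_{6}(p,r,q+s)+F_{6}(p,q,r) F_{1}(s)+x^{p} F_{1}(q+r+s)$. 151. $p.q.r\,0.s$ (NS): $F_{151}(p,q,r,s)=F_{25}(p+1,q,r,s)+F_{25}(p,r,q,s+1)$.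 152. $p.q.r\,0.s\,0$ (NS): $F_{152}(p,q,r,s)=F_{24}(p+1,q,s,r)+F_{38}(p,r,s,q)$. 153. $p.q.r.s$ (NS): $F_{153}(p,q,r,s)=F_{24}(p+1,q,r,s)+F_{27}(p,r,q,s+1)$. 154. $p.q.r.s\,0$ (NS): $F_{154}(p,q,r,s)=M(s,q,p+1,r)+F_{29}(p,q,r,s)$. 155. $.(p\,1,q)$ (NS): $F_{155}(p,q)=F_{47}(p,q,2,2)+F_{37}(p,q,2,2)$. 156. $.(p,q)\,1$ (NS): $F_{156}(p,q)=F_{61}(p,q)+F_{1}(p+q) (x+2 x^{2}+x^{3}+y+2 x y+y^{2})$. 157. $.(p,q+)$ (WE): $F_{157}(p,q)=F_{61}(p,q)+F_{1}(p) F_{1}(q) (x+x^{2}+y+2 x y+2 y^{2}+y^{3})$. 158. $.(p,q).r$ (WE): $F_{158}(p,q,r)=F_{21}(p,q,r,2)+M(r,2,p,q)+F_{1}(p+q) F_{1}(r+2)+F_{2}(r,2) F_{1}(p) F_{1}(q)$. 159. $.(p,q).r\,0$ (WE): $F_{159}(p,q,r)=F_{27}(p,q,r+1,2)+F_{26}(p,q,2,r)+F_{6}(p,q,2)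 \overline F_{1}(r)$. 160. $.(p,q):r$ (WE): $F_{160}(p,q,r)=[q]_x F_{15}(p,r)+\overline F_{6}(r,2,2) F_{1}(p)$. 161. $.(p,q):r\,0$ (WE): $F_{161}(p,q,r)=[r]_x F_{21}(p,q,2,2)+F_{27}(p,q,2,2)$. 162. $8^*p\,0::q\,0$ (WE): $F_{162}(p,q)=[q]_x F_{13}(p,2)+F_{8}(p,2,2)+F_{2}(p+1,2) (x+y)$. 163. $8^*p\,0:.q\,0$ (WE): $F_{163}(p,q)=F_{59}(p,2,q)+F_{44}(p,2,q,1)+F_{2}(2,q) F_{1}(p+2)$. 164. $8^*p\,0:q\,0$ (WE): $F_{164}(p,q)=F_{61}(p,q)+F_{11}(p+1,q+1)$. 165. $8^*p\,0.q\,0$ (WE): $F_{165}(p,q)=F_{144}(1,q,p,2)+F_{47}(2,q,p,2)$. 166. $8^*p\,1$ (WE): $F_{166}(p)=F_{63}(p)+F_{1}(p) (x+2 x^{2}+x^{3}+y+4 x y+2 x^{2} y+3 y^{2}+3 x y^{2}+3 y^{3}+y^{4})$. 167. $8^*p\,1\,0$ (NS): $F_{167}(p)=F_{62}(p)+F_{1}(p)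 (2 x+3 x^{2}+x^{3}+2 y+5 x y+x^{2} y+4 y^{2}+2 x y^{2}+3 y^{3}+y^{4})$. 168. $8^*p::q$ (NS): $F_{168}(p,q)=F_{11}(p+1,q+1)+F_{148}(1,p,q,2)$. 169. $8^*p:.q$ (NS): $F_{169}(p,q)=F_{22}(p+1,q)+F_{148}(1,p,1,q+1)$. 170. $8^*p:q$ (NS): $F_{170}(p,q)=F_{7}(p+q)+F_{20}(p,2,q)+F_{2}(p,2) F_{2}(q,2)$. 171. $8^*p.q$ (NS): $F_{171}(p,q)=F_{59}(p,q,1)+H(p,q+1,3)+F_{2}(p+1,q+1) (x+y)+x F_{40}(2,q,1,p-1)$. 172. $8^*p::q\,0$ (NS): $F_{172}(p,q)=F_{14}(p+1,q)+F_{36}(p,q,2)$. 173. $8^*p:.q\,0$ (NS): $F_{173}(p,q)=F_{52}(q,p)+F_{20}(q+1,p,2)$. 174. $8^*p:q\,0$ (NS): $F_{174}(p,q)=F_{22}(p,q+1)+K(p,q,2,2)+M(p,q,2,2)$. 175. $8^*p.q\,0$ (NS): $F_{175}(p,q)=[q]_x F_{7}(p+1)+F_{22}(p,2)$. 176. $9^*.p$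 (WE): $F_{176}(p)=[p]_x (3 x+6 x^{2}+4 x^{3}+x^{4}+3 y+9 x y+4 x^{2} y+6 y^{2}+4 x y^{2}+4 y^{3}+y^{4})+x+2 x^{2}+x^{3}+y+4 x y+3 x^{2} y+3 y^{2}+5 x y^{2}+4 y^{3}+2 x y^{3}+3 y^{4}+y^{5}$. 177. $9^*p$ (NS): $F_{177}(p)=[p]_x (2 x+5 x^{2}+5 x^{3}+3 x^{4}+x^{5}+2 y+6 x y+4 x^{2} y+x^{3} y+3 y^{2}+2 x y^{2}+y^{3})+2 x+4 x^{2}+3 x^{3}+x^{4}+2 y+7 x y+5 x^{2} y+x^{3} y+5 y^{2}+5 x y^{2}+4 y^{3}+y^{4}$. 178. $9^*.p\,0$ (WE): $F_{178}(p)=[p-1]_y y (x+2 x^{2}+x^{3}+y+4 x y+3 x^{2} y+3 y^{2}+5 x y^{2}+4 y^{3}+2 x y^{3}+3 y^{4}+y^{5})+4 x+8 x^{2}+5 x^{3}+x^{4}+4 y+13 x y+7 x^{2} y+9 y^{2}+9 x y^{2}+8 y^{3}+2 x y^{3}+4 y^{4}+y^{5}$. -/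

import Mathlib

/-! ## Tutte polynomial of a finite multigraph -/

/-- Merge the vertex `v` into the vertex `u`. -/
noncomputable def mergeVertex {V : Type*} (u v w : V) : V :=
  open Classical in if w = v then u else w

/-- The contraction `G / e` of a graph `e :: G` along an edge `e = (u, v)`: the edge is removed and
its ends are merged. A finite multigraph is given by the list of its edges, an edge being the pair
of its ends; loops and multiple edges are allowed and isolated vertices play no role. -/
noncomputable def contract {V : Type*} (e : V × V) (G : List (V × V)) : List (V × V) :=
  G.map fun f => (mergeVertex e.1 e.2 f.1, mergeVertex e.1 e.2 f.2)

/-- The edge `e` is a bridge of the graph `e :: G`: its ends are not joined by a path of `G`. -/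
def IsBridgeOver {V : Type*} (e : V × V) (G : List (V × V)) : Prop :=
  ¬ Relation.EqvGen (fun a b => (a, b) ∈ G) e.1 e.2

open Classical in
/-- The Tutte polynomial in `ℤ[x, y]` (`x = X 0`, `y = X 1`) by deletion and contraction:
`T = 1` without edges, `y T(G - e)` for a loop, `x T(G / e)` for a bridge and
`T(G - e) + T(G / e)` otherwise. -/
noncomputable def tutte {V : Type*} : List (V × V) → MvPolynomial (Fin 2) ℤ
  | [] => 1
  | e :: G =>
    if e.1 = e.2 then MvPolynomial.X 1 * tutte G
    else if IsBridgeOver e G then MvPolynomial.X 0 * tutte (contract e G)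
    else tutte G + tutte (contract e G)
termination_by G => G.length
decreasing_by all_goals simp [contract]

/-! ## Link diagrams -/

/-- Names of the arcs of a diagram: a path in a construction tree and an index. -/
abbrev Arc := List ℕ × ℕ

/-- A crossing of a link diagram: the four arcs that end there in counterclockwise order, and
whether the strand `a`-`c` is the lower one (otherwise the strand `b`-`d` is). -/
structure Crossing where
  a : Arc
  b : Arc
  c : Arc
  d : Arc
  under : Bool

/-- A planar diagram code: every arc name occurs at exactly two ends of crossings. -/
abbrev Diagram := List Crossing

/-- The mirror image: all crossings are changed. -/
def Diagram.mirror (D : Diagram) : Diagram :=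
  D.map fun c => { c with under := !c.under }

/-- The two colours of the checkerboard colouring. All diagrams built below list the arcs at every
crossing in such a way that the corners `a`-`b` and `c`-`d` have the colour `WE` (the corners West
and East of an unreflected crossing) and the corners `b`-`c` and `d`-`a` have the colour `NS`. -/
inductive Colour
  | WE
  | NS

/-- The two corners of the given colour at a crossing, each as the pair of arcs bounding it. -/
def Crossing.corners (c : Crossing) : Colour → (Arc × Arc) × (Arc × Arc)
  | .WE => ((c.a, c.b), (c.c, c.d))
  | .NS => ((c.b, c.c), (c.d, c.a))

/-- Two arcs that are consecutive around a corner of the given colour. Every arc borders exactly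
one region of each colour, so the regions of that colour are the classes of arcs under the
equivalence relation generated by this one. -/
def Adjacent (k : Colour) (D : Diagram) (s t : Arc) : Prop :=
  ∃ c ∈ D, (s, t) = (c.corners k).1 ∨ (s, t) = (c.corners k).2

/-- The regions of the given colour. -/
abbrev Region (k : Colour) (D : Diagram) : Type := Quot (Adjacent k D)

/-- The checkerboard (Tait) graph: the vertices are the regions of the given colour, and every
crossing is an edge between the two regions of that colour that meet there. -/
def taitGraph (k : Colour) (D : Diagram) : List (Region k D × Region k D) :=
  D.map fun c => (Quot.mk _ (c.corners k).1.1, Quot.mk _ (c.corners k).2.1)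

/-! ## Jones polynomial -/

/-- The pairs of arcs joined by the `A`-smoothing, which merges the two regions swept when the
upper strand turns counterclockwise, and by the `B`-smoothing. -/
def Crossing.smoothing (c : Crossing) (isA : Bool) : List (Arc × Arc) :=
  if c.under = isA then [(c.a, c.b), (c.c, c.d)] else [(c.b, c.c), (c.d, c.a)]

/-- The number of closed curves obtained by joining arcs according to the list `J`. -/
noncomputable def loopCount (J : List (Arc × Arc)) : ℕ :=
  Nat.card (Quot fun s t : {l : Arc // ∃ j ∈ J, l = j.1 ∨ l = j.2} => (s.1, t.1) ∈ J)

/-- The Kauffman bracket of a diagram with crossings `D`, where `J` lists the joins made so far: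
`⟨D⟩ = A ⟨D_A⟩ + A⁻¹ ⟨D_B⟩`, and `m ≥ 1` disjoint circles have the value `(-A² - A⁻²) ^ (m - 1)`. -/
noncomputable def bracketAux {K : Type*} [Field K] (A : K) : Diagram → List (Arc × Arc) → K
  | [], J => (-A ^ 2 - (A ^ 2)⁻¹) ^ (loopCount J - 1)
  | c :: D, J => A * bracketAux A D (c.smoothing true ++ J) +
      A⁻¹ * bracketAux A D (c.smoothing false ++ J)

/-- The Kauffman bracket, normalized to `1` on the crossingless unknot. -/
noncomputable def bracket {K : Type*} [Field K] (A : K) (D : Diagram) : K := bracketAux A D []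

/-- The arcs entering (`dir = true`) or leaving (`dir = false`) a crossing, if the strand `a`-`c`
runs from `a` to `c` exactly when `o.1` and the strand `b`-`d` from `b` to `d` exactly when
`o.2`. -/
def Crossing.ends (c : Crossing) (o : Bool × Bool) (dir : Bool) : List Arc :=
  [if o.1 = dir then c.a else c.c, if o.2 = dir then c.b else c.d]

/-- `o` orients the link: it directs both strands at every crossing, and every arc enters one
crossing and leaves one. -/
def IsOrientation (D : Diagram) (o : List (Bool × Bool)) : Prop :=
  o.length = D.length ∧
    ((D.zip o).flatMap fun z => z.1.ends z.2 true).Perm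
      ((D.zip o).flatMap fun z => z.1.ends z.2 false)

/-- The writhe: the sum of the signs of the crossings. -/
def writhe (D : Diagram) (o : List (Bool × Bool)) : ℤ :=
  ((D.zip o).map fun z => if (z.2.1 ^^ z.2.2) = z.1.under then (1 : ℤ) else -1).sum

/-- The Jones polynomial `(-A ^ 3) ^ (-w) ⟨D⟩` of an oriented link, in the variable `A` with
`t = A ^ (-4)`. -/
noncomputable def jones {K : Type*} [Field K] (A : K) (D : Diagram) (o : List (Bool × Bool)) : K :=
  (-A ^ 3) ^ (-writhe D o) * bracket A D

/-! ## Conway notation -/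

/-- Tangles built from single crossings by reflection in the NW-SE axis (the operation `t 0`) and by
horizontal addition. The crossing `1` is `crossing true`, the crossing `-1` is `crossing false`. -/
inductive Tangle
  | crossing (positive : Bool)
  | reflect (s : Tangle)
  | add (s t : Tangle)

namespace Tangle

/-- The crossings of a tangle whose four ends carry the given arcs; `π` is used to name the
internal arcs. In the crossing `1` the upper strand runs from SW to NE. -/
def crossings : Tangle → (π : List ℕ) → (nw sw se ne : Arc) → Diagram
  | crossing e, _, nw, sw, se, ne => [⟨nw, sw, se, ne, e⟩]
  | reflect s, π, nw, sw, se, ne =>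
    (s.crossings π nw ne se sw).map fun c => ⟨c.a, c.d, c.c, c.b, c.under⟩
  | add s t, π, nw, sw, se, ne =>
    s.crossings (0 :: π) nw sw (π, 1) (π, 0) ++ t.crossings (1 :: π) (π, 0) (π, 1) se ne

/-- `n + 1` equal crossings in a horizontal row. -/
def row (e : Bool) : ℕ → Tangle
  | 0 => crossing e
  | n + 1 => add (row e n) (crossing e)

/-- The integer tangle `n`, for `n ≠ 0` (the value at `0` is never used). -/
def twist (n : ℤ) : Tangle := row (decide (0 < n)) (n.natAbs - 1)

/-- Conway product `t₁ t₂ … tₙ`, bracketed to the left, where `s t` is `s 0 + t`. -/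
def product : List Tangle → Tangle
  | [] => crossing true
  | t :: l => l.foldl (fun s u => add (reflect s) u) t

/-- The rational tangle `a₁ a₂ … aₙ`. -/
def rational (l : List ℤ) : Tangle := product (l.map twist)

/-- Ramification `t₁, t₂, …, tₙ`, that is `t₁ 0 + t₂ 0 + … + tₙ 0`. The tangle `t₁, …, tₙ+k` is
obtained from it by adding the integer tangle `k`, where `+` alone means `k = 1`. -/
def ramify : List Tangle → Tangle
  | [] => crossing true
  | t :: l => l.foldl (fun s u => add s (reflect u)) (reflect t)

end Tangle

open Tangle

/-- The link of a tangle: the ends NW, NE are joined, and so are SW, SE. -/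
def linkOf (t : Tangle) : Diagram := t.crossings [0] ([], 0) ([], 1) ([], 1) ([], 0)

/-- The antiprismatic basic polyhedron `(2n)*` with the tangles of the list `l` substituted in its
vertices `1, 2, …, 2n` (the remaining vertices carry the tangle `1`). The vertices are numbered in
zigzag order; vertex `i + 1` is joined to the next one by the arc `([], 2 * i)` and to the second
next one by the arc `([], 2 * i + 1)`, indices modulo `2n`. -/
def antiprism (n : ℕ) (l : List Tangle) : Diagram :=
  (List.range (2 * n)).flatMap fun i =>
    let t := l.getD i (crossing true)
    let z : ℕ → Arc := fun j => ([], 2 * (j % (2 * n)))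
    let w : ℕ → Arc := fun j => ([], 2 * (j % (2 * n)) + 1)
    let i₁ := i + 2 * n - 1
    let i₂ := i + 2 * n - 2
    if i % 2 = 0 then (reflect t).crossings [i] (w i₂) (w i) (z i) (z i₁)
    else t.crossings [i] (z i) (w i) (w i₂) (z i₁)

/-- The polyhedral links `.a.b.c.d`, that is `6**1.a.b.c.d.1`: the four tangles sit on the 4-cycle of
vertices `1, 2, 4, 5` of the octahedron `6*`. -/
def dotted (l : List Tangle) : Diagram :=
  let t : ℕ → Tangle := fun i => l.getD i (crossing true)
  antiprism 3 [t 0, t 1, crossing true, reflect (t 2), reflect (t 3)]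

/-- The basic polyhedron `9*` with the tangles of the list `l` substituted in its first two vertices
and the tangle `1` in the others. The polyhedron is the medial graph of the triangular bipyramid;
the first vertex lies on an edge at an apex and the second one on an adjacent equatorial edge. -/
def nineStar (l : List Tangle) : Diagram :=
  (List.range 3).flatMap fun j =>
    let first := if j = 0 then l.getD 0 (crossing true) else crossing true
    let second := if j = 0 then l.getD 1 (crossing true) else crossing true
    let k := (j + 2) % 3
    (reflect first).crossings [0, j] ([2], k) ([1], j) ([0], j) ([0], k) ++
    second.crossings [1, j] ([1], j) ([4], j) ([5], j) ([2], j) ++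
    (crossing true).crossings [2, j] ([3], k) ([3], j) ([4], j) ([5], k)

/-! ## The formulas -/

section Formulas

variable {K : Type} [Field K]

/-- `(x ^ n - 1) / (x - 1)`. -/
def geom (x : K) (n : ℤ) : K := (x ^ n - 1) / (x - 1)

/-- Tutte polynomial for `p`. -/
def T_p (x y : K) (p : ℤ) : K :=
  geom x p + y - 1

/-- Tutte polynomial for `p,q,r`. -/
def T_p_q_r (x y : K) (p q r : ℤ) : K :=
  (x ^ (p + q + r) + (x ^ (p + 1) + x ^ (q + 1) + x ^ (r + 1)) * (y - 1) - (x ^ p + x ^ q + x ^ r) *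
  y) / (x - 1) ^ 2 + (x * y - x - y) * (x * y - x - y - 1) / (x - 1) ^ 2

/-- Tutte polynomial for `p q`. -/
def T_pq (x y : K) (p q : ℤ) : K :=
  geom x p * geom y q + x ^ p + y ^ q - 1

/-- Chain of `p` edges in a cycle with an `r`-fold and an `s`-fold edge. -/
def chain_bar_bar (x y : K) (p r s : ℤ) : K :=
  geom x p * T_p y x r * T_p y x s + T_p y x (r + s)

/-- Triangle of a `q`-fold, an `r`-fold and an `s`-fold edge. -/
def bar_bar_bar (x y : K) (q r s : ℤ) : K :=
  T_p y x r * T_p y x s + (y * geom y (q - 1) + 1) * T_p y x (r + s)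

/-- Chain of `p` edges in a cycle with a `q`-fold, an `r`-fold and an `s`-fold edge. -/
def chain_bar_bar_bar (x y : K) (p q r s : ℤ) : K :=
  geom x p * T_p y x q * T_p y x r * T_p y x s + bar_bar_bar x y q r s

/-- Three paths between two vertices: a chain of `r` edges, a chain of `s` edges, and a chain of `p`
edges continued by a `q`-fold edge. -/
def Gprime_chain_bar_par (x y : K) (p q r s : ℤ) : K :=
  geom y q * T_p_q_r x y p r s + x ^ p * T_p x y (r + s)

/-- Cycle that consists of a chain of `p` edges, a chain of `r` edges and an `s`-fold edge, with a
`q`-fold edge joining the ends of the chain of `p` edges. -/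
def Gprime_chain_bar_bar (x y : K) (p q r s : ℤ) : K :=
  geom y q * T_p x y p * T_pq x y r s + T_pq x y (p + r) s

/-- Tutte polynomial for `p 1 q`. -/
def T_p1q (x y : K) (p q : ℤ) : K :=
  x * geom x p * geom x q + (x ^ p + x ^ q + x * y - x - y - 1) * y / (x - 1)

/-- Tutte polynomial for `p q r`. -/
def T_pqr (x y : K) (p q r : ℤ) : K :=
  (x + y) * geom x p * geom x r + y ^ q * (x ^ (r + 1) + x ^ p - x - 1) / (x - 1) + geom x p * geom
  x r * (y ^ q - y ^ 2) / (y - 1) - (x ^ r - y) * y ^ q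

/-- Tutte polynomial for `p 1 1 q`. -/
def T_p11q (x y : K) (p q : ℤ) : K :=
  T_pq x y p (q + 1) + T_p x y (p + 1) * T_p y x q

/-- Tutte polynomial for `.p`. -/
def T_dot_p (x y : K) (p : ℤ) : K :=
  (x ^ p * (2 * x ^ 3 + 2 * x ^ 2 + y ^ 2 + 2 * x * y + y) - 2 * x ^ 2 - 2 * x - y ^ 2 - y - 2 * x *
  y) / (x - 1) - x ^ (p + 1) * (x + 1) + y + 2 * x * y + 2 * y ^ 2 + y ^ 3

/-- Tutte polynomial for `p q 1 r`. -/
def T_pq1r (x y : K) (p q r : ℤ) : K :=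
  (T_p y x (r + 1) * geom y q + x * T_p y x r) * geom x p + y ^ q * T_p y x (r + 1)

/-- Tutte polynomial for `p 1,q,r`. -/
def T_p1_q_r (x y : K) (p q r : ℤ) : K :=
  (T_p y x (r + 1) * geom y q + x * T_p y x r) * geom x p + y * T_p y x (q + r)

/-- Tutte polynomial for `p,q,r+`. -/
def T_p_q_r_plus (x y : K) (p q r : ℤ) : K :=
  T_p_q_r x y p q r + T_p x y p * T_p x y q * T_p x y r

/-- Tutte polynomial for `p 1 1 1 q`. -/
def T_p111q (x y : K) (p q : ℤ) : K :=
  T_pqr x y p 2 q + T_p x y (p + 1) * T_p x y (q + 1)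

/-- Tutte polynomial for `.p 1`. -/
def T_dot_p1 (x y : K) (p : ℤ) : K :=
  T_dot_p x y p + (x + x ^ 2 + y + 2 * x * y + 2 * y ^ 2 + y ^ 3) * T_p x y p

/-- Tutte polynomial for `.p:q`. -/
def T_dot_p_col_q (x y : K) (p q : ℤ) : K :=
  geom x q / (x - 1) * (x ^ p * (x ^ 3 + x ^ 2 + x + y) + (2 * x + y + 1) * (x * y - x - y)) + geom
  x p * (x + y) ^ 2 + x + y + y ^ 2 + y ^ 3

/-- Tutte polynomial for `.p.q`. -/
def T_dot_p_dot_q (x y : K) (p q : ℤ) : K :=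
  geom x p * (((1 + 2 * x + x ^ 2 + y) * (x * y - x - y) + y ^ q * (x + x ^ 2 + y + x * y + y ^ 2))
  / (y - 1)) + 2 * y * geom y (q + 2) - y - y ^ (q + 2) + x * y * geom y q + x * y + x + x ^ 2

/-- Tutte polynomial for `.p:q 0`. -/
def T_dot_p_col_q0 (x y : K) (p q : ℤ) : K :=
  geom x p * (geom y q * (x + y) ^ 2 + x + x ^ 2 + x ^ 3 + y) + 2 * y * geom y (q + 2) - 2 * y - y ^
  (q + 2) - x * y ^ q + x * y * geom y q + 2 * x * y + x + x ^ 2 + geom y (q + 1) - 1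

/-- Tutte polynomial for `.p.q 0`. -/
def T_dot_p_dot_q0 (x y : K) (p q : ℤ) : K :=
  T_p1q x y (p + q) 2 + T_p111q x y p q

/-- Tutte polynomial for `p 1,q 1,r`. -/
def T_p1_q1_r (x y : K) (p q r : ℤ) : K :=
  T_pqr x y p 2 q * geom y r + T_p x y (p + 1) * T_p x y (q + 1)

/-- Tutte polynomial for `p 1,q,r+`. -/
def T_p1_q_r_plus (x y : K) (p q r : ℤ) : K :=
  T_p1_q_r x y p q r + T_p x y (p + 1) * T_p y x q * T_p y x r

/-- Tutte polynomial for `p 1 1,q,r`. -/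
def T_p11_q_r (x y : K) (p q r : ℤ) : K :=
  T_p_q_r x y (p + 1) q r + T_p_q_r x y 1 q r * T_p x y p

/-- Tutte polynomial for `p 1 q 1 r`. -/
def T_p1q1r (x y : K) (p q r : ℤ) : K :=
  T_p1q x y (p + q) r + T_p1q x y q r * T_p x y p

/-- Tutte polynomial for `p,q,r,s`. -/
def T_p_q_r_s (x y : K) (p q r s : ℤ) : K :=
  geom x s * T_p_q_r x y p q r + T_p x y p * T_p x y q * T_p x y r

/-- Tutte polynomial for `p 1 1 1 1 q`. -/
def T_p1111q (x y : K) (p q : ℤ) : K :=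
  T_p11q x y (p + 1) q + T_p1q y x q 2 * T_p x y p

/-- Tutte polynomial for `p q 1 1 r`. -/
def T_pq11r (x y : K) (p q r : ℤ) : K :=
  T_pqr x y p (q + 1) r + T_pq x y p q * T_p x y (r + 1)

/-- Tutte polynomial for `p q r s`. -/
def T_pqrs (x y : K) (p q r s : ℤ) : K :=
  geom y s * T_pqr x y p q r + x ^ r * T_p x y (p + 1) + x ^ r * y * geom y (q - 1) * T_p x y p

/-- Tutte polynomial for `p q,r,s`. -/
def T_pq_r_s (x y : K) (p q r s : ℤ) : K :=
  chain_bar_bar x y p r s + geom y q * T_p x y p * T_p y x (r + s)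

/-- Tutte polynomial for `p,q,r+s`. -/
def T_p_q_r_plus_s (x y : K) (p q r s : ℤ) : K :=
  geom y s * T_p x y p * T_p x y q * T_p x y r + T_p_q_r x y p q r

/-- Tutte polynomial for `(p,q) (r,s)`. -/
def T_Lp_qR_Lr_sR (x y : K) (p q r s : ℤ) : K :=
  geom x q * chain_bar_bar x y p r s + T_p x y p * T_p y x (r + s)

/-- Tutte polynomial for `p q 1 r s`. -/
def T_pq1rs (x y : K) (p q r s : ℤ) : K :=
  T_pqr x y p (q + r) s + T_pq x y p q * T_pq x y s r

/-- Tutte polynomial for `p q r 1 s`. -/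
def T_pqr1s (x y : K) (p q r s : ℤ) : K :=
  T_pqr x y p q (r + s) + T_pqr x y p q r * T_p x y s

/-- Tutte polynomial for `p 1 q 1 1 r`. -/
def T_p1q11r (x y : K) (p q r : ℤ) : K :=
  T_p11q x y (p + q) r + T_p11q x y q r * T_p x y p

/-- Tutte polynomial for `p q 1 1 1 r`. -/
def T_pq111r (x y : K) (p q r : ℤ) : K :=
  T_pq1r x y p (q + 1) r + T_pq x y p q * T_pq x y 2 r

/-- Tutte polynomial for `p 1 1 1 1 1 q`. -/
def T_p11111q (x y : K) (p q : ℤ) : K :=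
  T_p111q x y p (q + 1) + T_p11q x y p 2 * T_p x y q

/-- Tutte polynomial for `p 1,q 1,r 1`. -/
def T_p1_q1_r1 (x y : K) (p q r : ℤ) : K :=
  T_p1q1r x y p q r + T_pqr x y p 2 r * T_p x y q

/-- Tutte polynomial for `p 1 q,r,s`. -/
def T_p1q_r_s (x y : K) (p q r s : ℤ) : K :=
  T_p_q_r x y (p + q) r s + T_p_q_r x y q r s * T_p x y p

/-- Tutte polynomial for `p q 1,r,s`. -/
def T_pq1_r_s (x y : K) (p q r s : ℤ) : K :=
  T_p_q_r_plus_s x y p r s q + T_pq x y p q * T_p x y (r + s)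

/-- Tutte polynomial for `p 1 1 1,q,r`. -/
def T_p111_q_r (x y : K) (p q r : ℤ) : K :=
  T_pq_r_s x y p 2 q r + T_p1q y x q r * T_p x y (p + 1)

/-- Tutte polynomial for `p 1,q,r,s`. -/
def T_p1_q_r_s (x y : K) (p q r s : ℤ) : K :=
  chain_bar_bar_bar x y p q r s + bar_bar_bar x y q r s * T_p x y p

/-- Tutte polynomial for `p q,r 1,s`. -/
def T_pq_r1_s (x y : K) (p q r s : ℤ) : K :=
  T_pqrs x y p q r s + T_pq x y p (q + s) * T_p x y r

/-- Tutte polynomial for `p 1 1,q 1,r`. -/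
def T_p11_q1_r (x y : K) (p q r : ℤ) : K :=
  T_pq11r x y r q p + T_p1q x y p (r + 1) * T_p y x q

/-- Tutte polynomial for `p 1,q,r+s`. -/
def T_p1_q_r_plus_s (x y : K) (p q r s : ℤ) : K :=
  chain_bar_bar x y (p + s) q r + chain_bar_bar x y s q r * T_p x y p

/-- Tutte polynomial for `p,q,r,s+`. -/
def T_p_q_r_s_plus (x y : K) (p q r s : ℤ) : K :=
  T_p_q_r_s x y p q r s + T_p x y p * T_p x y q * T_p x y r * T_p x y s

/-- Tutte polynomial for `p q,r,s+`. -/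
def T_pq_r_s_plus (x y : K) (p q r s : ℤ) : K :=
  T_pq_r_s x y p q r s + T_pq x y p q * T_p y x r * T_p y x s

/-- Tutte polynomial for `p 1 1,q,r+`. -/
def T_p11_q_r_plus (x y : K) (p q r : ℤ) : K :=
  T_p_q_r_plus_s x y p q r 2 + T_p1q x y q r * T_p x y (p + 1)

/-- Tutte polynomial for `(p,q+) (r,s)`. -/
def T_Lp_q_plusR_Lr_sR (x y : K) (p q r s : ℤ) : K :=
  T_Lp_qR_Lr_sR x y p q r s + T_p x y p * T_p x y q * T_p y x (r + s)

/-- Tutte polynomial for `(p,q) 1 (r,s)`. -/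
def T_Lp_qR1Lr_sR (x y : K) (p q r s : ℤ) : K :=
  T_p_q_r_s x y p q r s + T_p x y (p + q) * T_p x y (r + s)

/-- Tutte polynomial for `p 1,q 1,r+`. -/
def T_p1_q1_r_plus (x y : K) (p q r : ℤ) : K :=
  T_p1_q1_r x y p q r + T_p x y (p + 1) * T_p x y (q + 1) * T_p y x r

/-- Tutte polynomial for `(p 1,q) (r,s)`. -/
def T_Lp1_qR_Lr_sR (x y : K) (p q r s : ℤ) : K :=
  Gprime_chain_bar_par x y p q r s + T_pqr x y s q r * T_p x y p

/-- Tutte polynomial for `.p q`. -/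
def T_dot_pq (x y : K) (p q : ℤ) : K :=
  T_pq_r_s x y p q 2 2 + T_p_q_r_plus_s x y p 2 2 q

/-- Tutte polynomial for `.p 1 1`. -/
def T_dot_p11 (x y : K) (p : ℤ) : K :=
  T_dot_p1 x y p + T_p x y (p + 1) * (x + 2 * x ^ 2 + x ^ 3 + y + 2 * x * y + y ^ 2)

/-- Tutte polynomial for `.p 1:q`. -/
def T_dot_p1_col_q (x y : K) (p q : ℤ) : K :=
  T_dot_p_col_q0 x y p q + T_p x y p * T_p_q_r y x q 2 2

/-- Tutte polynomial for `.p 1.q`. -/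
def T_dot_p1_dot_q (x y : K) (p q : ℤ) : K :=
  T_p1_q1_r x y p q 2 + T_p_q_r_s x y p (q + 1) 2 1

/-- Tutte polynomial for `.p 1:q 0`. -/
def T_dot_p1_col_q0 (x y : K) (p q : ℤ) : K :=
  T_dot_p_col_q x y p q + (geom x q * (x + y) ^ 2 + geom y 4 + x - 1) * T_p x y p

/-- Tutte polynomial for `.p 1.q 0`. -/
def T_dot_p1_dot_q0 (x y : K) (p q : ℤ) : K :=
  T_dot_p_dot_q x y p q + (T_p y x (q + 1) * (x + y) + T_p y x (q + 3)) * T_p x y p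

/-- Tutte polynomial for `.p.q 0.r`. -/
def T_dot_p_dot_q0_dot_r (x y : K) (p q r : ℤ) : K :=
  T_p_q_r x y (p + 1) q (r + 1) + T_p_q_r x y (p + q) r 1 + T_p_q_r x y q r 1 * T_p x y p

/-- Tutte polynomial for `p:q 0:r 0`. -/
def T_p_col_q0_col_r0 (x y : K) (p q r : ℤ) : K :=
  chain_bar_bar x y p (q + 1) (r + 1) + T_Lp_qR_Lr_sR x y p 2 q r

/-- Tutte polynomial for `p 0:q 0:r 0`. -/
def T_p0_col_q0_col_r0 (x y : K) (p q r : ℤ) : K :=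
  T_p_q_r x y (p + 1) q (r + 1) + T_p_q_r x y p (q + 1) r + y * T_p_q_r x y p q r

/-- Tutte polynomial for `.p.q.r`. -/
def T_dot_p_dot_q_dot_r (x y : K) (p q r : ℤ) : K :=
  T_pqrs x y (p + 1) 1 r q + T_pq11r x y p q r

/-- Tutte polynomial for `p:q:r`. -/
def T_p_col_q_col_r (x y : K) (p q r : ℤ) : K :=
  T_p_q_r x y (p + r) 2 q + T_p1q1r x y p q r

/-- Tutte polynomial for `.p.q.r 0`. -/
def T_dot_p_dot_q_dot_r0 (x y : K) (p q r : ℤ) : K :=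
  T_p1_q_r x y (p + 1) q r + T_pq_r_s x y p q (r + 1) 1

/-- Tutte polynomial for `p:q:r 0`. -/
def T_p_col_q_col_r0 (x y : K) (p q r : ℤ) : K :=
  T_pqr x y (p + q) r 2 + T_p1_q1_r x y p q r

/-- Tutte polynomial for `.(p,q)`. -/
def T_dot_Lp_qR (x y : K) (p q : ℤ) : K :=
  T_p_q_r_s x y p 2 2 q + T_Lp_qR_Lr_sR x y p q 2 2

/-- Tutte polynomial for `8*p`. -/
def T_eight_p (x y : K) (p : ℤ) : K :=
  T_p1q1r x y 2 p 2 + T_dot_p_col_q0 x y p 2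

/-- Tutte polynomial for `8*p 0`. -/
def T_eight_p0 (x y : K) (p : ℤ) : K :=
  T_p111q x y (p + 1) 2 + T_dot_p1 x y p

/-- Tutte polynomial for `p q r s t`. -/
def T_pqrst (x y : K) (p q r s t : ℤ) : K :=
  geom y q * T_p x y p * T_pqr x y r s t + T_pqr x y (p + r) s t

/-- Tutte polynomial for `p 1 q r 1 s`. -/
def T_p1qr1s (x y : K) (p q r s : ℤ) : K :=
  T_pq1r x y (p + q) r s + T_pq1r x y q r s * T_p x y p

/-- Tutte polynomial for `p q 1 1 r s`. -/
def T_pq11rs (x y : K) (p q r s : ℤ) : K :=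
  Gprime_chain_bar_bar x y p (q + 1) r s + T_pq x y p q * T_pq x y (r + 1) s

/-- Tutte polynomial for `p q 1 r 1 s`. -/
def T_pq1r1s (x y : K) (p q r s : ℤ) : K :=
  T_pq1r x y p q (r + s) + T_pq1r x y p q r * T_p y x s

/-- Tutte polynomial for `p q r 1 1 s`. -/
def T_pqr11s (x y : K) (p q r s : ℤ) : K :=
  Gprime_chain_bar_bar x y p q (r + 1) s + T_pqr x y p q r * T_p y x (s + 1)

/-- Tutte polynomial for `p 1 1 q 1 1 r`. -/
def T_p11q11r (x y : K) (p q r : ℤ) : K :=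
  T_pq11r x y (p + 1) q r + T_p11q x y r (q + 1) * T_p x y p

/-- Tutte polynomial for `p 1 q 1 1 1 r`. -/
def T_p1q111r (x y : K) (p q r : ℤ) : K :=
  T_p111q x y (p + q) r + T_p111q x y q r * T_p x y p

/-- Tutte polynomial for `p q 1 1 1 1 r`. -/
def T_pq1111r (x y : K) (p q r : ℤ) : K :=
  T_pq11r x y p q (r + 1) + T_pq11r x y p q 1 * T_p x y r

/-- Tutte polynomial for `p 1 1 1 1 1 1 q`. -/
def T_p111111q (x y : K) (p q : ℤ) : K :=
  T_p1111q x y (p + 1) q + T_p111q y x 2 q * T_p x y p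

/-- Tutte polynomial for `p,q,r,s,t`. -/
def T_p_q_r_s_t (x y : K) (p q r s t : ℤ) : K :=
  geom x t * T_p_q_r_s x y p q r s + T_p x y p * T_p x y q * T_p x y r * T_p x y s

/-- Tutte polynomial for `p 1,q,r 1,s`. -/
def T_p1_q_r1_s (x y : K) (p q r s : ℤ) : K :=
  geom y s * T_p1_q1_r x y p r q + T_p x y (p + 1) * T_p y x q * T_p x y (r + 1)

/-- Tutte polynomial for `p q r,s,t`. -/
def T_pqr_s_t (x y : K) (p q r s t : ℤ) : K :=
  geom x t * T_pqr x y p q (r + s) + T_pqr x y p q r * T_p x y s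

/-- Tutte polynomial for `p 1 1 q,r,s`. -/
def T_p11q_r_s (x y : K) (p q r s : ℤ) : K :=
  T_pq_r_s x y (p + 1) q r s + bar_bar_bar x y (q + 1) r s * T_p x y p

/-- Tutte polynomial for `p 1 q 1,r,s`. -/
def T_p1q1_r_s (x y : K) (p q r s : ℤ) : K :=
  T_p1_q_r x y (p + q) r s + T_p1_q_r x y q r s * T_p x y p

/-- Tutte polynomial for `p q 1 1,r,s`. -/
def T_pq11_r_s (x y : K) (p q r s : ℤ) : K :=
  T_pq_r_s x y p (q + 1) s r + T_p1q y x s r * T_pq x y p q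

/-- Tutte polynomial for `p 1 1 1 1,q,r`. -/
def T_p1111_q_r (x y : K) (p q r : ℤ) : K :=
  T_p11_q_r_plus x y p q r + T_p1q x y p 2 * T_p x y (q + r)

/-- Tutte polynomial for `p q,r s,t`. -/
def T_pq_rs_t (x y : K) (p q r s t : ℤ) : K :=
  geom y t * T_pqr x y p (q + s) r + T_pq x y p q * T_pq x y r s

/-- Tutte polynomial for `p 1 1,q 1 1,r`. -/
def T_p11_q11_r (x y : K) (p q r : ℤ) : K :=
  T_p11_q_r_plus x y q p r + T_p1q x y q (r + 1) * T_p x y (p + 1)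

/-- Tutte polynomial for `p q,r 1,s 1`. -/
def T_pq_r1_s1 (x y : K) (p q r s : ℤ) : K :=
  T_pqr1s x y p q r s + T_pqr x y p (q + 1) s * T_p x y r

/-- Tutte polynomial for `p 1 1,q 1,r 1`. -/
def T_p11_q1_r1 (x y : K) (p q r : ℤ) : K :=
  T_p11q x y p (q + r) + T_p11q x y p q * T_p y x r + T_pqrs x y p 1 2 r * T_p y x q

/-- Tutte polynomial for `p q,r,s,t`. -/
def T_pq_r_s_t (x y : K) (p q r s t : ℤ) : K :=
  geom y t * T_pq_r_s x y p q r s + T_p y x r * T_p y x s * T_pq x y p q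

/-- Tutte polynomial for `p 1 1,q,r,s`. -/
def T_p11_q_r_s (x y : K) (p q r s : ℤ) : K :=
  T_p_q_r_s x y (p + 1) q r s + T_p_q_r x y q r s * T_p x y p + T_p x y p * T_p x y q * T_p x y r *
  T_p x y s

/-- Tutte polynomial for `p 1,q 1,r,s`. -/
def T_p1_q1_r_s (x y : K) (p q r s : ℤ) : K :=
  chain_bar_bar x y (p + q) r s + T_p1_q_r x y p r s * T_p x y q + chain_bar_bar x y q r s * T_p x y
  p

/-- Tutte polynomial for `p 1 q,r 1,s`. -/
def T_p1q_r1_s (x y : K) (p q r s : ℤ) : K :=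
  T_pqr1s x y s r q p + T_p_q_r x y (s + q) 1 p * T_p y x r

/-- Tutte polynomial for `p q 1,r 1,s`. -/
def T_pq1_r1_s (x y : K) (p q r s : ℤ) : K :=
  T_pqr x y p (q + r) s + T_pq x y p q * T_pq x y (s + 1) r + T_pqr x y p q s * T_p y x r

/-- Tutte polynomial for `p 1 1 1,q 1,r`. -/
def T_p111_q1_r (x y : K) (p q r : ℤ) : K :=
  T_p1_q1_r x y (p + 1) q r + T_p1_q_r x y q 2 r * T_p x y p

/-- Tutte polynomial for `p 1 1,q r,s`. -/
def T_p11_qr_s (x y : K) (p q r s : ℤ) : K :=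
  T_pq_r_s y x q r s (p + 1) + T_pq x y (r + s) q * T_p x y p + T_pq x y r q * T_p x y s * T_p x y p

/-- Tutte polynomial for `p,q,r,s+t`. -/
def T_p_q_r_s_plus_t (x y : K) (p q r s t : ℤ) : K :=
  geom y t * T_p x y p * T_p x y q * T_p x y r * T_p x y s + T_p_q_r_s x y p q r s

/-- Tutte polynomial for `p q,r,s+t`. -/
def T_pq_r_s_plus_t (x y : K) (p q r s t : ℤ) : K :=
  geom x t * T_pq x y p q * T_p y x r * T_p y x s + T_pq_r_s x y p q r s

/-- Tutte polynomial for `p 1 1,q,r+s`. -/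
def T_p11_q_r_plus_s (x y : K) (p q r s : ℤ) : K :=
  chain_bar_bar_bar y x s q r (p + 1) + T_pqr x y q (s + 1) r * T_p x y p

/-- Tutte polynomial for `p 1,q 1,r+s`. -/
def T_p1_q1_r_plus_s (x y : K) (p q r s : ℤ) : K :=
  T_p1_q_r_plus_s x y q r 1 (p + s - 1) + T_p1_q_r_plus_s x y q r 1 (s - 1) * T_p x y p

/-- Tutte polynomial for `p 1,q 1,r 1+`. -/
def T_p1_q1_r1_plus (x y : K) (p q r : ℤ) : K :=
  T_p1q1r x y p (r + 1) q + T_p111q x y p q * T_p x y r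

/-- Tutte polynomial for `p 1 q,r,s+`. -/
def T_p1q_r_s_plus (x y : K) (p q r s : ℤ) : K :=
  T_p_q_r_s x y (p + q) 1 r s + T_p_q_r_s x y q 1 r s * T_p x y p

/-- Tutte polynomial for `p q 1,r,s+`. -/
def T_pq1_r_s_plus (x y : K) (p q r s : ℤ) : K :=
  chain_bar_bar_bar y x (q + 1) r s p + T_pq x y p q * T_p_q_r x y 1 r s

/-- Tutte polynomial for `p 1 1 1,q,r+`. -/
def T_p111_q_r_plus (x y : K) (p q r : ℤ) : K :=
  T_p111_q_r x y p q r + T_p1q x y p 2 * T_p y x q * T_p y x r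

/-- Tutte polynomial for `p 1,q,r,s+`. -/
def T_p1_q_r_s_plus (x y : K) (p q r s : ℤ) : K :=
  T_p1_q_r_s x y p q r s + T_p x y (p + 1) * T_p y x q * T_p y x r * T_p y x s

/-- Tutte polynomial for `p q,r 1,s+`. -/
def T_pq_r1_s_plus (x y : K) (p q r s : ℤ) : K :=
  T_pq_r1_s x y p q r s + T_pq x y p q * T_p x y (r + 1) * T_p y x s

/-- Tutte polynomial for `p 1 1,q 1,r+`. -/
def T_p11_q1_r_plus (x y : K) (p q r : ℤ) : K :=
  T_pq11r x y r (q + 1) p + T_p111q x y p r * T_p y x q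

/-- Tutte polynomial for `(p q,r) (s,t)`. -/
def T_Lpq_rR_Ls_tR (x y : K) (p q r s t : ℤ) : K :=
  geom x t * T_pqrs x y p q s r + T_pq x y p (q + r) * T_p x y s

/-- Tutte polynomial for `(p 1 1,q) (r,s)`. -/
def T_Lp11_qR_Lr_sR (x y : K) (p q r s : ℤ) : K :=
  T_Lp_qR_Lr_sR x y (p + 1) q r s + T_Lp_qR_Lr_sR x y 1 q r s * T_p x y p

/-- Tutte polynomial for `(p 1,q 1) (r,s)`. -/
def T_Lp1_q1R_Lr_sR (x y : K) (p q r s : ℤ) : K :=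
  geom x s * T_p1q1r x y p r q + T_pqr x y p 2 q * T_p x y r

/-- Tutte polynomial for `(p 1,q) (r 1,s)`. -/
def T_Lp1_qR_Lr1_sR (x y : K) (p q r s : ℤ) : K :=
  T_pq_r1_s x y s r p q + T_pqrs x y p 1 s q * T_p y x r

/-- Tutte polynomial for `(p,q,r) (s,t)`. -/
def T_Lp_q_rR_Ls_tR (x y : K) (p q r s t : ℤ) : K :=
  geom x p * T_Lp_qR_Lr_sR x y q r s t + T_p y x (s + t) * T_p x y q * T_p x y r

/-- Tutte polynomial for `(p 1,q+) (r,s)`. -/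
def T_Lp1_q_plusR_Lr_sR (x y : K) (p q r s : ℤ) : K :=
  T_Lp1_qR_Lr_sR x y p q r s + T_p x y (r + s) * T_p x y (p + 1) * T_p y x q

/-- Tutte polynomial for `(p,q+) (r 1,s)`. -/
def T_Lp_q_plusR_Lr1_sR (x y : K) (p q r s : ℤ) : K :=
  T_Lp1_qR_Lr_sR x y r s p q + T_pq x y r (s + 1) * T_p x y p * T_p x y q

/-- Tutte polynomial for `(p,q+) (r,s+)`. -/
def T_Lp_q_plusR_Lr_s_plusR (x y : K) (p q r s : ℤ) : K :=
  T_Lp_q_plusR_Lr_sR x y p q r s + T_p_q_r x y p q 1 * T_p y x r * T_p y x s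

/-- Tutte polynomial for `(p,q+r) (s,t)`. -/
def T_Lp_q_plus_rR_Ls_tR (x y : K) (p q r s t : ℤ) : K :=
  geom y t * T_pqr x y p (r + s) q + T_pqr x y p r q * T_p y x s

/-- Tutte polynomial for `(p,q) r (s,t)`. -/
def T_Lp_qRrLs_tR (x y : K) (p q r s t : ℤ) : K :=
  geom x t * T_p_q_r x y p q (r + s) + T_p_q_r x y p q r * T_p x y s

/-- Tutte polynomial for `(p 1,q) 1 (r,s)`. -/
def T_Lp1_qR1Lr_sR (x y : K) (p q r s : ℤ) : K :=
  T_p1_q_r_s x y p q r s + T_pq x y p (q + 1) * T_p y x (r + s)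

/-- Tutte polynomial for `(p,q) 1 1 (r,s)`. -/
def T_Lp_qR11Lr_sR (x y : K) (p q r s : ℤ) : K :=
  T_Lp_q_plusR_Lr_sR x y p q r s + T_p1q y x r s * T_p x y (p + q)

/-- Tutte polynomial for `(p,q+) 1 (r,s)`. -/
def T_Lp_q_plusR1Lr_sR (x y : K) (p q r s : ℤ) : K :=
  T_p_q_r_s_t x y p q r s 1 + T_p_q_r x y p q 1 * T_p x y (r + s)

/-- Tutte polynomial for `(p,q),r,(s,t)`. -/
def T_Lp_qR_r_Ls_tR (x y : K) (p q r s t : ℤ) : K :=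
  geom y r * T_p_q_r_s x y p q s t + T_p x y (p + q) * T_p x y (s + t)

/-- Tutte polynomial for `.p 1 q`. -/
def T_dot_p1q (x y : K) (p q : ℤ) : K :=
  T_dot_p x y (p + q) + T_dot_p x y q * T_p x y p

/-- Tutte polynomial for `.p q 1`. -/
def T_dot_pq1 (x y : K) (p q : ℤ) : K :=
  geom y q * T_p x y p * (2 * x + 3 * x ^ 2 + x ^ 3 + 2 * y + 4 * x * y + 3 * y ^ 2 + y ^ 3) +
  T_dot_p x y (p + 1)

/-- Tutte polynomial for `.p 1 1 1`. -/
def T_dot_p111 (x y : K) (p : ℤ) : K :=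
  T_dot_p1 x y (p + 1) + (2 * x + 3 * x ^ 2 + x ^ 3 + 2 * y + 5 * x * y + x ^ 2 * y + 4 * y ^ 2 + 2
  * x * y ^ 2 + 3 * y ^ 3 + y ^ 4) * T_p x y p

/-- Tutte polynomial for `.p q:r`. -/
def T_dot_pq_col_r (x y : K) (p q r : ℤ) : K :=
  geom y q * T_p x y p * T_pq_r_s x y 1 (r - 1) 2 2 + T_dot_p_col_q0 x y p r

/-- Tutte polynomial for `.p q.r`. -/
def T_dot_pq_dot_r (x y : K) (p q r : ℤ) : K :=
  T_pq11r x y p q (r + 1) + T_pqr x y p (q + 2) r + T_pqr x y p q r * T_p x y 2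

/-- Tutte polynomial for `.p q:r 0`. -/
def T_dot_pq_col_r0 (x y : K) (p q r : ℤ) : K :=
  geom x p * T_dot_p_col_q0 x y r q + y ^ q * chain_bar_bar x y r 2 2

/-- Tutte polynomial for `.p q.r 0`. -/
def T_dot_pq_dot_r0 (x y : K) (p q r : ℤ) : K :=
  T_pq1rs x y 2 r q p + T_Lp_q_plus_rR_Ls_tR x y p 1 q r 2

/-- Tutte polynomial for `.p 1 1:q`. -/
def T_dot_p11_col_q (x y : K) (p q : ℤ) : K :=
  T_dot_p1_col_q0 x y p q + T_p_q_r x y 2 q 2 * T_p x y (p + 1)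

/-- Tutte polynomial for `.p 1 1.q`. -/
def T_dot_p11_dot_q (x y : K) (p q : ℤ) : K :=
  T_p_col_q_col_r0 x y (p + 1) 1 q + T_dot_p_col_q0 x y 1 q * T_p x y p

/-- Tutte polynomial for `.p 1 1:q 0`. -/
def T_dot_p11_col_q0 (x y : K) (p q : ℤ) : K :=
  T_dot_p1_col_q x y p q + T_pqr x y 2 q 2 * T_p x y (p + 1)

/-- Tutte polynomial for `.p 1 1.q 0`. -/
def T_dot_p11_dot_q0 (x y : K) (p q : ℤ) : K :=
  T_p1_q1_r x y p q 2 + T_p_q_r_s x y p (q + 1) 2 1 + T_p1q x y (q + 1) 2 * T_p x y (p + 1)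

/-- Tutte polynomial for `.p 1.q 0.r`. -/
def T_dot_p1_dot_q0_dot_r (x y : K) (p q r : ℤ) : K :=
  T_dot_p_dot_q_dot_r0 x y p q r + T_p_q_r y x (q + 1) r 2 * T_p x y p

/-- Tutte polynomial for `.p 1:q 1`. -/
def T_dot_p1_col_q1 (x y : K) (p q : ℤ) : K :=
  T_dot_p1_col_q0 x y q p + T_p1_q_r x y q 2 2 * T_p x y p

/-- Tutte polynomial for `.p 1.q 1`. -/
def T_dot_p1_dot_q1 (x y : K) (p q : ℤ) : K :=
  T_dot_p1_dot_q0 x y p q + T_p111q x y p 2 * T_p y x q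

/-- Tutte polynomial for `.p 1:q 1 0`. -/
def T_dot_p1_col_q10 (x y : K) (p q : ℤ) : K :=
  T_dot_p1_col_q x y p q + T_p_q_r_s x y p 2 2 1 * T_p y x q

/-- Tutte polynomial for `.p 1.q 1 0`. -/
def T_dot_p1_dot_q10 (x y : K) (p q : ℤ) : K :=
  T_dot_p1_dot_q x y q p + T_pq1r x y q 2 2 * T_p x y p

/-- Tutte polynomial for `.p 1 0.q.r`. -/
def T_dot_p10_dot_q_dot_r (x y : K) (p q r : ℤ) : K :=
  T_dot_p_dot_q_dot_r x y r q p + chain_bar_bar x y r (q + 1) 2 * T_p x y p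

/-- Tutte polynomial for `.p.q.r 0.s 0`. -/
def T_dot_p_dot_q_dot_r0_dot_s0 (x y : K) (p q r s : ℤ) : K :=
  T_pq1rs x y p q r s + T_p1_q_r x y (p + s) q r

/-- Tutte polynomial for `.p 1.q.r`. -/
def T_dot_p1_dot_q_dot_r (x y : K) (p q r : ℤ) : K :=
  T_dot_p_dot_q_dot_r0_dot_s0 x y p 1 r q + T_p1_q_r x y q r 2 * T_p x y p

/-- Tutte polynomial for `.p.q 1 0.r`. -/
def T_dot_p_dot_q10_dot_r (x y : K) (p q r : ℤ) : K :=
  T_dot_p_dot_q_dot_r x y p q r + T_p1q x y (p + 1) (r + 1) * T_p y x q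

/-- Tutte polynomial for `.p.q 1.r`. -/
def T_dot_p_dot_q1_dot_r (x y : K) (p q r : ℤ) : K :=
  T_dot_p_dot_q0_dot_r x y p q r + T_p111q x y p r * T_p x y q

/-- Tutte polynomial for `.p.q 1.r 0`. -/
def T_dot_p_dot_q1_dot_r0 (x y : K) (p q r : ℤ) : K :=
  T_pqrs x y (p + 1) 1 q r + T_Lp_qR_Lr_sR x y p q 1 (r + 1) + T_p11q x y p (r + 1) * T_p x y q

/-- Tutte polynomial for `.p 1.q.r 0`. -/
def T_dot_p1_dot_q_dot_r0 (x y : K) (p q r : ℤ) : K :=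
  T_p111q x y p (q + r) + T_p11_q_r_plus x y r q p

/-- Tutte polynomial for `p 1 0:q 0:r 0`. -/
def T_p10_col_q0_col_r0 (x y : K) (p q r : ℤ) : K :=
  T_p1_q_r x y p (q + 1) (r + 1) + T_Lp_q_plusR_Lr_sR x y p 2 q r

/-- Tutte polynomial for `p 1:q:r`. -/
def T_p1_col_q_col_r (x y : K) (p q r : ℤ) : K :=
  T_pq1r x y p q r + chain_bar_bar x y p (q + r) 2 + T_pq x y (p + 1) r * T_p y x q + T_p1q y x (q +
  1) (r + 1) * T_p x y p

/-- Tutte polynomial for `p 1:q 0:r 0`. -/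
def T_p1_col_q0_col_r0 (x y : K) (p q r : ℤ) : K :=
  T_p0_col_q0_col_r0 x y p q r + T_p111q x y q r * T_p x y p

/-- Tutte polynomial for `p:q:r 1 0`. -/
def T_p_col_q_col_r10 (x y : K) (p q r : ℤ) : K :=
  T_p1_q1_r1 x y p q r + T_p_q_r_s x y (p + q) r 2 1

/-- Tutte polynomial for `p 1:q:r 0`. -/
def T_p1_col_q_col_r0 (x y : K) (p q r : ℤ) : K :=
  T_pq11r x y (r + 1) q p + T_Lp_q_plusR_Lr_sR x y p r 2 q

/-- Tutte polynomial for `p 1 0:q:r 0`. -/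
def T_p10_col_q_col_r0 (x y : K) (p q r : ℤ) : K :=
  T_p_col_q_col_r0 x y p q r + T_pq1r x y q r 2 * T_p x y p

/-- Tutte polynomial for `.p.q.r.s`. -/
def T_dot_p_dot_q_dot_r_dot_s (x y : K) (p q r s : ℤ) : K :=
  geom x r * (T_pq1r x y p q s + T_pq x y (p + 1) s * T_p y x q) + chain_bar_bar x y p (q + 1) (s +
  1)

/-- Tutte polynomial for `.p.q.r.s 0`. -/
def T_dot_p_dot_q_dot_r_dot_s0 (x y : K) (p q r s : ℤ) : K :=
  T_pqrs x y (r + s) 1 p q + T_p_q_r_plus_s x y p r s q + T_pq x y r q * T_p x y (p + s)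

/-- Tutte polynomial for `.p.q 0.r.s 0`. -/
def T_dot_p_dot_q0_dot_r_dot_s0 (x y : K) (p q r s : ℤ) : K :=
  T_p_q_r_s x y p q r s + T_p1q x y (p + q) (r + s) + T_p x y (p + s) * T_p x y (q + r)

/-- Tutte polynomial for `p 0.q.r 0.s 0`. -/
def T_p0_dot_q_dot_r0_dot_s0 (x y : K) (p q r s : ℤ) : K :=
  T_pqr1s x y r s q p + T_pqr x y (p + r) s q + T_p x y (p + q + r) * T_p y x s

/-- Tutte polynomial for `p 0.q.r.s 0`. -/
def T_p0_dot_q_dot_r_dot_s0 (x y : K) (p q r s : ℤ) : K :=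
  T_pq1r x y (p + q) r s + T_pq_r1_s x y q s p r

/-- Tutte polynomial for `p.q 0.r.s 0`. -/
def T_p_dot_q0_dot_r_dot_s0 (x y : K) (p q r s : ℤ) : K :=
  T_p_q_r x y p q (r + s) + T_p_q_r x y p r (q + s) + T_p_q_r x y p q r * T_p x y s + x ^ p * T_p x
  y (q + r + s)

/-- Tutte polynomial for `p.q.r 0.s`. -/
def T_p_dot_q_dot_r0_dot_s (x y : K) (p q r s : ℤ) : K :=
  T_pq_r_s x y (p + 1) q r s + T_pq_r_s x y p r q (s + 1)

/-- Tutte polynomial for `p.q.r 0.s 0`. -/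
def T_p_dot_q_dot_r0_dot_s0 (x y : K) (p q r s : ℤ) : K :=
  T_pqrs x y (p + 1) q s r + T_pq_r1_s x y p r s q

/-- Tutte polynomial for `p.q.r.s`. -/
def T_p_dot_q_dot_r_dot_s (x y : K) (p q r s : ℤ) : K :=
  T_pqrs x y (p + 1) q r s + T_Lp_qR_Lr_sR x y p r q (s + 1)

/-- Tutte polynomial for `p.q.r.s 0`. -/
def T_p_dot_q_dot_r_dot_s0 (x y : K) (p q r s : ℤ) : K :=
  Gprime_chain_bar_par x y s q (p + 1) r + T_pqr1s x y p q r s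

/-- Tutte polynomial for `.(p 1,q)`. -/
def T_dot_Lp1_qR (x y : K) (p q : ℤ) : K :=
  T_Lp1_qR_Lr_sR x y p q 2 2 + T_p1_q_r_s x y p q 2 2

/-- Tutte polynomial for `.(p,q) 1`. -/
def T_dot_Lp_qR1 (x y : K) (p q : ℤ) : K :=
  T_dot_Lp_qR x y p q + T_p x y (p + q) * (x + 2 * x ^ 2 + x ^ 3 + y + 2 * x * y + y ^ 2)

/-- Tutte polynomial for `.(p,q+)`. -/
def T_dot_Lp_q_plusR (x y : K) (p q : ℤ) : K :=
  T_dot_Lp_qR x y p q + T_p x y p * T_p x y q * (x + x ^ 2 + y + 2 * x * y + 2 * y ^ 2 + y ^ 3)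

/-- Tutte polynomial for `.(p,q).r`. -/
def T_dot_Lp_qR_dot_r (x y : K) (p q r : ℤ) : K :=
  T_p_q_r_s x y p q r 2 + Gprime_chain_bar_par x y r 2 p q + T_p x y (p + q) * T_p x y (r + 2) +
  T_pq x y r 2 * T_p x y p * T_p x y q

/-- Tutte polynomial for `.(p,q).r 0`. -/
def T_dot_Lp_qR_dot_r0 (x y : K) (p q r : ℤ) : K :=
  T_Lp_qR_Lr_sR x y p q (r + 1) 2 + T_p_q_r_plus_s x y p q 2 r + T_p_q_r x y p q 2 * T_p y x r

/-- Tutte polynomial for `.(p,q):r`. -/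
def T_dot_Lp_qR_col_r (x y : K) (p q r : ℤ) : K :=
  geom x q * T_dot_p_col_q0 x y p r + T_p_q_r y x r 2 2 * T_p x y p

/-- Tutte polynomial for `.(p,q):r 0`. -/
def T_dot_Lp_qR_col_r0 (x y : K) (p q r : ℤ) : K :=
  geom x r * T_p_q_r_s x y p q 2 2 + T_Lp_qR_Lr_sR x y p q 2 2

/-- Tutte polynomial for `8*p 0::q 0`. -/
def T_eight_p0_colcol_q0 (x y : K) (p q : ℤ) : K :=
  geom x q * T_dot_p_col_q x y p 2 + T_pq1r x y p 2 2 + T_pq x y (p + 1) 2 * (x + y)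

/-- Tutte polynomial for `8*p 0:.q 0`. -/
def T_eight_p0_coldot_q0 (x y : K) (p q : ℤ) : K :=
  T_dot_p_dot_q_dot_r0 x y p 2 q + T_Lp_q_plusR_Lr_sR x y p 2 q 1 + T_pq x y 2 q * T_p x y (p + 2)

/-- Tutte polynomial for `8*p 0:q 0`. -/
def T_eight_p0_col_q0 (x y : K) (p q : ℤ) : K :=
  T_dot_Lp_qR x y p q + T_p111q x y (p + 1) (q + 1)

/-- Tutte polynomial for `8*p 0.q 0`. -/
def T_eight_p0_dot_q0 (x y : K) (p q : ℤ) : K :=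
  T_dot_p_dot_q_dot_r_dot_s x y 1 q p 2 + T_Lp1_qR_Lr_sR x y 2 q p 2

/-- Tutte polynomial for `8*p 1`. -/
def T_eight_p1 (x y : K) (p : ℤ) : K :=
  T_eight_p0 x y p + T_p x y p * (x + 2 * x ^ 2 + x ^ 3 + y + 4 * x * y + 2 * x ^ 2 * y + 3 * y ^ 2
  + 3 * x * y ^ 2 + 3 * y ^ 3 + y ^ 4)

/-- Tutte polynomial for `8*p 1 0`. -/
def T_eight_p10 (x y : K) (p : ℤ) : K :=
  T_eight_p x y p + T_p x y p * (2 * x + 3 * x ^ 2 + x ^ 3 + 2 * y + 5 * x * y + x ^ 2 * y + 4 * y ^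
  2 + 2 * x * y ^ 2 + 3 * y ^ 3 + y ^ 4)

/-- Tutte polynomial for `8*p::q`. -/
def T_eight_p_colcol_q (x y : K) (p q : ℤ) : K :=
  T_p111q x y (p + 1) (q + 1) + T_p0_dot_q_dot_r0_dot_s0 x y 1 p q 2

/-- Tutte polynomial for `8*p:.q`. -/
def T_eight_p_coldot_q (x y : K) (p q : ℤ) : K :=
  T_p1111q x y (p + 1) q + T_p0_dot_q_dot_r0_dot_s0 x y 1 p 1 (q + 1)

/-- Tutte polynomial for `8*p:q`. -/
def T_eight_p_col_q (x y : K) (p q : ℤ) : K :=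
  T_dot_p x y (p + q) + T_p1q1r x y p 2 q + T_pq x y p 2 * T_pq x y q 2

/-- Tutte polynomial for `8*p.q`. -/
def T_eight_p_dot_q (x y : K) (p q : ℤ) : K :=
  T_dot_p_dot_q_dot_r0 x y p q 1 + chain_bar_bar x y p (q + 1) 3 + T_pq x y (p + 1) (q + 1) * (x +
  y) + x * T_p1_q_r_plus_s x y 2 q 1 (p - 1)

/-- Tutte polynomial for `8*p::q 0`. -/
def T_eight_p_colcol_q0 (x y : K) (p q : ℤ) : K :=
  T_dot_p_dot_q x y (p + 1) q + T_p111_q_r x y p q 2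

/-- Tutte polynomial for `8*p:.q 0`. -/
def T_eight_p_coldot_q0 (x y : K) (p q : ℤ) : K :=
  T_dot_p1_col_q0 x y q p + T_p1q1r x y (q + 1) p 2

/-- Tutte polynomial for `8*p:q 0`. -/
def T_eight_p_col_q0 (x y : K) (p q : ℤ) : K :=
  T_p1111q x y p (q + 1) + chain_bar_bar_bar x y p q 2 2 + Gprime_chain_bar_par x y p q 2 2

/-- Tutte polynomial for `8*p.q 0`. -/
def T_eight_p_dot_q0 (x y : K) (p q : ℤ) : K :=
  geom x q * T_dot_p x y (p + 1) + T_p1111q x y p 2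

/-- Tutte polynomial for `9*.p`. -/
def T_nine_dot_p (x y : K) (p : ℤ) : K :=
  geom x p * (3 * x + 6 * x ^ 2 + 4 * x ^ 3 + x ^ 4 + 3 * y + 9 * x * y + 4 * x ^ 2 * y + 6 * y ^ 2
  + 4 * x * y ^ 2 + 4 * y ^ 3 + y ^ 4) + (x + 2 * x ^ 2 + x ^ 3 + y + 4 * x * y + 3 * x ^ 2 * y + 3
  * y ^ 2 + 5 * x * y ^ 2 + 4 * y ^ 3 + 2 * x * y ^ 3 + 3 * y ^ 4 + y ^ 5)

/-- Tutte polynomial for `9*p`. -/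
def T_nine_p (x y : K) (p : ℤ) : K :=
  geom x p * (2 * x + 5 * x ^ 2 + 5 * x ^ 3 + 3 * x ^ 4 + x ^ 5 + 2 * y + 6 * x * y + 4 * x ^ 2 * y
  + x ^ 3 * y + 3 * y ^ 2 + 2 * x * y ^ 2 + y ^ 3) + 2 * x + 4 * x ^ 2 + 3 * x ^ 3 + x ^ 4 + 2 * y +
  7 * x * y + 5 * x ^ 2 * y + x ^ 3 * y + 5 * y ^ 2 + 5 * x * y ^ 2 + 4 * y ^ 3 + y ^ 4

/-- Tutte polynomial for `9*.p 0`. -/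
def T_nine_dot_p0 (x y : K) (p : ℤ) : K :=
  geom y (p - 1) * y * (x + 2 * x ^ 2 + x ^ 3 + y + 4 * x * y + 3 * x ^ 2 * y + 3 * y ^ 2 + 5 * x *
  y ^ 2 + 4 * y ^ 3 + 2 * x * y ^ 3 + 3 * y ^ 4 + y ^ 5) + 4 * x + 8 * x ^ 2 + 5 * x ^ 3 + x ^ 4 + 4
  * y + 13 * x * y + 7 * x ^ 2 * y + 9 * y ^ 2 + 9 * x * y ^ 2 + 8 * y ^ 3 + 2 * x * y ^ 3 + 4 * y ^
  4 + y ^ 5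

end Formulas

/-- A family of links with integer parameters: its diagrams in Conway notation, the colour of the
regions chosen as vertices of its graphs, and a formula in `x`, `y` and the parameters. -/
structure Family where
  arity : ℕ
  colour : Colour
  diagram : (Fin arity → ℤ) → Diagram
  formula : ∀ {K : Type} [Field K], K → K → (Fin arity → ℤ) → K

def family1 (k : Colour) (D : ℤ → Diagram) (T : ∀ {K : Type} [Field K], K → K → ℤ → K) : Family :=
  ⟨1, k, fun v => D (v 0), fun x y v => T x y (v 0)⟩

def family2 (k : Colour) (D : ℤ → ℤ → Diagram)
    (T : ∀ {K : Type} [Field K], K → K → ℤ → ℤ → K) : Family :=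
  ⟨2, k, fun v => D (v 0) (v 1), fun x y v => T x y (v 0) (v 1)⟩

def family3 (k : Colour) (D : ℤ → ℤ → ℤ → Diagram)
    (T : ∀ {K : Type} [Field K], K → K → ℤ → ℤ → ℤ → K) : Family :=
  ⟨3, k, fun v => D (v 0) (v 1) (v 2), fun x y v => T x y (v 0) (v 1) (v 2)⟩

def family4 (k : Colour) (D : ℤ → ℤ → ℤ → ℤ → Diagram)
    (T : ∀ {K : Type} [Field K], K → K → ℤ → ℤ → ℤ → ℤ → K) : Family :=
  ⟨4, k, fun v => D (v 0) (v 1) (v 2) (v 3), fun x y v => T x y (v 0) (v 1) (v 2) (v 3)⟩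

def family5 (k : Colour) (D : ℤ → ℤ → ℤ → ℤ → ℤ → Diagram)
    (T : ∀ {K : Type} [Field K], K → K → ℤ → ℤ → ℤ → ℤ → ℤ → K) : Family :=
  ⟨5, k, fun v => D (v 0) (v 1) (v 2) (v 3) (v 4),
    fun x y v => T x y (v 0) (v 1) (v 2) (v 3) (v 4)⟩

/-- The families derived from source links, each with the formula for its Tutte polynomials. -/
def families : List Family :=
  [ family1 .WE (fun p => linkOf (twist p)) T_p,
    family2 .NS (fun p q => linkOf (rational [p, q])) T_pq,
    family2 .WE (fun p q => linkOf (rational [p, 1, q])) T_p1q,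
    family3 .WE (fun p q r => linkOf (rational [p, q, r])) T_pqr,
    family2 .NS (fun p q => linkOf (rational [p, 1, 1, q])) T_p11q,
    family3 .NS (fun p q r => linkOf (ramify [twist p, twist q, twist r])) T_p_q_r,
    family1 .NS (fun p => dotted [twist p]) T_dot_p,
    family3 .NS (fun p q r => linkOf (rational [p, q, 1, r])) T_pq1r,
    family3 .WE (fun p q r => linkOf (ramify [rational [p, 1], twist q, twist r])) T_p1_q_r,
    family3 .NS (fun p q r => linkOf (add (ramify [twist p, twist q, twist r]) (twist 1)))
    T_p_q_r_plus,
    family2 .WE (fun p q => linkOf (rational [p, 1, 1, 1, q])) T_p111q,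
    family1 .WE (fun p => dotted [rational [p, 1]]) T_dot_p1,
    family2 .NS (fun p q => dotted [twist p, twist 1, twist q]) T_dot_p_col_q,
    family2 .NS (fun p q => dotted [twist p, twist q]) T_dot_p_dot_q,
    family2 .NS (fun p q => dotted [twist p, twist 1, reflect (twist q)]) T_dot_p_col_q0,
    family2 .NS (fun p q => dotted [twist p, reflect (twist q)]) T_dot_p_dot_q0,
    family3 .WE (fun p q r => linkOf (ramify [rational [p, 1], rational [q, 1], twist r])) T_p1_q1_r,
    family3 .WE (fun p q r => linkOf (add (ramify [rational [p, 1], twist q, twist r]) (twist 1)))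
    T_p1_q_r_plus,
    family3 .NS (fun p q r => linkOf (ramify [rational [p, 1, 1], twist q, twist r])) T_p11_q_r,
    family3 .WE (fun p q r => linkOf (rational [p, 1, q, 1, r])) T_p1q1r,
    family4 .NS (fun p q r s => linkOf (ramify [twist p, twist q, twist r, twist s])) T_p_q_r_s,
    family2 .NS (fun p q => linkOf (rational [p, 1, 1, 1, 1, q])) T_p1111q,
    family3 .WE (fun p q r => linkOf (rational [p, q, 1, 1, r])) T_pq11r,
    family4 .NS (fun p q r s => linkOf (rational [p, q, r, s])) T_pqrs,
    family4 .WE (fun p q r s => linkOf (ramify [rational [p, q], twist r, twist s])) T_pq_r_s,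
    family4 .NS (fun p q r s => linkOf (add (ramify [twist p, twist q, twist r]) (twist s)))
    T_p_q_r_plus_s,
    family4 .WE (fun p q r s => linkOf (product [ramify [twist p, twist q], ramify [twist r, twist
    s]])) T_Lp_qR_Lr_sR,
    family4 .WE (fun p q r s => linkOf (rational [p, q, 1, r, s])) T_pq1rs,
    family4 .WE (fun p q r s => linkOf (rational [p, q, r, 1, s])) T_pqr1s,
    family3 .NS (fun p q r => linkOf (rational [p, 1, q, 1, 1, r])) T_p1q11r,
    family3 .NS (fun p q r => linkOf (rational [p, q, 1, 1, 1, r])) T_pq111r,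
    family2 .WE (fun p q => linkOf (rational [p, 1, 1, 1, 1, 1, q])) T_p11111q,
    family3 .WE (fun p q r => linkOf (ramify [rational [p, 1], rational [q, 1], rational [r, 1]]))
    T_p1_q1_r1,
    family4 .NS (fun p q r s => linkOf (ramify [rational [p, 1, q], twist r, twist s])) T_p1q_r_s,
    family4 .NS (fun p q r s => linkOf (ramify [rational [p, q, 1], twist r, twist s])) T_pq1_r_s,
    family3 .WE (fun p q r => linkOf (ramify [rational [p, 1, 1, 1], twist q, twist r])) T_p111_q_r,
    family4 .WE (fun p q r s => linkOf (ramify [rational [p, 1], twist q, twist r, twist s]))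
    T_p1_q_r_s,
    family4 .WE (fun p q r s => linkOf (ramify [rational [p, q], rational [r, 1], twist s]))
    T_pq_r1_s,
    family3 .NS (fun p q r => linkOf (ramify [rational [p, 1, 1], rational [q, 1], twist r]))
    T_p11_q1_r,
    family4 .WE (fun p q r s => linkOf (add (ramify [rational [p, 1], twist q, twist r]) (twist s)))
    T_p1_q_r_plus_s,
    family4 .NS (fun p q r s => linkOf (add (ramify [twist p, twist q, twist r, twist s]) (twist
    1))) T_p_q_r_s_plus,
    family4 .WE (fun p q r s => linkOf (add (ramify [rational [p, q], twist r, twist s]) (twist 1)))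
    T_pq_r_s_plus,
    family3 .NS (fun p q r => linkOf (add (ramify [rational [p, 1, 1], twist q, twist r]) (twist
    1))) T_p11_q_r_plus,
    family4 .WE (fun p q r s => linkOf (product [add (ramify [twist p, twist q]) (twist 1), ramify
    [twist r, twist s]])) T_Lp_q_plusR_Lr_sR,
    family4 .NS (fun p q r s => linkOf (product [ramify [twist p, twist q], twist 1, ramify [twist
    r, twist s]])) T_Lp_qR1Lr_sR,
    family3 .WE (fun p q r => linkOf (add (ramify [rational [p, 1], rational [q, 1], twist r])
    (twist 1))) T_p1_q1_r_plus,
    family4 .NS (fun p q r s => linkOf (product [ramify [rational [p, 1], twist q], ramify [twist r,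
    twist s]])) T_Lp1_qR_Lr_sR,
    family2 .WE (fun p q => dotted [rational [p, q]]) T_dot_pq,
    family1 .NS (fun p => dotted [rational [p, 1, 1]]) T_dot_p11,
    family2 .WE (fun p q => dotted [rational [p, 1], twist 1, twist q]) T_dot_p1_col_q,
    family2 .WE (fun p q => dotted [rational [p, 1], twist q]) T_dot_p1_dot_q,
    family2 .WE (fun p q => dotted [rational [p, 1], twist 1, reflect (twist q)]) T_dot_p1_col_q0,
    family2 .WE (fun p q => dotted [rational [p, 1], reflect (twist q)]) T_dot_p1_dot_q0,
    family3 .NS (fun p q r => dotted [twist p, reflect (twist q), twist r]) T_dot_p_dot_q0_dot_r,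
    family3 .NS (fun p q r => antiprism 3 [twist p, twist 1, reflect (twist q), twist 1, reflect
    (twist r)]) T_p_col_q0_col_r0,
    family3 .WE (fun p q r => antiprism 3 [reflect (twist p), twist 1, reflect (twist q), twist 1,
    reflect (twist r)]) T_p0_col_q0_col_r0,
    family3 .NS (fun p q r => dotted [twist p, twist q, twist r]) T_dot_p_dot_q_dot_r,
    family3 .NS (fun p q r => antiprism 3 [twist p, twist 1, twist q, twist 1, twist r])
    T_p_col_q_col_r,
    family3 .NS (fun p q r => dotted [twist p, twist q, reflect (twist r)]) T_dot_p_dot_q_dot_r0,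
    family3 .NS (fun p q r => antiprism 3 [twist p, twist 1, twist q, twist 1, reflect (twist r)])
    T_p_col_q_col_r0,
    family2 .WE (fun p q => dotted [ramify [twist p, twist q]]) T_dot_Lp_qR,
    family1 .NS (fun p => antiprism 4 [twist p]) T_eight_p,
    family1 .WE (fun p => antiprism 4 [reflect (twist p)]) T_eight_p0,
    family5 .WE (fun p q r s t => linkOf (rational [p, q, r, s, t])) T_pqrst,
    family4 .NS (fun p q r s => linkOf (rational [p, 1, q, r, 1, s])) T_p1qr1s,
    family4 .NS (fun p q r s => linkOf (rational [p, q, 1, 1, r, s])) T_pq11rs,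
    family4 .NS (fun p q r s => linkOf (rational [p, q, 1, r, 1, s])) T_pq1r1s,
    family4 .NS (fun p q r s => linkOf (rational [p, q, r, 1, 1, s])) T_pqr11s,
    family3 .WE (fun p q r => linkOf (rational [p, 1, 1, q, 1, 1, r])) T_p11q11r,
    family3 .WE (fun p q r => linkOf (rational [p, 1, q, 1, 1, 1, r])) T_p1q111r,
    family3 .WE (fun p q r => linkOf (rational [p, q, 1, 1, 1, 1, r])) T_pq1111r,
    family2 .NS (fun p q => linkOf (rational [p, 1, 1, 1, 1, 1, 1, q])) T_p111111q,
    family5 .NS (fun p q r s t => linkOf (ramify [twist p, twist q, twist r, twist s, twist t]))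
    T_p_q_r_s_t,
    family4 .WE (fun p q r s => linkOf (ramify [rational [p, 1], twist q, rational [r, 1], twist
    s])) T_p1_q_r1_s,
    family5 .NS (fun p q r s t => linkOf (ramify [rational [p, q, r], twist s, twist t])) T_pqr_s_t,
    family4 .WE (fun p q r s => linkOf (ramify [rational [p, 1, 1, q], twist r, twist s]))
    T_p11q_r_s,
    family4 .WE (fun p q r s => linkOf (ramify [rational [p, 1, q, 1], twist r, twist s]))
    T_p1q1_r_s,
    family4 .WE (fun p q r s => linkOf (ramify [rational [p, q, 1, 1], twist r, twist s]))
    T_pq11_r_s,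
    family3 .NS (fun p q r => linkOf (ramify [rational [p, 1, 1, 1, 1], twist q, twist r]))
    T_p1111_q_r,
    family5 .WE (fun p q r s t => linkOf (ramify [rational [p, q], rational [r, s], twist t]))
    T_pq_rs_t,
    family3 .NS (fun p q r => linkOf (ramify [rational [p, 1, 1], rational [q, 1, 1], twist r]))
    T_p11_q11_r,
    family4 .WE (fun p q r s => linkOf (ramify [rational [p, q], rational [r, 1], rational [s, 1]]))
    T_pq_r1_s1,
    family3 .NS (fun p q r => linkOf (ramify [rational [p, 1, 1], rational [q, 1], rational [r,
    1]])) T_p11_q1_r1,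
    family5 .WE (fun p q r s t => linkOf (ramify [rational [p, q], twist r, twist s, twist t]))
    T_pq_r_s_t,
    family4 .NS (fun p q r s => linkOf (ramify [rational [p, 1, 1], twist q, twist r, twist s]))
    T_p11_q_r_s,
    family4 .WE (fun p q r s => linkOf (ramify [rational [p, 1], rational [q, 1], twist r, twist
    s])) T_p1_q1_r_s,
    family4 .NS (fun p q r s => linkOf (ramify [rational [p, 1, q], rational [r, 1], twist s]))
    T_p1q_r1_s,
    family4 .NS (fun p q r s => linkOf (ramify [rational [p, q, 1], rational [r, 1], twist s]))
    T_pq1_r1_s,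
    family3 .WE (fun p q r => linkOf (ramify [rational [p, 1, 1, 1], rational [q, 1], twist r]))
    T_p111_q1_r,
    family4 .NS (fun p q r s => linkOf (ramify [rational [p, 1, 1], rational [q, r], twist s]))
    T_p11_qr_s,
    family5 .NS (fun p q r s t => linkOf (add (ramify [twist p, twist q, twist r, twist s]) (twist
    t))) T_p_q_r_s_plus_t,
    family5 .WE (fun p q r s t => linkOf (add (ramify [rational [p, q], twist r, twist s]) (twist
    t))) T_pq_r_s_plus_t,
    family4 .NS (fun p q r s => linkOf (add (ramify [rational [p, 1, 1], twist q, twist r]) (twist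
    s))) T_p11_q_r_plus_s,
    family4 .WE (fun p q r s => linkOf (add (ramify [rational [p, 1], rational [q, 1], twist r])
    (twist s))) T_p1_q1_r_plus_s,
    family3 .WE (fun p q r => linkOf (add (ramify [rational [p, 1], rational [q, 1], rational [r,
    1]]) (twist 1))) T_p1_q1_r1_plus,
    family4 .NS (fun p q r s => linkOf (add (ramify [rational [p, 1, q], twist r, twist s]) (twist
    1))) T_p1q_r_s_plus,
    family4 .NS (fun p q r s => linkOf (add (ramify [rational [p, q, 1], twist r, twist s]) (twist
    1))) T_pq1_r_s_plus,
    family3 .WE (fun p q r => linkOf (add (ramify [rational [p, 1, 1, 1], twist q, twist r]) (twist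
    1))) T_p111_q_r_plus,
    family4 .WE (fun p q r s => linkOf (add (ramify [rational [p, 1], twist q, twist r, twist s])
    (twist 1))) T_p1_q_r_s_plus,
    family4 .WE (fun p q r s => linkOf (add (ramify [rational [p, q], rational [r, 1], twist s])
    (twist 1))) T_pq_r1_s_plus,
    family3 .NS (fun p q r => linkOf (add (ramify [rational [p, 1, 1], rational [q, 1], twist r])
    (twist 1))) T_p11_q1_r_plus,
    family5 .NS (fun p q r s t => linkOf (product [ramify [rational [p, q], twist r], ramify [twist
    s, twist t]])) T_Lpq_rR_Ls_tR,
    family4 .WE (fun p q r s => linkOf (product [ramify [rational [p, 1, 1], twist q], ramify [twist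
    r, twist s]])) T_Lp11_qR_Lr_sR,
    family4 .NS (fun p q r s => linkOf (product [ramify [rational [p, 1], rational [q, 1]], ramify
    [twist r, twist s]])) T_Lp1_q1R_Lr_sR,
    family4 .NS (fun p q r s => linkOf (product [ramify [rational [p, 1], twist q], ramify [rational
    [r, 1], twist s]])) T_Lp1_qR_Lr1_sR,
    family5 .WE (fun p q r s t => linkOf (product [ramify [twist p, twist q, twist r], ramify [twist
    s, twist t]])) T_Lp_q_rR_Ls_tR,
    family4 .NS (fun p q r s => linkOf (product [add (ramify [rational [p, 1], twist q]) (twist 1),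
    ramify [twist r, twist s]])) T_Lp1_q_plusR_Lr_sR,
    family4 .WE (fun p q r s => linkOf (product [add (ramify [twist p, twist q]) (twist 1), ramify
    [rational [r, 1], twist s]])) T_Lp_q_plusR_Lr1_sR,
    family4 .WE (fun p q r s => linkOf (product [add (ramify [twist p, twist q]) (twist 1), add
    (ramify [twist r, twist s]) (twist 1)])) T_Lp_q_plusR_Lr_s_plusR,
    family5 .WE (fun p q r s t => linkOf (product [add (ramify [twist p, twist q]) (twist r), ramify
    [twist s, twist t]])) T_Lp_q_plus_rR_Ls_tR,
    family5 .NS (fun p q r s t => linkOf (product [ramify [twist p, twist q], twist r, ramify [twist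
    s, twist t]])) T_Lp_qRrLs_tR,
    family4 .WE (fun p q r s => linkOf (product [ramify [rational [p, 1], twist q], twist 1, ramify
    [twist r, twist s]])) T_Lp1_qR1Lr_sR,
    family4 .WE (fun p q r s => linkOf (product [ramify [twist p, twist q], twist 1, twist 1, ramify
    [twist r, twist s]])) T_Lp_qR11Lr_sR,
    family4 .NS (fun p q r s => linkOf (product [add (ramify [twist p, twist q]) (twist 1), twist 1,
    ramify [twist r, twist s]])) T_Lp_q_plusR1Lr_sR,
    family5 .WE (fun p q r s t => linkOf (ramify [ramify [twist p, twist q], twist r, ramify [twist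
    s, twist t]])) T_Lp_qR_r_Ls_tR,
    family2 .NS (fun p q => dotted [rational [p, 1, q]]) T_dot_p1q,
    family2 .NS (fun p q => dotted [rational [p, q, 1]]) T_dot_pq1,
    family1 .WE (fun p => dotted [rational [p, 1, 1, 1]]) T_dot_p111,
    family3 .WE (fun p q r => dotted [rational [p, q], twist 1, twist r]) T_dot_pq_col_r,
    family3 .WE (fun p q r => dotted [rational [p, q], twist r]) T_dot_pq_dot_r,
    family3 .WE (fun p q r => dotted [rational [p, q], twist 1, reflect (twist r)]) T_dot_pq_col_r0,
    family3 .WE (fun p q r => dotted [rational [p, q], reflect (twist r)]) T_dot_pq_dot_r0,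
    family2 .NS (fun p q => dotted [rational [p, 1, 1], twist 1, twist q]) T_dot_p11_col_q,
    family2 .NS (fun p q => dotted [rational [p, 1, 1], twist q]) T_dot_p11_dot_q,
    family2 .NS (fun p q => dotted [rational [p, 1, 1], twist 1, reflect (twist q)])
    T_dot_p11_col_q0,
    family2 .NS (fun p q => dotted [rational [p, 1, 1], reflect (twist q)]) T_dot_p11_dot_q0,
    family3 .WE (fun p q r => dotted [rational [p, 1], reflect (twist q), twist r])
    T_dot_p1_dot_q0_dot_r,
    family2 .WE (fun p q => dotted [rational [p, 1], twist 1, rational [q, 1]]) T_dot_p1_col_q1,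
    family2 .WE (fun p q => dotted [rational [p, 1], rational [q, 1]]) T_dot_p1_dot_q1,
    family2 .WE (fun p q => dotted [rational [p, 1], twist 1, reflect (rational [q, 1])])
    T_dot_p1_col_q10,
    family2 .WE (fun p q => dotted [rational [p, 1], reflect (rational [q, 1])]) T_dot_p1_dot_q10,
    family3 .NS (fun p q r => dotted [reflect (rational [p, 1]), twist q, twist r])
    T_dot_p10_dot_q_dot_r,
    family3 .WE (fun p q r => dotted [rational [p, 1], twist q, twist r]) T_dot_p1_dot_q_dot_r,
    family3 .NS (fun p q r => dotted [twist p, reflect (rational [q, 1]), twist r])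
    T_dot_p_dot_q10_dot_r,
    family3 .NS (fun p q r => dotted [twist p, rational [q, 1], twist r]) T_dot_p_dot_q1_dot_r,
    family3 .NS (fun p q r => dotted [twist p, rational [q, 1], reflect (twist r)])
    T_dot_p_dot_q1_dot_r0,
    family3 .WE (fun p q r => dotted [rational [p, 1], twist q, reflect (twist r)])
    T_dot_p1_dot_q_dot_r0,
    family3 .NS (fun p q r => antiprism 3 [reflect (rational [p, 1]), twist 1, reflect (twist q),
    twist 1, reflect (twist r)]) T_p10_col_q0_col_r0,
    family3 .WE (fun p q r => antiprism 3 [rational [p, 1], twist 1, twist q, twist 1, twist r])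
    T_p1_col_q_col_r,
    family3 .WE (fun p q r => antiprism 3 [rational [p, 1], twist 1, reflect (twist q), twist 1,
    reflect (twist r)]) T_p1_col_q0_col_r0,
    family3 .NS (fun p q r => antiprism 3 [twist p, twist 1, twist q, twist 1, reflect (rational [r,
    1])]) T_p_col_q_col_r10,
    family3 .WE (fun p q r => antiprism 3 [rational [p, 1], twist 1, twist q, twist 1, reflect
    (twist r)]) T_p1_col_q_col_r0,
    family3 .NS (fun p q r => antiprism 3 [reflect (rational [p, 1]), twist 1, twist q, twist 1,
    reflect (twist r)]) T_p10_col_q_col_r0,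
    family4 .NS (fun p q r s => dotted [twist p, twist q, twist r, twist s])
    T_dot_p_dot_q_dot_r_dot_s,
    family4 .NS (fun p q r s => dotted [twist p, twist q, reflect (twist r), reflect (twist s)])
    T_dot_p_dot_q_dot_r0_dot_s0,
    family4 .NS (fun p q r s => dotted [twist p, twist q, twist r, reflect (twist s)])
    T_dot_p_dot_q_dot_r_dot_s0,
    family4 .NS (fun p q r s => dotted [twist p, reflect (twist q), twist r, reflect (twist s)])
    T_dot_p_dot_q0_dot_r_dot_s0,
    family4 .WE (fun p q r s => antiprism 3 [reflect (twist p), twist q, reflect (twist r), reflect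
    (twist s)]) T_p0_dot_q_dot_r0_dot_s0,
    family4 .WE (fun p q r s => antiprism 3 [reflect (twist p), twist q, twist r, reflect (twist
    s)]) T_p0_dot_q_dot_r_dot_s0,
    family4 .NS (fun p q r s => antiprism 3 [twist p, reflect (twist q), twist r, reflect (twist
    s)]) T_p_dot_q0_dot_r_dot_s0,
    family4 .NS (fun p q r s => antiprism 3 [twist p, twist q, reflect (twist r), twist s])
    T_p_dot_q_dot_r0_dot_s,
    family4 .NS (fun p q r s => antiprism 3 [twist p, twist q, reflect (twist r), reflect (twist
    s)]) T_p_dot_q_dot_r0_dot_s0,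
    family4 .NS (fun p q r s => antiprism 3 [twist p, twist q, twist r, twist s])
    T_p_dot_q_dot_r_dot_s,
    family4 .NS (fun p q r s => antiprism 3 [twist p, twist q, twist r, reflect (twist s)])
    T_p_dot_q_dot_r_dot_s0,
    family2 .NS (fun p q => dotted [ramify [rational [p, 1], twist q]]) T_dot_Lp1_qR,
    family2 .NS (fun p q => dotted [product [ramify [twist p, twist q], twist 1]]) T_dot_Lp_qR1,
    family2 .WE (fun p q => dotted [add (ramify [twist p, twist q]) (twist 1)]) T_dot_Lp_q_plusR,
    family3 .WE (fun p q r => dotted [ramify [twist p, twist q], twist r]) T_dot_Lp_qR_dot_r,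
    family3 .WE (fun p q r => dotted [ramify [twist p, twist q], reflect (twist r)])
    T_dot_Lp_qR_dot_r0,
    family3 .WE (fun p q r => dotted [ramify [twist p, twist q], twist 1, twist r])
    T_dot_Lp_qR_col_r,
    family3 .WE (fun p q r => dotted [ramify [twist p, twist q], twist 1, reflect (twist r)])
    T_dot_Lp_qR_col_r0,
    family2 .WE (fun p q => antiprism 4 [reflect (twist p), twist 1, twist 1, twist 1, reflect
    (twist q)]) T_eight_p0_colcol_q0,
    family2 .WE (fun p q => antiprism 4 [reflect (twist p), twist 1, twist 1, reflect (twist q)])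
    T_eight_p0_coldot_q0,
    family2 .WE (fun p q => antiprism 4 [reflect (twist p), twist 1, reflect (twist q)])
    T_eight_p0_col_q0,
    family2 .WE (fun p q => antiprism 4 [reflect (twist p), reflect (twist q)]) T_eight_p0_dot_q0,
    family1 .WE (fun p => antiprism 4 [rational [p, 1]]) T_eight_p1,
    family1 .NS (fun p => antiprism 4 [reflect (rational [p, 1])]) T_eight_p10,
    family2 .NS (fun p q => antiprism 4 [twist p, twist 1, twist 1, twist 1, twist q])
    T_eight_p_colcol_q,
    family2 .NS (fun p q => antiprism 4 [twist p, twist 1, twist 1, twist q]) T_eight_p_coldot_q,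
    family2 .NS (fun p q => antiprism 4 [twist p, twist 1, twist q]) T_eight_p_col_q,
    family2 .NS (fun p q => antiprism 4 [twist p, twist q]) T_eight_p_dot_q,
    family2 .NS (fun p q => antiprism 4 [twist p, twist 1, twist 1, twist 1, reflect (twist q)])
    T_eight_p_colcol_q0,
    family2 .NS (fun p q => antiprism 4 [twist p, twist 1, twist 1, reflect (twist q)])
    T_eight_p_coldot_q0,
    family2 .NS (fun p q => antiprism 4 [twist p, twist 1, reflect (twist q)]) T_eight_p_col_q0,
    family2 .NS (fun p q => antiprism 4 [twist p, reflect (twist q)]) T_eight_p_dot_q0,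
    family1 .WE (fun p => nineStar [twist 1, twist p]) T_nine_dot_p,
    family1 .NS (fun p => nineStar [twist p]) T_nine_p,
    family1 .WE (fun p => nineStar [twist 1, reflect (twist p)]) T_nine_dot_p0 ]

/-- The formula for the wheel with `n` spokes, where `s` is a square root of
`(1 + x + y) ^ 2 - 4 x y`. -/
def wheelFormula {K : Type} [Field K] (x y s : K) (n : ℕ) : K :=
  ((1 + x + y + s) / 2) ^ n + ((1 + x + y - s) / 2) ^ n + (x * y - x - y - 1)

/-- The diagram for which the Tait graph on the regions of colour `k` yields the Jones polynomial by
the substitution `x = -t`, `y = -1/t` (the other colour belongs to the mirror image). -/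
def Colour.normalize : Colour → Diagram → Diagram
  | .WE, D => D.mirror
  | .NS, D => D

/-- `f = ± A ^ m g` for some integer `m`. -/
def EqUpToUnit {K : Type} [Field K] (A f g : K) : Prop :=
  ∃ m : ℤ, f = A ^ m * g ∨ f = -(A ^ m * g)

/-!
The graph of a diagram and its Kauffman bracket are treated together, as state sums. A state chooses
one of two ways of joining the arcs at every crossing, and a state sum adds up, with weights, a
function of the number of classes of joined arcs that is multiplied by `q` for every further class.
There are three such sums: for the bracket the classes are the loops of the smoothings, and for the
subgraph expansions of the Tutte polynomials of the two checkerboard graphs they are the components of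
the spanning subgraphs (`tutte_taitGraph`). A tangle enters each of them only through two coefficients
(`stateSum_tangle`), because its states can be replaced by one of the two states of a single crossing;
this rests on a criterion, decidable for concrete joins, for the elimination of inner arcs
(`loopCount_eliminate`).

After a rescaling of the two coefficients, all three sums become the same algebraic expression, the
value of a diagram, in parameters `L` and `M` (`Tangle.value`, `Tangle.rawValue_eq`,
`Shape.eval_scale`): `L` and `M` are `x - 1` and `y - 1` for the Tutte polynomials
(`Shape.aeval_tutte`), and `-A ^ 4 - 1` and `-A ^ (-4) - 1` for the bracket (`bracket_diagram`). In the
latter case also the crossing `-1` obtains the second coefficient `1`, and an integer tangle `n` of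
either sign has the coefficients `(x ^ n - 1) / (x - 1)` and `1` (`Tangle.value_twist`). Since a change
of the orientation only changes the writhe, the Jones polynomial is the value up to a unit
(`eqUpToUnit_jones_value`).

The tangles are put together in three ways: by closing up a tangle, by the closure of a braid on three
strands for the antiprisms, where a calculation in the Temperley-Lieb algebra gives the value
(`stateSum_closedBraid`), and by the polyhedron `9*`, the 512 states of which are enumerated
(`stateSum_nine`). It remains to compare the values with the formulas, which are polynomials in the
coefficients of the integer tangles (`hasValue_of_mem_families`), and to diagonalize the product of the
two generators of the Temperley-Lieb algebra for the wheels (`closure_replicate_one`).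
-/

/-! ### Counting the classes of a list of joins -/

/-- The class of a point in the quotient by the joins of a list. -/
def joinClass {α : Type} (J : List (α × α)) (a : α) : Quot fun s t => (s, t) ∈ J :=
  Quot.mk _ a

/-- The number of classes that the joins of `J` leave on a set `V` of points. -/
noncomputable def classCount {α : Type} (V : Set α) (J : List (α × α)) : ℕ :=
  (joinClass J '' V).ncard

/-- The points occurring in a list of joins. -/
def support {α : Type} (J : List (α × α)) : Set α :=
  {l | ∃ j ∈ J, l = j.1 ∨ l = j.2}

/-- Two lists of joins on the same points that generate the same equivalence relation, the latter
expressed by the functions that are constant on its classes. -/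
def SameJoins {α : Type} (J J' : List (α × α)) : Prop :=
  support J = support J' ∧
    ∀ (β : Type) (h : α → β), (∀ p ∈ J, h p.1 = h p.2) ↔ ∀ p ∈ J', h p.1 = h p.2

section Counting

variable {α β γ : Type}

theorem joinClass_eq_of_mem {J : List (α × α)} {p : α × α} (hp : p ∈ J) :
    joinClass J p.1 = joinClass J p.2 := Quot.sound hp

theorem apply_eq_of_joinClass_eq {J : List (α × α)} {h : α → β} (hJ : ∀ p ∈ J, h p.1 = h p.2)
    {a b : α} (hab : joinClass J a = joinClass J b) : h a = h b := by
  have := congrArg (Quot.lift h fun s t hst => hJ (s, t) hst) hab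
  exact this

theorem ncard_image_congr {V : Set α} {h : α → β} {h' : α → γ}
    (hh : ∀ a ∈ V, ∀ b ∈ V, h a = h b ↔ h' a = h' b) : (h '' V).ncard = (h' '' V).ncard := by
  classical
  rcases V.eq_empty_or_nonempty with rfl | ⟨v, hv⟩
  · simp
  have : Nonempty α := ⟨v⟩
  refine Set.ncard_congr (fun x _ => h' (Function.invFunOn h V x)) ?_ ?_ ?_
  · rintro _ ⟨a, ha, rfl⟩
    exact ⟨_, Function.invFunOn_mem ⟨a, ha, rfl⟩, rfl⟩
  · intro x y hx hy hxy
    have h1 := Function.invFunOn_mem hx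
    have h2 := Function.invFunOn_mem hy
    have := (hh _ h1 _ h2).2 hxy
    rwa [Function.invFunOn_eq hx, Function.invFunOn_eq hy] at this
  · rintro _ ⟨a, ha, rfl⟩
    refine ⟨h a, ⟨a, ha, rfl⟩, ?_⟩
    have hx : ∃ b ∈ V, h b = h a := ⟨a, ha, rfl⟩
    exact (hh _ (Function.invFunOn_mem hx) _ ha).1 (Function.invFunOn_eq hx)

theorem classCount_eq_ncard {V : Set α} {J : List (α × α)} {h : α → β}
    (hh : ∀ a ∈ V, ∀ b ∈ V, joinClass J a = joinClass J b ↔ h a = h b) :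
    classCount V J = (h '' V).ncard :=
  ncard_image_congr hh

theorem joinClass_eq_iff_of_forall {J J' : List (α × α)}
    (h : ∀ (β : Type) (h : α → β), (∀ p ∈ J, h p.1 = h p.2) ↔ ∀ p ∈ J', h p.1 = h p.2) (a b : α) :
    joinClass J a = joinClass J b ↔ joinClass J' a = joinClass J' b :=
  ⟨apply_eq_of_joinClass_eq ((h _ _).2 fun _ => joinClass_eq_of_mem),
    apply_eq_of_joinClass_eq ((h _ _).1 fun _ => joinClass_eq_of_mem)⟩

theorem classCount_congr {V : Set α} {J J' : List (α × α)}
    (h : ∀ (β : Type) (h : α → β), (∀ p ∈ J, h p.1 = h p.2) ↔ ∀ p ∈ J', h p.1 = h p.2) :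
    classCount V J = classCount V J' :=
  classCount_eq_ncard fun a _ b _ => joinClass_eq_iff_of_forall h a b

theorem finite_support (J : List (α × α)) : (support J).Finite := by
  have : support J = ⋃ j ∈ {j | j ∈ J}, {j.1, j.2} := by
    ext x; simp only [support, Set.mem_ofPred_eq, Set.mem_iUnion, Set.mem_insert_iff,
      Set.mem_singleton_iff, exists_prop]
  rw [this]
  exact (List.finite_toSet J).biUnion fun j _ => by simp

@[simp]
theorem support_nil : support ([] : List (α × α)) = ∅ := by
  simp [support]

@[simp]
theorem support_cons (p : α × α) (J : List (α × α)) :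
    support (p :: J) = {p.1, p.2} ∪ support J := by
  ext x; simp [support]

@[simp]
theorem support_append (J J' : List (α × α)) :
    support (J ++ J') = support J ∪ support J' := by
  ext x; simp [support, or_and_right, exists_or]

/-- Joins do not leave the set of points that occur in them. -/
theorem eq_of_joinClass_eq_of_notMem {J : List (α × α)} {a b : α} (ha : a ∉ support J)
    (h : joinClass J a = joinClass J b) : a = b := by
  have := apply_eq_of_joinClass_eq (h := fun x => x = a) (fun p hp => ?_) h
  · simpa [eq_comm] using this
  · have h1 : p.1 ≠ a := fun e => ha ⟨p, hp, Or.inl e.symm⟩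
    have h2 : p.2 ≠ a := fun e => ha ⟨p, hp, Or.inr e.symm⟩
    simp [h1, h2]

/-- One more join merges the classes of its two ends. -/
theorem joinClass_cons_eq_iff (p : α × α) (J : List (α × α)) (a b : α) :
    joinClass (p :: J) a = joinClass (p :: J) b ↔
      open Classical in
      (if joinClass J a = joinClass J p.1 then joinClass J p.2 else joinClass J a) =
        if joinClass J b = joinClass J p.1 then joinClass J p.2 else joinClass J b := by
  classical
  have mono : ∀ {a b}, joinClass J a = joinClass J b →
      joinClass (p :: J) a = joinClass (p :: J) b := fun hab =>
    apply_eq_of_joinClass_eq (fun q hq => joinClass_eq_of_mem (List.mem_cons_of_mem _ hq)) hab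
  have hp : joinClass (p :: J) p.1 = joinClass (p :: J) p.2 :=
    joinClass_eq_of_mem List.mem_cons_self
  constructor
  · intro h
    refine apply_eq_of_joinClass_eq (J := p :: J) (h := fun a =>
      if joinClass J a = joinClass J p.1 then joinClass J p.2 else joinClass J a) ?_ h
    intro q hq
    rcases List.mem_cons.1 hq with rfl | hq
    · by_cases h : joinClass J q.2 = joinClass J q.1 <;> simp [h]
    · simp only [joinClass_eq_of_mem hq]
  · intro h
    split_ifs at h with h1 h2 h2
    · exact mono (h1.trans h2.symm)
    · exact (mono h1).trans (hp.trans (mono h))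
    · exact (mono h).trans (hp.symm.trans (mono h2).symm)
    · exact mono h

theorem classCount_cons_of_eq {V : Set α} {p : α × α} {J : List (α × α)}
    (h : joinClass J p.1 = joinClass J p.2) : classCount V (p :: J) = classCount V J := by
  classical
  refine (classCount_eq_ncard fun a _ b _ => ?_).trans rfl
  rw [joinClass_cons_eq_iff, ← h]
  have : ∀ a, (if joinClass J a = joinClass J p.1 then joinClass J p.1 else joinClass J a) =
      joinClass J a := fun a => by split_ifs with h <;> simp [h]
  rw [this, this]

theorem classCount_cons_of_ne {V : Set α} (hV : V.Finite) {p : α × α} {J : List (α × α)}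
    (h1 : p.1 ∈ V) (h2 : p.2 ∈ V) (h : joinClass J p.1 ≠ joinClass J p.2) :
    classCount V J = classCount V (p :: J) + 1 := by
  classical
  rw [classCount_eq_ncard (V := V) (J := p :: J) fun a _ b _ => joinClass_cons_eq_iff p J a b]
  have : (fun a => if joinClass J a = joinClass J p.1 then joinClass J p.2 else joinClass J a) '' V
      = joinClass J '' V \ {joinClass J p.1} := by
    ext x
    constructor
    · rintro ⟨a, ha, rfl⟩
      by_cases hc : joinClass J a = joinClass J p.1
      · simp only [hc, if_true]
        exact ⟨⟨_, h2, rfl⟩, fun e => h e.symm⟩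
      · simp only [hc, if_false]
        exact ⟨⟨_, ha, rfl⟩, hc⟩
    · rintro ⟨⟨a, ha, rfl⟩, hx⟩
      exact ⟨a, ha, if_neg hx⟩
  rw [this]
  exact (Set.ncard_sdiff_singleton_add_one (Set.mem_image_of_mem _ h1) (hV.image _)).symm

theorem loopCount_eq_classCount (J : List (Arc × Arc)) :
    loopCount J = classCount (support J) J := by
  classical
  unfold loopCount classCount
  rw [← Nat.card_coe_set_eq]
  let r : {l : Arc // ∃ j ∈ J, l = j.1 ∨ l = j.2} → {l : Arc // ∃ j ∈ J, l = j.1 ∨ l = j.2} → Prop :=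
    fun s t => (s.1, t.1) ∈ J
  let F : Quot r → (joinClass J '' support J : Set _) :=
    Quot.lift (fun a => ⟨joinClass J a.1, a.1, a.2, rfl⟩) fun a b hab =>
      Subtype.ext (joinClass_eq_of_mem (p := (a.1, b.1)) hab)
  refine Nat.card_congr (Equiv.ofBijective F ⟨?_, ?_⟩)
  · rintro ⟨a⟩ ⟨b⟩ hab
    have hab' : joinClass J a.1 = joinClass J b.1 := congrArg Subtype.val hab
    have := apply_eq_of_joinClass_eq (h := fun x =>
      if hx : ∃ j ∈ J, x = j.1 ∨ x = j.2 then some (Quot.mk r ⟨x, hx⟩) else none) ?_ hab'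
    · simpa [a.2, b.2] using this
    · intro p hp
      have h1 : ∃ j ∈ J, p.1 = j.1 ∨ p.1 = j.2 := ⟨p, hp, Or.inl rfl⟩
      have h2 : ∃ j ∈ J, p.2 = j.1 ∨ p.2 = j.2 := ⟨p, hp, Or.inr rfl⟩
      simp only [h1, h2, dif_pos]
      exact congrArg some (Quot.sound hp)
  · rintro ⟨_, a, ha, rfl⟩
    exact ⟨Quot.mk _ ⟨a, ha⟩, rfl⟩

theorem loopCount_congr {J J' : List (Arc × Arc)} (h : SameJoins J J') :
    loopCount J = loopCount J' := by
  rw [loopCount_eq_classCount, loopCount_eq_classCount, h.1]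
  exact classCount_congr h.2

theorem SameJoins.refl (J : List (α × α)) : SameJoins J J := ⟨rfl, fun _ _ => Iff.rfl⟩

theorem SameJoins.symm {J J' : List (α × α)} (h : SameJoins J J') : SameJoins J' J :=
  ⟨h.1.symm, fun β f => (h.2 β f).symm⟩

theorem SameJoins.append {J J' I I' : List (α × α)} (h : SameJoins J J') (h' : SameJoins I I') :
    SameJoins (J ++ I) (J' ++ I') :=
  ⟨by simp [h.1, h'.1], fun β f => by rw [List.forall_mem_append, List.forall_mem_append, h.2, h'.2]⟩

theorem one_le_loopCount {J : List (Arc × Arc)} (hJ : J ≠ []) : 1 ≤ loopCount J := by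
  rw [loopCount_eq_classCount, classCount, Nat.succ_le_iff,
    Set.ncard_pos ((finite_support J).image _)]
  obtain ⟨p, l, rfl⟩ := List.exists_cons_of_ne_nil hJ
  exact ⟨_, p.1, by simp, rfl⟩

end Counting

/-! ### Eliminating the inner points of a list of joins -/

/-- Labels of the points `0, 1, 2, …` that agree exactly on the classes of a list of joins. -/
def label : List (ℕ × ℕ) → ℕ → ℕ
  | [], i => i
  | p :: K, i => bif label K i == label K p.1 then label K p.2 else label K i

theorem label_eq_iff (K : List (ℕ × ℕ)) (i j : ℕ) :
    label K i = label K j ↔ joinClass K i = joinClass K j := by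
  classical
  induction K generalizing i j with
  | nil =>
    exact ⟨fun h => congrArg _ h, fun h => eq_of_joinClass_eq_of_notMem (by simp) h⟩
  | cons p K ih =>
    rw [joinClass_cons_eq_iff]
    have : ∀ i, label (p :: K) i =
        if joinClass K i = joinClass K p.1 then label K p.2 else label K i := fun i => by
      simp only [label, Bool.cond_eq_ite, beq_iff_eq, ih]
    rw [this, this]
    split_ifs <;> simp [ih]

/-- The points of `K` and `K'` are numbered, those below `o` being the outer ones. The relation
generated by `K` on the points below `N` restricts to the one of `K'` on the outer points, and
has `n` classes without outer points. -/
def Eliminates (o N n : ℕ) (K K' : List (ℕ × ℕ)) : Prop :=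
  (∀ p ∈ K, p.1 < N ∧ p.2 < N) ∧ (∀ p ∈ K', p.1 < o ∧ p.2 < o) ∧
  (∀ i < N, ∃ p ∈ K, i = p.1 ∨ i = p.2) ∧ (∀ i < o, ∃ p ∈ K', i = p.1 ∨ i = p.2) ∧
  (∀ i < o, ∀ j < o, label K i = label K j ↔ label K' i = label K' j) ∧
  (((List.range N).map (label K)).filter fun l =>
    !((List.range o).map (label K)).contains l).dedup.length = n

instance (o N n : ℕ) (K K' : List (ℕ × ℕ)) : Decidable (Eliminates o N n K K') := by
  unfold Eliminates; infer_instance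

/-- Transport of joins of numbered points to joins of arcs. -/
def mapJoins {α : Type} (φ : ℕ → α) (K : List (ℕ × ℕ)) : List (α × α) :=
  K.map (Prod.map φ φ)

theorem joinClass_mapJoins {α : Type} {φ : ℕ → α} {K : List (ℕ × ℕ)} {J : List (α × α)} {i j : ℕ}
    (h : label K i = label K j) :
    joinClass (mapJoins φ K ++ J) (φ i) = joinClass (mapJoins φ K ++ J) (φ j) :=
  apply_eq_of_joinClass_eq (h := fun i => joinClass (mapJoins φ K ++ J) (φ i))
    (fun p hp => joinClass_eq_of_mem (p := (φ p.1, φ p.2))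
      (List.mem_append_left _ (List.mem_map.2 ⟨p, hp, rfl⟩))) ((label_eq_iff K i j).1 h)

theorem support_mapJoins {α : Type} {φ : ℕ → α} {K : List (ℕ × ℕ)} {N : ℕ}
    (h : ∀ p ∈ K, p.1 < N ∧ p.2 < N) (h' : ∀ i < N, ∃ p ∈ K, i = p.1 ∨ i = p.2) :
    support (mapJoins φ K) = φ '' {i | i < N} := by
  ext x
  constructor
  · rintro ⟨_, hq, hx⟩
    obtain ⟨p, hp, rfl⟩ := List.mem_map.1 hq
    rcases hx with rfl | rfl
    · exact ⟨_, (h p hp).1, rfl⟩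
    · exact ⟨_, (h p hp).2, rfl⟩
  · rintro ⟨i, hi, rfl⟩
    obtain ⟨p, hp, hpi⟩ := h' i hi
    refine ⟨_, List.mem_map.2 ⟨p, hp, rfl⟩, ?_⟩
    rcases hpi with rfl | rfl <;> simp

theorem loopCount_eliminate {o N n : ℕ} {K K' : List (ℕ × ℕ)} (hK : Eliminates o N n K K')
    (hoN : o ≤ N) {φ : ℕ → Arc} {J : List (Arc × Arc)}
    (hφ : ∀ i < N, o ≤ i → ∀ j < N, φ i = φ j → i = j)
    (hJ : ∀ i < N, o ≤ i → φ i ∉ support J) :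
    loopCount (mapJoins φ K ++ J) = loopCount (mapJoins φ K' ++ J) + n := by
  classical
  obtain ⟨h1, h2, h3, h4, h5, h6⟩ := hK
  rw [loopCount_eq_classCount, loopCount_eq_classCount]
  rw [support_append, support_append, support_mapJoins h1 h3, support_mapJoins h2 h4]
  set I := mapJoins φ K ++ J
  set I' := mapJoins φ K' ++ J
  let Fresh : Arc → Prop := fun a => ∃ i < N, o ≤ i ∧ φ i = a
  -- An inner point takes the class of an outer point joined to it, if there is one.
  let h : Arc → (Quot fun s t => (s, t) ∈ I') ⊕ ℕ := fun a =>
    if ha : Fresh a then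
      if hb : ∃ j < o, label K j = label K ha.choose then Sum.inl (joinClass I' (φ hb.choose))
      else Sum.inr (label K ha.choose)
    else Sum.inl (joinClass I' a)
  have outer : ∀ {i j}, i < o → j < o → label K i = label K j →
      joinClass I' (φ i) = joinClass I' (φ j) := fun hi hj hij =>
    joinClass_mapJoins ((h5 _ hi _ hj).1 hij)
  have notFresh : ∀ {i}, i < o → ¬ Fresh (φ i) := by
    rintro i hi ⟨j, hj, hoj, e⟩
    have := hφ j hj hoj i (by omega) e
    omega
  have hval : ∀ i < N, (∀ j < o, label K j = label K i → h (φ i) = Sum.inl (joinClass I' (φ j))) ∧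
      ((∀ j < o, label K j ≠ label K i) → h (φ i) = Sum.inr (label K i)) := by
    intro i hi
    by_cases hio : i < o
    · refine ⟨fun j hj hij => ?_, fun hn => absurd rfl (hn i hio)⟩
      simp only [h, notFresh hio, dif_neg, not_false_iff]
      rw [outer hj hio hij]
    · have hF : Fresh (φ i) := ⟨i, hi, by omega, rfl⟩
      have hc : hF.choose = i :=
        hφ _ hF.choose_spec.1 hF.choose_spec.2.1 i hi hF.choose_spec.2.2
      refine ⟨fun j hj hij => ?_, fun hn => ?_⟩
      · have hb : ∃ j < o, label K j = label K hF.choose := ⟨j, hj, by rw [hc, hij]⟩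
        simp only [h, hF, dif_pos, hb]
        rw [outer hb.choose_spec.1 hj]
        rw [hb.choose_spec.2, hc, hij]
      · have hb : ¬ ∃ j < o, label K j = label K hF.choose := by
          rw [hc]; rintro ⟨j, hj, e⟩; exact hn j hj e
        simp only [h, hF, dif_pos, hb, dif_neg, not_false_iff]
        rw [hc]
  have hlab : ∀ i < N, ∀ j < N, label K i = label K j → h (φ i) = h (φ j) := by
    intro i hi j hj hij
    by_cases hb : ∃ k < o, label K k = label K i
    · obtain ⟨k, hk, e⟩ := hb
      rw [(hval i hi).1 k hk e, (hval j hj).1 k hk (e.trans hij)]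
    · push Not at hb
      rw [(hval i hi).2 hb, (hval j hj).2 (by rwa [← hij]), hij]
  have hrest : ∀ a ∈ support J, h a = Sum.inl (joinClass I' a) := by
    intro a ha
    have : ¬ Fresh a := by rintro ⟨i, hi, hoi, rfl⟩; exact hJ i hi hoi ha
    simp only [h, this, dif_neg, not_false_iff]
  have hresp : ∀ p ∈ I, h p.1 = h p.2 := by
    intro p hp
    rcases List.mem_append.1 hp with hp | hp
    · obtain ⟨q, hq, rfl⟩ := List.mem_map.1 hp
      exact hlab _ (h1 q hq).1 _ (h1 q hq).2 ((label_eq_iff _ _ _).2 (joinClass_eq_of_mem hq))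
    · rw [hrest _ ⟨p, hp, Or.inl rfl⟩, hrest _ ⟨p, hp, Or.inr rfl⟩]
      exact congrArg _ (joinClass_eq_of_mem (List.mem_append_right _ hp))
  have hmono : ∀ {a b}, joinClass I' a = joinClass I' b → joinClass I a = joinClass I b := by
    intro a b hab
    refine apply_eq_of_joinClass_eq (J := I') (h := joinClass I) ?_ hab
    intro p hp
    rcases List.mem_append.1 hp with hp | hp
    · obtain ⟨q, hq, rfl⟩ := List.mem_map.1 hp
      exact joinClass_mapJoins ((h5 _ (h2 q hq).1 _ (h2 q hq).2).2
        ((label_eq_iff _ _ _).2 (joinClass_eq_of_mem hq)))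
    · exact joinClass_eq_of_mem (List.mem_append_right _ hp)
  -- Every point has a representative that is either inner and isolated from the outer points, or
  -- whose class is computed by the outer joins.
  have hrep : ∀ a ∈ φ '' {i | i < N} ∪ support J,
      (∃ b, joinClass I a = joinClass I b ∧ h a = Sum.inl (joinClass I' b)) ∨
        ∃ i < N, a = φ i ∧ h a = Sum.inr (label K i) := by
    rintro a (⟨i, hi, rfl⟩ | ha)
    · by_cases hb : ∃ k < o, label K k = label K i
      · obtain ⟨k, hk, e⟩ := hb
        exact Or.inl ⟨φ k, joinClass_mapJoins e.symm, (hval i hi).1 k hk e⟩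
      · push Not at hb
        exact Or.inr ⟨i, hi, rfl, (hval i hi).2 hb⟩
    · exact Or.inl ⟨a, rfl, hrest a ha⟩
  rw [classCount_eq_ncard (h := h) (J := I)]
  swap
  · intro a ha b hb
    refine ⟨apply_eq_of_joinClass_eq hresp, fun hab => ?_⟩
    rcases hrep a ha with ⟨a', ha1, ha2⟩ | ⟨i, hi, rfl, hi2⟩ <;>
    rcases hrep b hb with ⟨b', hb1, hb2⟩ | ⟨j, hj, rfl, hj2⟩
    · rw [ha2, hb2] at hab
      rw [ha1, hb1]; exact hmono (Sum.inl_injective hab)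
    · rw [ha2, hj2] at hab; cases hab
    · rw [hb2, hi2] at hab; cases hab
    · rw [hi2, hj2] at hab
      exact joinClass_mapJoins (Sum.inr_injective hab)
  let L : List ℕ := (((List.range N).map (label K)).filter fun l =>
    !((List.range o).map (label K)).contains l).dedup
  have himg : h '' (φ '' {i | i < N} ∪ support J) =
      Sum.inl '' (joinClass I' '' (φ '' {i | i < o} ∪ support J)) ∪ Sum.inr '' {l | l ∈ L} := by
    have hL : ∀ l, l ∈ L ↔ ∃ i < N, label K i = l ∧ ∀ j < o, label K j ≠ l := by
      intro l
      simp only [L, List.mem_dedup, List.mem_filter, List.mem_map, List.mem_range,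
        Bool.not_eq_true', ← Bool.not_eq_true, List.contains_iff_mem]
      constructor
      · rintro ⟨⟨i, hi, rfl⟩, hn⟩
        exact ⟨i, hi, rfl, fun j hj e => hn ⟨j, hj, e⟩⟩
      · rintro ⟨i, hi, rfl, hn⟩
        exact ⟨⟨i, hi, rfl⟩, fun ⟨j, hj, e⟩ => hn j hj e⟩
    ext x
    constructor
    · rintro ⟨a, ⟨i, hi, rfl⟩ | ha, rfl⟩
      · by_cases hb : ∃ k < o, label K k = label K i
        · obtain ⟨k, hk, e⟩ := hb
          rw [(hval i hi).1 k hk e]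
          exact Or.inl ⟨_, ⟨_, Or.inl ⟨k, hk, rfl⟩, rfl⟩, rfl⟩
        · push Not at hb
          rw [(hval i hi).2 hb]
          exact Or.inr ⟨_, (hL _).2 ⟨i, hi, rfl, hb⟩, rfl⟩
      · rw [hrest a ha]
        exact Or.inl ⟨_, ⟨_, Or.inr ha, rfl⟩, rfl⟩
    · rintro (⟨_, ⟨a, ⟨i, hi, rfl⟩ | ha, rfl⟩, rfl⟩ | ⟨l, hl, rfl⟩)
      · have hi' : i < o := hi
        exact ⟨φ i, Or.inl ⟨i, by simp; omega, rfl⟩, (hval i (by omega)).1 i hi rfl⟩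
      · exact ⟨a, Or.inr ha, hrest a ha⟩
      · obtain ⟨i, hi, rfl, hn⟩ := (hL l).1 hl
        exact ⟨φ i, Or.inl ⟨i, hi, rfl⟩, (hval i hi).2 hn⟩
  have fin : (φ '' {i | i < o} ∪ support J).Finite :=
    ((Set.finite_lt_nat o).image _).union (finite_support J)
  rw [himg, Set.ncard_union_eq ?_ ((fin.image _).image _) ((List.finite_toSet L).image _),
    Set.ncard_image_of_injective _ Sum.inl_injective,
    Set.ncard_image_of_injective _ Sum.inr_injective]
  · congr 1
    rw [← h6, ← List.toFinset_card_of_nodup (List.nodup_dedup _), ← Set.ncard_coe_finset]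
    congr 1
    ext l; simp [L]
  · rw [Set.disjoint_left]
    rintro _ ⟨a, _, rfl⟩ ⟨l, _, e⟩
    cases e

/-! ### State sums and tangles -/

/-- The three state sums of a diagram: the one of the Kauffman bracket, which counts loops, and the
subgraph expansions of the two checkerboard graphs, which count components. -/
inductive Kind
  | loops
  | we
  | ns

/-- The effect on the kinds of a reflection in the NW-SE axis. -/
def Kind.dual : Kind → Kind
  | loops => loops
  | we => ns
  | ns => we

/-- The joins at a crossing that separate West from East for the loops, that delete its edge for the
graph of colour `WE`, and that contract its edge for the graph of colour `NS`. Around the crossing the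
four ends are `a`, `b`, `c`, `d`. -/
def Kind.fst {α : Type} (κ : Kind) (a b c d : α) : List (α × α) :=
  match κ with
  | loops => [(a, b), (c, d)]
  | we => [(a, b), (c, d)]
  | ns => [(b, c), (d, a), (a, b)]

/-- The joins of the other state of a crossing. -/
def Kind.snd {α : Type} (κ : Kind) (a b c d : α) : List (α × α) :=
  match κ with
  | loops => [(b, c), (d, a)]
  | we => [(a, b), (c, d), (b, c)]
  | ns => [(b, c), (d, a)]

/-- The number of classes enclosed by two crossings side by side that are both in the first state. -/
def Kind.enclosed : Kind → ℕ
  | loops => 1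
  | we => 1
  | ns => 0

/-- The factor for two crossings side by side that are both in the first state. -/
def Kind.loopFactor {K : Type} [CommRing K] (q : K) (κ : Kind) : K := q ^ κ.enclosed

/-- A place of a diagram with two possible states, each with a weight and a list of joins. -/
structure Resolved (K : Type) where
  a : K
  X : List (Arc × Arc)
  b : K
  Y : List (Arc × Arc)

/-- The points of both states. -/
def Resolved.points {K : Type} (r : Resolved K) : Set Arc := support r.X ∪ support r.Y

/-- A place with ends `nw`, `sw`, `se`, `ne` whose states have the weights `w`. -/
def Kind.resolve {K : Type} (κ : Kind) (nw sw se ne : Arc) (w : K × K) : Resolved K :=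
  ⟨w.1, κ.fst nw sw se ne, w.2, κ.snd nw sw se ne⟩

/-- The resolution of a crossing, with weights depending on its sign. -/
def Kind.resolveCrossing {K : Type} (κ : Kind) (w : Bool → K × K) (c : Crossing) : Resolved K :=
  κ.resolve c.a c.b c.c c.d (w c.under)

section StateSum

variable {K : Type}

/-- Equality of two places up to the description of the joins and the order of the states. -/
def Resolved.Same (r r' : Resolved K) : Prop :=
  (r.a = r'.a ∧ r.b = r'.b ∧ SameJoins r.X r'.X ∧ SameJoins r.Y r'.Y) ∨
    (r.a = r'.b ∧ r.b = r'.a ∧ SameJoins r.X r'.Y ∧ SameJoins r.Y r'.X)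

theorem support_fst {α : Type} (κ : Kind) (a b c d : α) :
    support (κ.fst a b c d) = {a, b, c, d} := by
  ext x; cases κ <;> simp [Kind.fst] <;> tauto

theorem support_snd {α : Type} (κ : Kind) (a b c d : α) :
    support (κ.snd a b c d) = {a, b, c, d} := by
  ext x; cases κ <;> simp [Kind.snd] <;> tauto

theorem Kind.resolve_points (κ : Kind) (nw sw se ne : Arc) (w : K × K) :
    (κ.resolve nw sw se ne w).points = {nw, sw, se, ne} := by
  simp [Resolved.points, Kind.resolve, support_fst, support_snd]

theorem Kind.resolve_reflect (κ : Kind) (a b c d : Arc) (w : K × K) :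
    (κ.resolve a d c b w).Same (κ.dual.resolve a b c d w.swap) := by
  refine Or.inr ⟨rfl, rfl, ⟨?_, ?_⟩, ⟨?_, ?_⟩⟩
  · simp only [Kind.resolve, support_fst, support_snd]; ext; simp; tauto
  · intro β h; cases κ <;> simp [Kind.resolve, Kind.dual, Kind.fst, Kind.snd] <;> grind
  · simp only [Kind.resolve, support_fst, support_snd]; ext; simp; tauto
  · intro β h; cases κ <;> simp [Kind.resolve, Kind.dual, Kind.fst, Kind.snd] <;> grind

theorem Resolved.Same.symm {r r' : Resolved K} (h : r.Same r') : r'.Same r := by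
  rcases h with ⟨h1, h2, h3, h4⟩ | ⟨h1, h2, h3, h4⟩
  · exact Or.inl ⟨h1.symm, h2.symm, h3.symm, h4.symm⟩
  · exact Or.inr ⟨h2.symm, h1.symm, h4.symm, h3.symm⟩

variable [CommRing K]

/-- The sum over all states of the products of their weights with a function of the number of
classes of the joins, where `J` lists the joins made so far. -/
noncomputable def stateSum (g : ℕ → K) : List (Resolved K) → List (Arc × Arc) → K
  | [], J => g (loopCount J)
  | r :: D, J => r.a * stateSum g D (r.X ++ J) + r.b * stateSum g D (r.Y ++ J)

theorem SameJoins.of_perm {α : Type} {J J' : List (α × α)} (h : J.Perm J') : SameJoins J J' :=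
  ⟨by ext x; simp [support, h.mem_iff], fun β f => by simp [h.mem_iff]⟩

theorem stateSum_congr (g : ℕ → K) (D : List (Resolved K)) {J J' : List (Arc × Arc)}
    (h : SameJoins J J') : stateSum g D J = stateSum g D J' := by
  induction D generalizing J J' with
  | nil => simp only [stateSum, loopCount_congr h]
  | cons r D ih =>
    simp only [stateSum, ih ((SameJoins.refl r.X).append h), ih ((SameJoins.refl r.Y).append h)]

theorem stateSum_cons_congr (g : ℕ → K) {r r' : Resolved K} (hr : r.Same r')
    (D : List (Resolved K)) (J : List (Arc × Arc)) :
    stateSum g (r :: D) J = stateSum g (r' :: D) J := by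
  simp only [stateSum]
  rcases hr with ⟨h1, h2, h3, h4⟩ | ⟨h1, h2, h3, h4⟩ <;>
    rw [h1, h2, stateSum_congr g D (h3.append (.refl J)), stateSum_congr g D (h4.append (.refl J))]
  ring

theorem stateSum_map_congr (g : ℕ → K) {ι : Type} {R R' : ι → Resolved K}
    (h : ∀ i, (R i).Same (R' i)) (L : List ι) (D : List (Resolved K)) (J : List (Arc × Arc)) :
    stateSum g (L.map R ++ D) J = stateSum g (L.map R' ++ D) J := by
  induction L generalizing J with
  | nil => rfl
  | cons i L ih =>
    rw [List.map_cons, List.cons_append, stateSum_cons_congr g (h i)]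
    simp only [stateSum, ih, List.map_cons, List.cons_append]

/-- Inner points that the rest of the diagram does not meet can be eliminated from a state sum. -/
theorem stateSum_eliminate {g : ℕ → K} {q : K} (hg : ∀ n, 1 ≤ n → g (n + 1) = q * g n)
    {o N n : ℕ} {I I' : List (ℕ × ℕ)} (hI : Eliminates o N n I I') (ho : 0 < o) (hoN : o ≤ N)
    {φ : ℕ → Arc} (hφ : ∀ i < N, o ≤ i → ∀ j < N, φ i = φ j → i = j)
    (D : List (Resolved K)) (hD : ∀ r ∈ D, ∀ i < N, o ≤ i → φ i ∉ r.points)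
    (J : List (Arc × Arc)) (hJ : ∀ i < N, o ≤ i → φ i ∉ support J) :
    stateSum g D (mapJoins φ I ++ J) = q ^ n * stateSum g D (mapJoins φ I' ++ J) := by
  induction D generalizing J with
  | nil =>
    have hne : mapJoins φ I' ++ J ≠ [] := by
      obtain ⟨p, hp, _⟩ := hI.2.2.2.1 0 ho
      intro h
      have : I' = [] := List.map_eq_nil_iff.1 (List.append_eq_nil_iff.1 h).1
      simp [this] at hp
    simp only [stateSum, loopCount_eliminate hI hoN hφ hJ]
    have hm : 1 ≤ loopCount (mapJoins φ I' ++ J) := one_le_loopCount hne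
    generalize loopCount (mapJoins φ I' ++ J) = m at *
    clear hI
    induction n with
    | zero => simp
    | succ n ih => rw [← add_assoc, hg _ (by omega), ih]; ring
  | cons r D ih =>
    have hD' : ∀ r ∈ D, ∀ i < N, o ≤ i → φ i ∉ r.points := fun s hs =>
      hD s (List.mem_cons_of_mem _ hs)
    have hr := hD r List.mem_cons_self
    have swap : ∀ (A B C : List (Arc × Arc)), SameJoins (A ++ (B ++ C)) (B ++ (A ++ C)) :=
      fun A B C => .of_perm (by
        rw [← List.append_assoc, ← List.append_assoc]
        exact List.Perm.append_right _ List.perm_append_comm)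
    simp only [stateSum]
    rw [stateSum_congr g D (swap r.X _ _), stateSum_congr g D (swap r.Y _ _),
      stateSum_congr g D (swap r.X (mapJoins φ I') _),
      stateSum_congr g D (swap r.Y (mapJoins φ I') _), ih hD', ih hD']
    · ring
    · intro i hi hoi h
      rcases (support_append _ _).subset h with h | h
      · exact hr i hi hoi (Or.inr h)
      · exact hJ i hi hoi h
    · intro i hi hoi h
      rcases (support_append _ _).subset h with h | h
      · exact hr i hi hoi (Or.inl h)
      · exact hJ i hi hoi h

theorem mapJoins_append {α : Type} (φ : ℕ → α) (I I' : List (ℕ × ℕ)) :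
    mapJoins φ (I ++ I') = mapJoins φ I ++ mapJoins φ I' := List.map_append

theorem mapJoins_fst {α : Type} (φ : ℕ → α) (κ : Kind) (a b c d : ℕ) :
    mapJoins φ (κ.fst a b c d) = κ.fst (φ a) (φ b) (φ c) (φ d) := by
  cases κ <;> rfl

theorem mapJoins_snd {α : Type} (φ : ℕ → α) (κ : Kind) (a b c d : ℕ) :
    mapJoins φ (κ.snd a b c d) = κ.snd (φ a) (φ b) (φ c) (φ d) := by
  cases κ <;> rfl

/-- The weights of the two states of a tangle: the coefficients in its expansion by the two tangles
without crossings. `l` is the factor for two tangles side by side in their first states, and `l'` the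
one for the reflected picture. -/
def Tangle.rawValue (l l' : K) (w : Bool → K × K) : Tangle → K × K
  | crossing e => w e
  | reflect s => (rawValue l' l (Prod.swap ∘ w) s).swap
  | add s t =>
    let u := rawValue l l' w s
    let v := rawValue l l' w t
    (l * u.1 * v.1 + u.1 * v.2 + u.2 * v.1, u.2 * v.2)

/-- All arcs at the crossings of a tangle are ends of it or inner arcs, which are named after it. -/
theorem Tangle.mem_crossings (t : Tangle) (π : List ℕ) (nw sw se ne : Arc) :
    ∀ c ∈ t.crossings π nw sw se ne, ∀ a : Arc, (a = c.a ∨ a = c.b ∨ a = c.c ∨ a = c.d) →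
      a = nw ∨ a = sw ∨ a = se ∨ a = ne ∨ π <:+ a.1 := by
  induction t generalizing π nw sw se ne with
  | crossing e =>
    intro c hc a ha
    simp only [crossings, List.mem_singleton] at hc
    subst hc
    simp only at ha
    tauto
  | reflect s ih =>
    intro c hc a ha
    simp only [crossings, List.mem_map] at hc
    obtain ⟨c', hc', rfl⟩ := hc
    have := ih _ _ _ _ _ c' hc' a (by simp only at ha; tauto)
    tauto
  | add s t ihs iht =>
    intro c hc a ha
    simp only [crossings, List.mem_append] at hc
    have key : ∀ (i : ℕ) (b : Arc), (i :: π) <:+ b.1 → π <:+ b.1 := fun i b h =>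
      (List.suffix_cons i π).trans h
    have key' : ∀ i : ℕ, ∀ a : Arc, a = (π, i) → π <:+ a.1 := by
      rintro i _ rfl; exact List.suffix_rfl
    rcases hc with hc | hc
    · have := ihs _ _ _ _ _ c hc a ha
      have := key 0 a
      have := key' 0 a
      have := key' 1 a
      tauto
    · have := iht _ _ _ _ _ c hc a ha
      have := key 1 a
      have := key' 0 a
      have := key' 1 a
      tauto

theorem cons_suffix_unique {π l : List ℕ} {i j : ℕ} (hi : (i :: π) <:+ l) (hj : (j :: π) <:+ l) :
    i = j := by
  have := List.suffix_of_suffix_length_le hi hj (by simp)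
  have := this.eq_of_length (by simp)
  simpa using this

/-- A tangle inside a diagram can be replaced by a single place weighted by its value. -/
theorem stateSum_tangle {g : ℕ → K} {q : K} (hg : ∀ n, 1 ≤ n → g (n + 1) = q * g n) (t : Tangle) :
    ∀ (κ : Kind) (w : Bool → K × K) (π : List ℕ) (nw sw se ne : Arc) (D : List (Resolved K))
      (J : List (Arc × Arc)), (∀ a ∈ ({nw, sw, se, ne} : Set Arc), ¬ π <:+ a.1) →
      (∀ r ∈ D, ∀ a ∈ r.points, ¬ π <:+ a.1) → (∀ a ∈ support J, ¬ π <:+ a.1) →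
      stateSum g ((t.crossings π nw sw se ne).map (κ.resolveCrossing w) ++ D) J =
        stateSum g (κ.resolve nw sw se ne
          (t.rawValue (κ.loopFactor q) (κ.dual.loopFactor q) w) :: D) J := by
  induction t with
  | crossing e => intros; rfl
  | reflect s ih =>
    intro κ w π nw sw se ne D J hE hD hJ
    simp only [crossings, List.map_map]
    have h1 : ∀ c : Crossing, (κ.resolveCrossing w ∘ fun c : Crossing =>
        (⟨c.a, c.d, c.c, c.b, c.under⟩ : Crossing)) c |>.Same
          (κ.dual.resolveCrossing (Prod.swap ∘ w) c) := fun c =>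
      Kind.resolve_reflect κ _ _ _ _ _
    rw [stateSum_map_congr g h1, ih κ.dual (Prod.swap ∘ w) π nw ne se sw D J
      (fun a ha => hE a (by simp at ha ⊢; tauto)) hD hJ]
    have h2 := (Kind.resolve_reflect κ nw ne se sw
      ((rawValue (κ.dual.loopFactor q) (κ.loopFactor q) (Prod.swap ∘ w) s).swap)).symm
    have h3 : κ.dual.dual = κ := by cases κ <;> rfl
    rw [h3]
    rw [Prod.swap_swap] at h2
    exact stateSum_cons_congr g h2 D J
  | add s t ihs iht =>
    intro κ w π nw sw se ne D J hE hD hJ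
    have sub : ∀ (i : ℕ) (l : List ℕ), ¬ π <:+ l → ¬ (i :: π) <:+ l := fun i l h h' =>
      h ((List.suffix_cons i π).trans h')
    have len : ∀ i : ℕ, ¬ (i :: π) <:+ π := fun i h => by
      have := h.length_le; simp at this
    simp only [crossings, List.map_append, List.append_assoc]
    rw [ihs κ w (0 :: π)]
    rotate_left
    · intro a ha
      simp only [Set.mem_insert_iff, Set.mem_singleton_iff] at ha
      rcases ha with rfl | rfl | rfl | rfl
      · exact sub _ _ (hE _ (by simp))
      · exact sub _ _ (hE _ (by simp))
      · exact len 0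
      · exact len 0
    · intro r hr a ha
      rcases List.mem_append.1 hr with hr | hr
      · obtain ⟨c, hc, rfl⟩ := List.mem_map.1 hr
        rw [Kind.resolveCrossing, Kind.resolve_points] at ha
        have := mem_crossings t _ _ _ _ _ c hc a ha
        rcases this with rfl | rfl | rfl | rfl | h
        · exact len 0
        · exact len 0
        · exact sub _ _ (hE _ (by simp))
        · exact sub _ _ (hE _ (by simp))
        · intro h'
          have := cons_suffix_unique h h'
          omega
      · exact sub _ _ (hD r hr a ha)
    · exact fun a ha => sub _ _ (hJ a ha)
    have ht : ∀ (Z : List (Arc × Arc)), (support Z = {nw, sw, (π, 1), (π, 0)}) →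
        stateSum g ((t.crossings (1 :: π) (π, 0) (π, 1) se ne).map (κ.resolveCrossing w) ++ D)
          (Z ++ J) = _ := fun Z hZ => iht κ w (1 :: π) (π, 0) (π, 1) se ne D (Z ++ J) (by
        intro a ha
        simp only [Set.mem_insert_iff, Set.mem_singleton_iff] at ha
        rcases ha with rfl | rfl | rfl | rfl
        · exact len 1
        · exact len 1
        · exact sub _ _ (hE _ (by simp))
        · exact sub _ _ (hE _ (by simp))) (fun r hr a ha => sub _ _ (hD r hr a ha)) (by
        intro a ha
        rw [support_append, hZ] at ha
        rcases ha with ha | ha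
        · simp only [Set.mem_insert_iff, Set.mem_singleton_iff] at ha
          rcases ha with rfl | rfl | rfl | rfl
          · exact sub _ _ (hE _ (by simp))
          · exact sub _ _ (hE _ (by simp))
          · exact len 1
          · exact len 1
        · exact sub _ _ (hJ a ha))
    simp only [stateSum, Kind.resolve] at ht ⊢
    rw [ht _ (support_fst κ _ _ _ _), ht _ (support_snd κ _ _ _ _)]
    let φ : ℕ → Arc := fun i => [nw, sw, se, ne, (π, 1), (π, 0)].getD i nw
    have elim : ∀ {n : ℕ} {I I' : List (ℕ × ℕ)}, Eliminates 4 6 n I I' →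
        stateSum g D (mapJoins φ I ++ J) = q ^ n * stateSum g D (mapJoins φ I' ++ J) := by
      intro n I I' hI
      have hne : ∀ (k : ℕ) (a : Arc), ¬ π <:+ a.1 → a ≠ (π, k) := by
        rintro k _ h rfl; exact h List.suffix_rfl
      refine stateSum_eliminate hg hI (by norm_num) (by norm_num) ?_ D ?_ J ?_
      · have h0 := hE nw (by simp)
        have h1 := hE sw (by simp)
        have h2 := hE se (by simp)
        have h3 := hE ne (by simp)
        intro i hi hoi j hj hij
        interval_cases i <;> interval_cases j <;> simp [φ] at hij ⊢
        · exact hne _ _ h0 hij.symm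
        · exact hne _ _ h1 hij.symm
        · exact hne _ _ h2 hij.symm
        · exact hne _ _ h3 hij.symm
        · exact hne _ _ h0 hij.symm
        · exact hne _ _ h1 hij.symm
        · exact hne _ _ h2 hij.symm
        · exact hne _ _ h3 hij.symm
      · intro r hr i hi hoi h
        have := hD r hr _ h
        interval_cases i <;> exact this List.suffix_rfl
      · intro i hi hoi h
        have := hJ _ h
        interval_cases i <;> exact this List.suffix_rfl
    have r11 : Eliminates 4 6 κ.enclosed
        (κ.fst 5 4 2 3 ++ κ.fst 0 1 4 5) (κ.fst 0 1 2 3) := by cases κ <;> decide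
    have r12 : Eliminates 4 6 0 (κ.snd 5 4 2 3 ++ κ.fst 0 1 4 5) (κ.fst 0 1 2 3) := by
      cases κ <;> decide
    have r21 : Eliminates 4 6 0 (κ.fst 5 4 2 3 ++ κ.snd 0 1 4 5) (κ.fst 0 1 2 3) := by
      cases κ <;> decide
    have r22 : Eliminates 4 6 0 (κ.snd 5 4 2 3 ++ κ.snd 0 1 4 5) (κ.snd 0 1 2 3) := by
      cases κ <;> decide
    have e11 := elim r11
    have e12 := elim r12
    have e21 := elim r21
    have e22 := elim r22
    simp only [mapJoins_append, mapJoins_fst, mapJoins_snd, List.append_assoc] at e11 e12 e21 e22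
    simp only [φ, List.getD_cons_zero, List.getD_cons_succ] at e11 e12 e21 e22
    rw [e11, e12, e21, e22]
    simp only [rawValue, Kind.loopFactor]
    ring

end StateSum

/-! ### The Tutte polynomial as a sum over subgraphs -/

section Tutte

variable {V : Type} {K : Type} [CommRing K]

/-- The subgraph expansion `∑ q ^ k(S) u ^ |G - S| v ^ |S|` of a graph with vertex set `U`, where
the edges of `J` belong to all the subgraphs `S` and `k` counts components. -/
noncomputable def subgraphSum (q u v : K) (U : Set V) : List (V × V) → List (V × V) → K
  | [], J => q ^ classCount U J
  | e :: G, J => u * subgraphSum q u v U G J + v * subgraphSum q u v U G (e :: J)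

theorem subgraphSum_contract (q u v : K) {U : Set V} {e : V × V} (h1 : e.1 ∈ U)
    (he : e.1 ≠ e.2) (G J : List (V × V)) :
    subgraphSum q u v U G (J ++ [e]) =
      subgraphSum q u v (U \ {e.2}) (contract e G) (contract e J) := by
  classical
  induction G generalizing J with
  | nil =>
    simp only [subgraphSum, contract, List.map_nil]
    congr 1
    set m := mergeVertex e.1 e.2
    have m1 : m e.1 = e.1 := by simp [m, mergeVertex, he]
    have m2 : m e.2 = e.1 := by simp [m, mergeVertex]
    have m3 : ∀ a, a ≠ e.2 → m a = a := fun a ha => by simp [m, mergeVertex, ha]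
    have hm : m '' U = U \ {e.2} := by
      ext x
      constructor
      · rintro ⟨a, ha, rfl⟩
        by_cases hae : a = e.2
        · rw [hae, m2]; exact ⟨h1, he⟩
        · rw [m3 a hae]; exact ⟨ha, hae⟩
      · rintro ⟨hx, hxe⟩
        exact ⟨x, hx, m3 x hxe⟩
    have cls : ∀ a, joinClass (J ++ [e]) (m a) = joinClass (J ++ [e]) a := by
      intro a
      by_cases hae : a = e.2
      · rw [hae, m2]; exact joinClass_eq_of_mem (by simp)
      · rw [m3 a hae]
    have ker : ∀ a ∈ U, ∀ b ∈ U, joinClass (J ++ [e]) a = joinClass (J ++ [e]) b ↔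
        (joinClass (J.map fun f => (m f.1, m f.2)) ∘ m) a =
          (joinClass (J.map fun f => (m f.1, m f.2)) ∘ m) b := by
      intro a _ b _
      constructor
      · refine apply_eq_of_joinClass_eq fun p hp => ?_
        rcases List.mem_append.1 hp with hp | hp
        · exact joinClass_eq_of_mem (p := (m p.1, m p.2)) (List.mem_map.2 ⟨p, hp, rfl⟩)
        · rw [List.mem_singleton.1 hp]; simp [m1, m2]
      · intro h
        rw [← cls a, ← cls b]
        refine apply_eq_of_joinClass_eq (h := joinClass (J ++ [e])) (fun p hp => ?_) h
        obtain ⟨p, hq, rfl⟩ := List.mem_map.1 hp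
        simp only [cls]
        exact joinClass_eq_of_mem (List.mem_append_left _ hq)
    rw [classCount_eq_ncard ker, Set.image_comp, hm]
    rfl
  | cons f G ih =>
    have := ih (f :: J)
    simp only [contract, List.map_cons, List.cons_append] at this ih ⊢
    simp only [subgraphSum, ih, this]

theorem subgraphSum_congr (q u v : K) (U : Set V) (G : List (V × V)) {J J' : List (V × V)}
    (h : ∀ (β : Type) (h : V → β), (∀ p ∈ J, h p.1 = h p.2) ↔ ∀ p ∈ J', h p.1 = h p.2) :
    subgraphSum q u v U G J = subgraphSum q u v U G J' := by
  induction G generalizing J J' with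
  | nil => simp only [subgraphSum, classCount_congr h]
  | cons f G ih =>
    simp only [subgraphSum, ih h]
    rw [ih (J := f :: J) (J' := f :: J') fun β k => by
      rw [List.forall_mem_cons, List.forall_mem_cons, h]]

theorem joinClass_mono {J J' : List (V × V)} (hJ : J ⊆ J') {a b : V}
    (h : joinClass J a = joinClass J b) : joinClass J' a = joinClass J' b :=
  apply_eq_of_joinClass_eq (fun _ hp => joinClass_eq_of_mem (hJ hp)) h

theorem subgraphSum_bridge (q u v : K) {U : Set V} (hU : U.Finite) {e : V × V} (h1 : e.1 ∈ U)
    (h2 : e.2 ∈ U) (G J : List (V × V)) (hb : joinClass (G ++ J) e.1 ≠ joinClass (G ++ J) e.2) :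
    subgraphSum q u v U G J = q * subgraphSum q u v U G (J ++ [e]) := by
  induction G generalizing J with
  | nil =>
    simp only [subgraphSum]
    rw [classCount_cons_of_ne (J := J) hU h1 h2 hb, pow_succ']
    congr 2
    exact classCount_congr fun β k => by simp [or_imp, forall_and, and_comm]
  | cons f G ih =>
    simp only [subgraphSum]
    rw [ih J, ih (f :: J)]
    · simp only [List.cons_append]; ring
    · exact fun h => hb (joinClass_mono (by intro x hx; simp at hx ⊢; tauto) h)
    · exact fun h => hb (joinClass_mono (by intro x hx; simp at hx ⊢; tauto) h)

theorem isBridgeOver_iff (e : V × V) (G : List (V × V)) :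
    IsBridgeOver e G ↔ joinClass G e.1 ≠ joinClass G e.2 :=
  not_congr ⟨fun h => Quot.eqvGen_sound h, fun h => Quot.eqvGen_exact h⟩

/-- The Tutte polynomial is the subgraph expansion up to a monomial: its exponents are the number of
components and the number of vertices. -/
theorem tutte_eq_subgraphSum (X Y : K) (G : List (V × V)) :
    ∀ U : Set V, U.Finite → (∀ e ∈ G, e.1 ∈ U ∧ e.2 ∈ U) →
      X ^ classCount U G * Y ^ U.ncard * MvPolynomial.aeval ![X + 1, Y + 1] (tutte G) =
        subgraphSum (X * Y) 1 Y U G [] := by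
  classical
  induction hn : G.length generalizing G with
  | zero =>
    intro U _ _
    rw [List.length_eq_zero_iff.1 hn]
    have : classCount U ([] : List (V × V)) = U.ncard :=
      Set.ncard_image_of_injective _ fun a b h => eq_of_joinClass_eq_of_notMem (by simp) h
    simp [tutte, subgraphSum, this, mul_pow]
  | succ n ih =>
    intro U hU hG
    obtain ⟨e, G, rfl⟩ := List.exists_cons_of_length_eq_add_one hn
    have hn' : G.length = n := by simpa using hn
    obtain ⟨h1, h2⟩ := hG e List.mem_cons_self
    have hG' : ∀ e ∈ G, e.1 ∈ U ∧ e.2 ∈ U := fun f hf => hG f (List.mem_cons_of_mem _ hf)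
    have ihG := ih G hn' U hU hG'
    rw [tutte]
    by_cases hl : e.1 = e.2
    · rw [if_pos hl, classCount_cons_of_eq (by rw [hl])]
      have : subgraphSum (X * Y) 1 Y U G [e] = subgraphSum (X * Y) 1 Y U G [] :=
        subgraphSum_congr _ _ _ _ _ fun β k => by simp [hl]
      simp only [subgraphSum, this, ← ihG]
      simp
      ring
    · rw [if_neg hl]
      have hc := subgraphSum_contract (X * Y) 1 Y h1 hl G []
      have ihC := ih (contract e G) (by simp [contract, hn']) (U \ {e.2}) (hU.subset Set.sdiff_subset) (by
        intro f hf
        obtain ⟨f, hf', rfl⟩ := List.mem_map.1 hf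
        have key : ∀ a ∈ U, mergeVertex e.1 e.2 a ∈ U \ {e.2} := by
          intro a ha
          unfold mergeVertex
          split_ifs with h
          · exact ⟨h1, hl⟩
          · exact ⟨ha, h⟩
        exact ⟨key _ (hG' f hf').1, key _ (hG' f hf').2⟩)
      have hcc : classCount (U \ {e.2}) (contract e G) = classCount U (e :: G) := by
        -- the component count is the exponent of a subgraph expansion with a single term
        have := subgraphSum_contract (2 : ℤ) 0 1 h1 hl [] G
        simp only [subgraphSum] at this
        have h3 : classCount U (G ++ [e]) = classCount (U \ {e.2}) (contract e G) :=
          pow_right_injective₀ (by norm_num) (by norm_num) this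
        rw [← h3]
        exact classCount_congr fun β k => by simp [or_imp, forall_and, and_comm]
      have hV : U.ncard = (U \ {e.2}).ncard + 1 :=
        (Set.ncard_sdiff_singleton_add_one h2 hU).symm
      rw [hcc] at ihC
      have hce : contract e ([] : List (V × V)) = [] := rfl
      rw [hce, ← ihC] at hc
      simp only [List.nil_append] at hc
      by_cases hb : IsBridgeOver e G
      · rw [if_pos hb]
        rw [isBridgeOver_iff] at hb
        have := subgraphSum_bridge (X * Y) 1 Y hU h1 h2 G [] (by rwa [List.append_nil])
        simp only [List.nil_append] at this
        simp only [subgraphSum, this, hc, hV]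
        simp
        ring
      · rw [if_neg hb]
        rw [isBridgeOver_iff, not_not] at hb
        have hcb : classCount U (e :: G) = classCount U G := classCount_cons_of_eq hb
        rw [hcb] at hc ⊢
        simp only [subgraphSum, hc, ← ihG, hV]
        simp
        ring

/-! ### The checkerboard graphs -/

/-- The kind of the subgraph expansion of the graph of a colour. -/
def Colour.kind : Colour → Kind
  | .WE => .we
  | .NS => .ns

/-- The weights at a crossing when its edge has the weight `u` for deletion and `v` for
contraction. -/
def Colour.weight {K : Type} (u v : K) : Colour → K × K
  | .WE => (u, v)
  | .NS => (v, u)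

/-- The pairs of arcs joined around the corners of a colour. -/
def Crossing.cornerJoins (k : Colour) (c : Crossing) : List (Arc × Arc) :=
  [(c.corners k).1, (c.corners k).2]

/-- The arcs of a diagram. -/
def Diagram.arcs (D : Diagram) : Set Arc :=
  {a | ∃ c ∈ D, a = c.a ∨ a = c.b ∨ a = c.c ∨ a = c.d}

theorem joinClass_region (k : Colour) (D : Diagram) (S : List (Arc × Arc)) (a b : Arc) :
    joinClass (S.map (Prod.map (Quot.mk (Adjacent k D)) (Quot.mk (Adjacent k D)))) (Quot.mk _ a) =
      joinClass (S.map (Prod.map (Quot.mk (Adjacent k D)) (Quot.mk (Adjacent k D))))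
        (Quot.mk _ b) ↔
    joinClass (D.flatMap (Crossing.cornerJoins k) ++ S) a =
      joinClass (D.flatMap (Crossing.cornerJoins k) ++ S) b := by
  constructor
  · intro h
    refine apply_eq_of_joinClass_eq (h := Quot.lift
      (joinClass (D.flatMap (Crossing.cornerJoins k) ++ S)) ?_) ?_ h
    · rintro s t ⟨c, hc, hst⟩
      refine joinClass_eq_of_mem (p := (s, t)) (List.mem_append_left _ (List.mem_flatMap.2 ⟨c, hc, ?_⟩))
      simpa [Crossing.cornerJoins] using hst
    · intro p hp
      obtain ⟨p, hq, rfl⟩ := List.mem_map.1 hp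
      exact joinClass_eq_of_mem (List.mem_append_right _ hq)
  · refine apply_eq_of_joinClass_eq (h := fun a => joinClass
      (S.map (Prod.map (Quot.mk (Adjacent k D)) (Quot.mk (Adjacent k D)))) (Quot.mk _ a)) ?_
    intro p hp
    rcases List.mem_append.1 hp with hp | hp
    · obtain ⟨c, hc, hp⟩ := List.mem_flatMap.1 hp
      exact congrArg _ (Quot.sound ⟨c, hc, by simpa [Crossing.cornerJoins] using hp⟩)
    · exact joinClass_eq_of_mem (p := (Quot.mk _ p.1, Quot.mk _ p.2)) (List.mem_map.2 ⟨p, hp, rfl⟩)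

/-- The end of a crossing in each of the two regions of a colour that meet there. -/
def Crossing.edgeArcs (k : Colour) (c : Crossing) : Arc × Arc :=
  ((c.corners k).1.1, (c.corners k).2.1)

theorem subgraphSum_taitGraph_aux (q u v : K) (k : Colour) (D : Diagram) :
    ∀ (D' : Diagram) (S J : List (Arc × Arc)),
      (∀ (β : Type) (h : Arc → β), (∀ p ∈ D.flatMap (Crossing.cornerJoins k) ++ S, h p.1 = h p.2) ↔
        ∀ p ∈ D'.flatMap (Crossing.cornerJoins k) ++ J, h p.1 = h p.2) →
      support J ∪ Diagram.arcs D' = D.arcs →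
      subgraphSum q u v (Quot.mk (Adjacent k D) '' D.arcs)
          (D'.map fun c => Prod.map (Quot.mk _) (Quot.mk _) (c.edgeArcs k))
          (S.map (Prod.map (Quot.mk _) (Quot.mk _))) =
        stateSum (fun n => q ^ n) (D'.map (k.kind.resolveCrossing fun _ => k.weight u v)) J := by
  intro D'
  induction D' with
  | nil =>
    intro S J hJ hs
    simp only [subgraphSum, stateSum, List.map_nil]
    congr 1
    rw [loopCount_eq_classCount]
    have hs' : support J = D.arcs := by
      rw [← hs]; simp [Diagram.arcs]
    rw [hs', classCount, ← Set.image_comp]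
    refine ncard_image_congr fun a _ b _ => ?_
    refine (joinClass_region k D S a b).trans ?_
    exact joinClass_eq_iff_of_forall (by simpa using hJ) a b
  | cons c D' ih =>
    intro S J hJ hs
    have hs1 : ∀ X : List (Arc × Arc), support X = {c.a, c.b, c.c, c.d} →
        support (X ++ J) ∪ Diagram.arcs D' = D.arcs := by
      intro X hX
      rw [← hs, support_append, hX]
      ext x
      by_cases hx : x ∈ support J <;> simp [Diagram.arcs, hx, or_assoc]
    have e1 := ih S (c.cornerJoins k ++ J) (by
      intro β h
      rw [hJ]
      simp only [List.flatMap_cons, List.forall_mem_append]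
      tauto) (hs1 _ (by
        ext x; cases k <;> simp [Crossing.cornerJoins, Crossing.corners] <;> tauto))
    have e2 := ih (c.edgeArcs k :: S) (c.edgeArcs k :: c.cornerJoins k ++ J) (by
      intro β h
      have := hJ β h
      simp only [List.flatMap_cons, List.forall_mem_append, List.forall_mem_cons,
        List.cons_append] at this ⊢
      tauto) (hs1 _ (by
        ext x
        cases k <;> simp [Crossing.cornerJoins, Crossing.corners, Crossing.edgeArcs] <;> tauto))
    simp only [List.map_cons, subgraphSum, stateSum] at e1 e2 ⊢
    rw [e1, e2]
    have s1 : ∀ X X' : List (Arc × Arc), support X = support X' → (∀ (β : Type) (h : Arc → β),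
        (∀ p ∈ X, h p.1 = h p.2) ↔ ∀ p ∈ X', h p.1 = h p.2) → ∀ E : List (Resolved K),
        stateSum (fun n => q ^ n) E (X ++ J) = stateSum (fun n => q ^ n) E (X' ++ J) :=
      fun X X' h h' E => stateSum_congr _ _ (SameJoins.append ⟨h, h'⟩ (.refl J))
    cases k
    · simp only [Kind.resolveCrossing, Kind.resolve, Colour.kind, Colour.weight]
      congr 2
      refine s1 _ _ ?_ ?_ _
      · ext x
        simp [Crossing.cornerJoins, Crossing.corners, Crossing.edgeArcs, Kind.snd]
        tauto
      · intro β h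
        simp [Crossing.cornerJoins, Crossing.corners, Crossing.edgeArcs, Kind.snd]
        grind
    · simp only [Kind.resolveCrossing, Kind.resolve, Colour.kind, Colour.weight]
      rw [add_comm]
      congr 2
      refine s1 _ _ ?_ ?_ _
      · ext x
        simp [Crossing.cornerJoins, Crossing.corners, Crossing.edgeArcs, Kind.fst]
        tauto
      · intro β h
        simp [Crossing.cornerJoins, Crossing.corners, Crossing.edgeArcs, Kind.fst]
        grind

/-- The subgraph expansion of a checkerboard graph as a state sum of the diagram. -/
theorem subgraphSum_taitGraph (q u v : K) (k : Colour) (D : Diagram) :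
    subgraphSum q u v (Quot.mk (Adjacent k D) '' D.arcs) (taitGraph k D) [] =
      stateSum (fun n => q ^ n) (D.map (k.kind.resolveCrossing fun _ => k.weight u v)) [] :=
  subgraphSum_taitGraph_aux q u v k D D [] [] (by simp) (by simp)

theorem Diagram.finite_arcs (D : Diagram) : D.arcs.Finite := by
  have : D.arcs = ⋃ c ∈ {c | c ∈ D}, {c.a, c.b, c.c, c.d} := by
    ext x; simp [arcs]
  rw [this]
  exact (List.finite_toSet D).biUnion fun c _ => by simp

theorem subgraphSum_delete (q : K) (U : Set V) (G J : List (V × V)) :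
    subgraphSum q 1 0 U G J = q ^ classCount U J := by
  induction G with
  | nil => rfl
  | cons e G ih => simp [subgraphSum, ih]

theorem subgraphSum_keep (q : K) (U : Set V) (G J : List (V × V)) :
    subgraphSum q 0 1 U G J = q ^ classCount U (G ++ J) := by
  induction G generalizing J with
  | nil => rfl
  | cons e G ih =>
    simp only [subgraphSum, ih, zero_mul, one_mul, zero_add]
    congr 1
    exact classCount_congr fun β k => by simp [or_imp, forall_and]; tauto

/-- The Tutte polynomial of a connected checkerboard graph from the state sum of the diagram; the
number of vertices and the connectedness are read off from two special state sums. -/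
theorem tutte_taitGraph (k : Colour) (D : Diagram) (n : ℕ)
    (hn : stateSum (fun n => (2 : ℤ) ^ n)
      (D.map (k.kind.resolveCrossing fun _ => k.weight 1 0)) [] = 2 ^ n)
    (hc : stateSum (fun n => (2 : ℤ) ^ n)
      (D.map (k.kind.resolveCrossing fun _ => k.weight 0 1)) [] = 2) (X Y : K) :
    X * Y ^ n * MvPolynomial.aeval ![X + 1, Y + 1] (tutte (taitGraph k D)) =
      stateSum (fun n => (X * Y) ^ n) (D.map (k.kind.resolveCrossing fun _ => k.weight 1 Y)) [] := by
  rw [← subgraphSum_taitGraph] at hn hc ⊢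
  rw [subgraphSum_delete] at hn
  rw [subgraphSum_keep, List.append_nil] at hc
  have inj : Function.Injective fun n : ℕ => (2 : ℤ) ^ n := pow_right_injective₀ (by norm_num) (by norm_num)
  have hn' := inj hn
  have hc' := inj (a₂ := 1) (hc.trans (pow_one _).symm)
  have hU : classCount (Quot.mk (Adjacent k D) '' D.arcs) [] =
      (Quot.mk (Adjacent k D) '' D.arcs).ncard :=
    Set.ncard_image_of_injective _ fun a b h => eq_of_joinClass_eq_of_notMem (by simp) h
  rw [hU] at hn'
  have := tutte_eq_subgraphSum X Y (taitGraph k D) (Quot.mk (Adjacent k D) '' D.arcs)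
    (D.finite_arcs.image _) (by
      intro e he
      obtain ⟨c, hc, rfl⟩ := List.mem_map.1 he
      constructor <;> refine ⟨_, ⟨c, hc, ?_⟩, rfl⟩ <;> cases k <;> simp [Crossing.corners])
  rwa [hn', hc', pow_one] at this

end Tutte

/-! ### Tangles in a fixed position -/

/-- A tangle in a diagram, with the name of its inner arcs and its four ends. -/
structure Place where
  t : Tangle
  π : List ℕ
  nw : Arc
  sw : Arc
  se : Arc
  ne : Arc

/-- The crossings of a tangle in a diagram. -/
def Place.crossings (p : Place) : Diagram := p.t.crossings p.π p.nw p.sw p.se p.ne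

/-- The ends of the places are named by shorter paths than their inner arcs. -/
def Place.Within (m : ℕ) (p : Place) : Prop :=
  p.π.length = m ∧ ∀ a ∈ ({p.nw, p.sw, p.se, p.ne} : Set Arc), a.1.length < m

/-- The places of a diagram as weighted places of a state sum. -/
def Place.resolve {K : Type} [CommRing K] (κ : Kind) (q : K) (w : Bool → K × K) (p : Place) :
    Resolved K :=
  κ.resolve p.nw p.sw p.se p.ne (p.t.rawValue (κ.loopFactor q) (κ.dual.loopFactor q) w)

section Places

variable {K : Type} [CommRing K] {g : ℕ → K} {q : K}

theorem stateSum_places (hg : ∀ n, 1 ≤ n → g (n + 1) = q * g n) (κ : Kind) (w : Bool → K × K)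
    (m : ℕ) (P : List Place) (hP : ∀ p ∈ P, p.Within m) (hd : (P.map Place.π).Nodup)
    (J : List (Arc × Arc)) (hJ : ∀ a ∈ support J, a.1.length < m) :
    stateSum g ((P.flatMap Place.crossings).map (κ.resolveCrossing w)) J =
      stateSum g (P.map (Place.resolve κ q w)) J := by
  have short : ∀ {π : List ℕ} {a : Arc}, π.length = m → a.1.length < m → ¬ π <:+ a.1 :=
    fun h1 h2 h => by have := h.length_le; omega
  induction P generalizing J with
  | nil => rfl
  | cons p P ih =>
    obtain ⟨hp, hP'⟩ := List.forall_mem_cons.1 hP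
    rw [List.map_cons, List.nodup_cons] at hd
    rw [List.flatMap_cons, List.map_append, Place.crossings, stateSum_tangle hg p.t κ w]
    · simp only [List.map_cons, stateSum]
      rw [ih hP' hd.2, ih hP' hd.2]
      · rfl
      · intro a ha
        rw [support_append, Kind.resolve, support_snd] at ha
        exact ha.elim (hp.2 a) (hJ a)
      · intro a ha
        rw [support_append, Kind.resolve, support_fst] at ha
        exact ha.elim (hp.2 a) (hJ a)
    · exact fun a ha => short hp.1 (hp.2 a ha)
    · intro r hr a ha
      obtain ⟨c, hc, rfl⟩ := List.mem_map.1 hr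
      obtain ⟨p', hp', hc⟩ := List.mem_flatMap.1 hc
      rw [Kind.resolveCrossing, Kind.resolve_points] at ha
      have hw := hP' p' hp'
      rcases mem_crossings _ _ _ _ _ _ c hc a ha with h | h | h | h | h
      · exact short hp.1 (hw.2 _ (by simp [h]))
      · exact short hp.1 (hw.2 _ (by simp [h]))
      · exact short hp.1 (hw.2 _ (by simp [h]))
      · exact short hp.1 (hw.2 _ (by simp [h]))
      · intro h'
        have := List.suffix_of_suffix_length_le h h' (by rw [hp.1, hw.1])
        have := this.eq_of_length (by rw [hp.1, hw.1])
        exact hd.1 (List.mem_map.2 ⟨p', hp', this⟩)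
    · exact fun a ha => short hp.1 (hJ a ha)

end Places

/-! ### Closed braids on three strands -/

/-- The basis of the Temperley-Lieb algebra on three strands. -/
inductive Pattern
  | one
  | e1
  | e2
  | e12
  | e21

/-- The joins of a basis element between the lower ends `b₁`, `b₂`, `b₃` and the upper ends `t₁`,
`t₂`, `t₃` of the strands. In the checkerboard graphs one outer region and the region inside the braid
play the roles of strands. -/
def Pattern.joins {α : Type} (κ : Kind) (b₁ b₂ b₃ t₁ t₂ t₃ : α) : Pattern → List (α × α) :=
  match κ with
  | .loops => fun
    | one => [(b₁, t₁), (b₂, t₂), (b₃, t₃)]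
    | e1 => [(b₁, b₂), (t₁, t₂), (b₃, t₃)]
    | e2 => [(b₂, b₃), (t₂, t₃), (b₁, t₁)]
    | e12 => [(b₁, b₂), (t₂, t₃), (b₃, t₁)]
    | e21 => [(b₂, b₃), (t₁, t₂), (b₁, t₃)]
  | .we => fun
    | one => [(b₁, t₁), (b₂, b₃), (t₂, t₃), (b₂, t₂)]
    | e1 => [(b₁, t₁), (b₂, b₃), (t₂, t₃), (b₂, t₂), (b₁, b₂)]
    | e2 => [(b₁, t₁), (b₂, b₃), (t₂, t₃)]
    | e12 => [(b₁, t₁), (b₂, b₃), (t₂, t₃), (b₁, b₂)]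
    | e21 => [(b₁, t₁), (b₂, b₃), (t₂, t₃), (t₁, t₂)]
  | .ns => fun
    | one => [(b₃, t₃), (b₁, b₂), (t₁, t₂), (b₁, t₁)]
    | e1 => [(b₃, t₃), (b₁, b₂), (t₁, t₂)]
    | e2 => [(b₃, t₃), (b₁, b₂), (t₁, t₂), (b₁, t₁), (b₂, b₃)]
    | e12 => [(b₃, t₃), (b₁, b₂), (t₁, t₂), (t₂, t₃)]
    | e21 => [(b₃, t₃), (b₁, b₂), (t₁, t₂), (b₂, b₃)]

/-- The product of a basis element with the first generator, and the exponent of its square. -/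
def Pattern.mulE1 : Pattern → ℕ × Pattern
  | one => (0, e1)
  | e1 => (1, e1)
  | e2 => (0, e21)
  | e12 => (0, e1)
  | e21 => (1, e21)

/-- The product of a basis element with the second generator, and the exponent of its square. -/
def Pattern.mulE2 : Pattern → ℕ × Pattern
  | one => (0, e2)
  | e1 => (0, e12)
  | e2 => (1, e2)
  | e12 => (1, e12)
  | e21 => (0, e2)

/-- Elements of the Temperley-Lieb algebra on three strands, by their coefficients. -/
structure TLThree (K : Type) where
  one : K
  e1 : K
  e2 : K
  e12 : K
  e21 : K

namespace TLThree

variable {K : Type} [CommRing K]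

/-- Right multiplication by `w.1 + w.2 e₁`, where `e₁² = M e₁`. -/
def mulFirst (M : K) (v : TLThree K) (w : K × K) : TLThree K :=
  ⟨w.1 * v.one, w.1 * v.e1 + w.2 * (v.one + M * v.e1 + v.e12), w.1 * v.e2, w.1 * v.e12,
    w.1 * v.e21 + w.2 * (v.e2 + M * v.e21)⟩

/-- Right multiplication by `w.1 e₂ + w.2`, where `e₂² = L e₂`. -/
def mulSecond (L : K) (v : TLThree K) (w : K × K) : TLThree K :=
  ⟨w.2 * v.one, w.2 * v.e1, w.2 * v.e2 + w.1 * (v.one + L * v.e2 + v.e21),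
    w.2 * v.e12 + w.1 * (v.e1 + L * v.e12), w.2 * v.e21⟩

/-- The trace of the closed braids, normalized to `1` on a single loop. -/
def trace (L M : K) (v : TLThree K) : K :=
  L * M * v.one + M * v.e1 + L * v.e2 + v.e12 + v.e21

/-- The braid product of places that alternately join the first and the last two strands. -/
def braid (L M : K) : TLThree K → List (K × K) → TLThree K
  | v, w₁ :: w₂ :: ws => braid L M ((v.mulFirst M w₁).mulSecond L w₂) ws
  | v, _ => v

/-- A linear function given by its values on the basis. -/
def lift (v : TLThree K) (F : Pattern → K) : K :=
  v.one * F .one + v.e1 * F .e1 + v.e2 * F .e2 + v.e12 * F .e12 + v.e21 * F .e21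

/-- The value of the closure of a braid. -/
def closure (L M : K) (ws : List (K × K)) : K := (braid L M ⟨1, 0, 0, 0, 0⟩ ws).trace L M

theorem braid_append (L M : K) (u : List (K × K)) (w₁ w₂ : K × K) :
    ∀ (n : ℕ) (v : TLThree K), u.length = 2 * n →
      braid L M v (u ++ [w₁, w₂]) = ((braid L M v u).mulFirst M w₁).mulSecond L w₂ := by
  intro n
  induction n generalizing u with
  | zero =>
    intro v hu
    have hu' : u = [] := List.length_eq_zero_iff.1 (by simpa using hu)
    rw [hu']
    rfl
  | succ n ih =>
    intro v hu
    match u, hu with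
    | a :: b :: u, hu =>
      simp only [List.cons_append, braid]
      exact ih u _ (by simp at hu; omega)

end TLThree

/-- Two more crossings on top of a braid multiply it by the first and then by the second generator, or
by the unit, according to their four states. The joins `6 7 8` are the upper ends of the braid below,
and `9` is the arc between the two crossings. -/
theorem eliminates_step (κ : Kind) (p : Pattern) :
    Eliminates 6 10 (κ.enclosed * p.mulE2.1)
      (κ.fst 4 5 8 9 ++ (κ.fst 6 3 9 7 ++ p.joins κ 0 1 2 6 7 8)) (p.mulE2.2.joins κ 0 1 2 3 4 5) ∧
    Eliminates 6 10 0
      (κ.snd 4 5 8 9 ++ (κ.fst 6 3 9 7 ++ p.joins κ 0 1 2 6 7 8)) (p.joins κ 0 1 2 3 4 5) ∧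
    Eliminates 6 10 (κ.dual.enclosed * p.mulE1.1 + κ.enclosed * p.mulE1.2.mulE2.1)
      (κ.fst 4 5 8 9 ++ (κ.snd 6 3 9 7 ++ p.joins κ 0 1 2 6 7 8))
      (p.mulE1.2.mulE2.2.joins κ 0 1 2 3 4 5) ∧
    Eliminates 6 10 (κ.dual.enclosed * p.mulE1.1)
      (κ.snd 4 5 8 9 ++ (κ.snd 6 3 9 7 ++ p.joins κ 0 1 2 6 7 8))
      (p.mulE1.2.joins κ 0 1 2 3 4 5) := by
  cases κ <;> cases p <;> decide

/-- The four states of the two lowest crossings, the lower ends of which are `0 1 2`, and their upper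
ends `3 4 5`. -/
theorem eliminates_start (κ : Kind) :
    Eliminates 6 7 0 (κ.fst 4 5 2 6 ++ κ.fst 0 3 6 1) (Pattern.e2.joins κ 0 1 2 3 4 5) ∧
    Eliminates 6 7 0 (κ.snd 4 5 2 6 ++ κ.fst 0 3 6 1) (Pattern.one.joins κ 0 1 2 3 4 5) ∧
    Eliminates 6 7 0 (κ.fst 4 5 2 6 ++ κ.snd 0 3 6 1) (Pattern.e12.joins κ 0 1 2 3 4 5) ∧
    Eliminates 6 7 0 (κ.snd 4 5 2 6 ++ κ.snd 0 3 6 1) (Pattern.e1.joins κ 0 1 2 3 4 5) := by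
  cases κ <;> decide

/-- The exponent of the trace of a basis element. -/
def Pattern.traceExponent (κ : Kind) : Pattern → ℕ
  | one => κ.enclosed + κ.dual.enclosed
  | e1 => κ.dual.enclosed
  | e2 => κ.enclosed
  | e12 => 0
  | e21 => 0

/-- Closing a basis element leaves only loops. -/
theorem eliminates_closure (κ : Kind) (p : Pattern) :
    Eliminates 0 3 (p.traceExponent κ + 1) (p.joins κ 0 1 2 0 1 2) [] := by
  cases κ <;> cases p <;> decide

theorem mapJoins_joins {α : Type} (φ : ℕ → α) (κ : Kind) (p : Pattern) (a b c d e f : ℕ) :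
    mapJoins φ (p.joins κ a b c d e f) = p.joins κ (φ a) (φ b) (φ c) (φ d) (φ e) (φ f) := by
  cases κ <;> cases p <;> rfl

section Braid

variable {K : Type}

/-- The `i`-th vertex of the antiprism as a weighted place. -/
def prismPlace (n : ℕ) (κ : Kind) (v : ℕ → K × K) (i : ℕ) : Resolved K :=
  if i % 2 = 0 then κ.resolve ([], 2 * ((i + 2 * n - 2) % (2 * n)) + 1) ([], 2 * (i % (2 * n)) + 1)
    ([], 2 * (i % (2 * n))) ([], 2 * ((i + 2 * n - 1) % (2 * n))) (v i)
  else κ.resolve ([], 2 * (i % (2 * n))) ([], 2 * (i % (2 * n)) + 1)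
    ([], 2 * ((i + 2 * n - 2) % (2 * n)) + 1) ([], 2 * ((i + 2 * n - 1) % (2 * n))) (v i)

theorem add_sub_mod {N i k : ℕ} (hk : k ≤ i) (hi : i < N) : (i + N - k) % N = i - k := by
  rw [show i + N - k = (i - k) + N by omega, Nat.add_mod_right, Nat.mod_eq_of_lt (by omega)]

theorem prismPlace_even {n m : ℕ} (κ : Kind) (v : ℕ → K × K) (h1 : 1 ≤ m) (hm : m < n) :
    prismPlace n κ v (2 * m) = κ.resolve ([], 4 * m - 3) ([], 4 * m + 1) ([], 4 * m)
      ([], 4 * m - 2) (v (2 * m)) := by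
  rw [prismPlace, if_pos (by omega), add_sub_mod (by omega) (by omega),
    add_sub_mod (by omega) (by omega), Nat.mod_eq_of_lt (by omega)]
  congr 2 <;> omega

theorem prismPlace_odd {n m : ℕ} (κ : Kind) (v : ℕ → K × K) (h1 : 1 ≤ m) (hm : m < n) :
    prismPlace n κ v (2 * m + 1) = κ.resolve ([], 4 * m + 2) ([], 4 * m + 3) ([], 4 * m - 1)
      ([], 4 * m) (v (2 * m + 1)) := by
  rw [prismPlace, if_neg (by omega), add_sub_mod (by omega) (by omega),
    add_sub_mod (by omega) (by omega), Nat.mod_eq_of_lt (by omega)]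
  congr 2 <;> omega

theorem prismPlace_zero {n : ℕ} (κ : Kind) (v : ℕ → K × K) (hn : 2 ≤ n) :
    prismPlace n κ v 0 = κ.resolve ([], 4 * n - 3) ([], 1) ([], 0) ([], 4 * n - 2) (v 0) := by
  rw [prismPlace, if_pos rfl, Nat.mod_eq_of_lt (a := 0 + 2 * n - 2) (by omega),
    Nat.mod_eq_of_lt (a := 0 + 2 * n - 1) (by omega), Nat.mod_eq_of_lt (by omega)]
  congr 2 <;> omega

theorem prismPlace_one {n : ℕ} (κ : Kind) (v : ℕ → K × K) (hn : 2 ≤ n) :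
    prismPlace n κ v 1 = κ.resolve ([], 2) ([], 3) ([], 4 * n - 1) ([], 0) (v 1) := by
  rw [prismPlace, if_neg (by omega), Nat.mod_eq_of_lt (a := 1 + 2 * n - 2) (by omega),
    add_sub_mod le_rfl (by omega), Nat.mod_eq_of_lt (a := 1) (by omega)]
  congr 2
  omega

variable [CommRing K] {g : ℕ → K} {q : K}

/-- The state sum of a braid whose lower ends are the arcs `4n - 3`, `4n - 2`, `4n - 1`. -/
theorem stateSum_braid (hg : ∀ n, 1 ≤ n → g (n + 1) = q * g n) (κ : Kind) (v : ℕ → K × K) {n : ℕ}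
    (hn : 2 ≤ n) {m : ℕ} (h1 : 1 ≤ m) (hm : m ≤ n) (D : List (Resolved K))
    (hD : ∀ r ∈ D, ∀ i < 4 * m - 3, (([], i) : Arc) ∉ r.points) :
    stateSum g ((List.range (2 * m)).map (prismPlace n κ v) ++ D) [] =
      (TLThree.braid (κ.loopFactor q) (κ.dual.loopFactor q) ⟨1, 0, 0, 0, 0⟩
        ((List.range (2 * m)).map v)).lift fun p => stateSum g D
          (p.joins κ ([], 4 * n - 3) ([], 4 * n - 2) ([], 4 * n - 1) ([], 4 * m - 3)
            ([], 4 * m - 2) ([], 4 * m - 1)) := by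
  induction m, h1 using Nat.le_induction generalizing D with
  | base =>
    simp only [mul_one, List.range_succ, List.range_zero, List.nil_append,
      List.map_cons, List.map_nil, List.cons_append, TLThree.braid, stateSum,
      prismPlace_zero κ v hn, prismPlace_one κ v hn]
    let φ : ℕ → Arc := fun i => ([], [4 * n - 3, 4 * n - 2, 4 * n - 1, 1, 2, 3, 0].getD i 0)
    have elim : ∀ {k : ℕ} {I I' : List (ℕ × ℕ)}, Eliminates 6 7 k I I' →
        stateSum g D (mapJoins φ I ++ []) = q ^ k * stateSum g D (mapJoins φ I' ++ []) := by
      intro k I I' hI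
      refine stateSum_eliminate hg hI (by norm_num) (by norm_num) ?_ D ?_ [] (by simp)
      · intro i hi hoi j hj hij
        interval_cases i <;> interval_cases j <;> simp [φ] at hij ⊢ <;> omega
      · intro r hr i hi hoi h
        interval_cases i <;> exact hD r hr 0 (by norm_num) h
    obtain ⟨s1, s2, s3, s4⟩ := eliminates_start κ
    have e1 := elim s1
    have e2 := elim s2
    have e3 := elim s3
    have e4 := elim s4
    simp only [mapJoins_append, mapJoins_fst, mapJoins_snd, mapJoins_joins,
      pow_zero, one_mul, List.append_nil] at e1 e2 e3 e4
    simp only [φ, List.getD_cons_zero, List.getD_cons_succ] at e1 e2 e3 e4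
    simp only [Kind.resolve, List.append_nil, e1, e2, e3, e4, TLThree.lift, TLThree.mulFirst,
      TLThree.mulSecond, Nat.reduceSub]
    ring
  | succ m h1 ih =>
    have hr : ∀ {β : Type} (f : ℕ → β), (List.range (2 * (m + 1))).map f =
        (List.range (2 * m)).map f ++ [f (2 * m), f (2 * m + 1)] := fun f => by
      rw [show 2 * (m + 1) = 2 * m + 1 + 1 by ring, List.range_succ, List.range_succ]; simp
    rw [hr, hr, List.append_assoc, ih (by omega), TLThree.braid_append _ _ _ _ _ m _ (by simp)]
    swap
    · intro r hr i hi h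
      simp only [List.cons_append, List.nil_append, List.mem_cons] at hr
      rcases hr with rfl | rfl | hr
      · rw [prismPlace_even κ v h1 (by omega), Kind.resolve_points] at h
        simp at h; omega
      · rw [prismPlace_odd κ v h1 (by omega), Kind.resolve_points] at h
        simp at h; omega
      · exact hD r hr i (by omega) h
    generalize TLThree.braid (κ.loopFactor q) (κ.dual.loopFactor q) ⟨1, 0, 0, 0, 0⟩
      ((List.range (2 * m)).map v) = V
    let φ : ℕ → Arc := fun i => ([], [4 * n - 3, 4 * n - 2, 4 * n - 1, 4 * m + 1, 4 * m + 2,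
      4 * m + 3, 4 * m - 3, 4 * m - 2, 4 * m - 1, 4 * m].getD i 0)
    have elim : ∀ {k : ℕ} {I I' : List (ℕ × ℕ)}, Eliminates 6 10 k I I' →
        stateSum g D (mapJoins φ I ++ []) = q ^ k * stateSum g D (mapJoins φ I' ++ []) := by
      intro k I I' hI
      refine stateSum_eliminate hg hI (by norm_num) (by norm_num) ?_ D ?_ [] (by simp)
      · intro i hi hoi j hj hij
        have hij' := congrArg Prod.snd hij
        interval_cases i <;> interval_cases j <;>
          simp only [φ, List.getD_cons_zero, List.getD_cons_succ] at hij' ⊢ <;> omega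
      · intro r hr i hi hoi h
        refine hD r hr (φ i).2 ?_ h
        interval_cases i <;> simp only [φ, List.getD_cons_zero, List.getD_cons_succ] <;> omega
    have hs : ∀ p, _ := fun p => elim (eliminates_step κ p).1
    have hs2 : ∀ p, _ := fun p => elim (eliminates_step κ p).2.1
    have hs3 : ∀ p, _ := fun p => elim (eliminates_step κ p).2.2.1
    have hs4 : ∀ p, _ := fun p => elim (eliminates_step κ p).2.2.2
    simp only [mapJoins_append, mapJoins_fst, mapJoins_snd, mapJoins_joins,
      pow_zero, one_mul, List.append_nil] at hs hs2 hs3 hs4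
    simp only [φ, List.getD_cons_zero, List.getD_cons_succ] at hs hs2 hs3 hs4
    simp only [List.cons_append, List.nil_append, stateSum, prismPlace_even κ v h1 (by omega : m < n),
      prismPlace_odd κ v h1 (by omega : m < n), Kind.resolve, hs, hs2, hs3, hs4]
    simp only [TLThree.lift, TLThree.mulFirst, TLThree.mulSecond, Pattern.mulE1, Pattern.mulE2,
      Kind.loopFactor, show 4 * (m + 1) - 3 = 4 * m + 1 by omega,
      show 4 * (m + 1) - 2 = 4 * m + 2 by omega, show 4 * (m + 1) - 1 = 4 * m + 3 by omega]
    ring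

theorem weight_add (hg : ∀ n, 1 ≤ n → g (n + 1) = q * g n) (k : ℕ) : g (k + 1) = q ^ k * g 1 := by
  induction k with
  | zero => simp
  | succ k ih => rw [hg _ (by omega), ih]; ring

theorem stateSum_closedBraid (hg : ∀ n, 1 ≤ n → g (n + 1) = q * g n) (κ : Kind) (v : ℕ → K × K)
    {n : ℕ} (hn : 2 ≤ n) :
    stateSum g ((List.range (2 * n)).map (prismPlace n κ v)) [] =
      g 1 * TLThree.closure (κ.loopFactor q) (κ.dual.loopFactor q) ((List.range (2 * n)).map v) := by
  have := stateSum_braid hg κ v hn (m := n) (by omega) le_rfl [] (by simp)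
  rw [List.append_nil] at this
  rw [this, TLThree.closure]
  generalize TLThree.braid (κ.loopFactor q) (κ.dual.loopFactor q) ⟨1, 0, 0, 0, 0⟩
      ((List.range (2 * n)).map v) = V
  let φ : ℕ → Arc := fun i => ([], [4 * n - 3, 4 * n - 2, 4 * n - 1].getD i 0)
  have key : ∀ p : Pattern, stateSum g [] (p.joins κ ([], 4 * n - 3) ([], 4 * n - 2)
      ([], 4 * n - 1) ([], 4 * n - 3) ([], 4 * n - 2) ([], 4 * n - 1)) =
      q ^ p.traceExponent κ * g 1 := by
    intro p
    have := loopCount_eliminate (eliminates_closure κ p) (by norm_num) (φ := φ) (J := []) (by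
      intro i hi _ j hj hij
      have hij' := congrArg Prod.snd hij
      interval_cases i <;> interval_cases j <;>
        simp only [φ, List.getD_cons_zero, List.getD_cons_succ] at hij' ⊢ <;> omega) (by simp)
    have h0 : loopCount (mapJoins φ [] ++ []) = 0 := by
      rw [loopCount_eq_classCount]; simp [mapJoins, classCount]
    rw [h0, zero_add, mapJoins_joins, List.append_nil] at this
    simp only [φ, List.getD_cons_zero, List.getD_cons_succ] at this
    rw [stateSum, this, weight_add hg]
  simp only [TLThree.lift, key, Pattern.traceExponent, TLThree.trace, Kind.loopFactor]
  ring

end Braid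

/-! ### Normalized values of tangles -/

section Value

variable {K : Type} [Field K]

/-- The value of a tangle as a pair of coefficients, of the state that separates West from East and
of the other one. A crossing `1` has the value `(1, 1)`, a crossing `-1` has the value `(γ, 1)`, and the
product of the first state with itself is `L` times itself, or `M` times after a reflection. -/
def Tangle.value (γ L M : K) : Tangle → K × K
  | crossing e => (bif e then 1 else γ, 1)
  | reflect s => (s.value γ⁻¹ M L).swap
  | add s t => (L * (s.value γ L M).1 * (t.value γ L M).1 +
      (s.value γ L M).1 * (t.value γ L M).2 + (s.value γ L M).2 * (t.value γ L M).1,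
      (s.value γ L M).2 * (t.value γ L M).2)

/-- The factor between the state sum of a tangle and its value. -/
def Tangle.scale (γ α β : K) (u : Bool → K) : Tangle → K
  | crossing e => u e
  | reflect s => s.scale γ⁻¹ β α fun e => u e * bif e then 1 else γ
  | add s t => s.scale γ α β u * t.scale γ α β u * β

/-- Rescaling the two states by `α` and `β` replaces the parameters `L` and `M` by `β L / α` and
`α M / β`. -/
theorem Tangle.rawValue_eq (t : Tangle) {γ L M l l' α β : K} (hγ : γ ≠ 0) (hl : l * α = β * L)
    (hl' : l' * β = α * M) (u : Bool → K) :
    t.rawValue l l' (fun e => (u e * α * bif e then 1 else γ, u e * β)) =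
      (t.scale γ α β u * α * (t.value γ L M).1, t.scale γ α β u * β * (t.value γ L M).2) := by
  induction t generalizing γ L M l l' α β u with
  | crossing e => simp [rawValue, scale, value]
  | reflect s ih =>
    have := ih (inv_ne_zero hγ) hl' hl fun e => u e * bif e then 1 else γ
    simp only [rawValue, scale, value, Prod.swap]
    rw [← Prod.eta (s.rawValue _ _ _)]
    have hw : (Prod.swap ∘ fun e : Bool => (u e * α * bif e then 1 else γ, u e * β)) =
        fun e => ((u e * bif e then 1 else γ) * β * bif e then 1 else γ⁻¹,
          (u e * bif e then 1 else γ) * α) := by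
      funext e
      cases e
      · simp only [Function.comp, Prod.swap, cond_false, Prod.mk.injEq]
        exact ⟨by field_simp, by ring⟩
      · simp
    simp only [hw, this]
  | add s t ihs iht =>
    simp only [rawValue, scale, value, ihs hγ hl hl' u, iht hγ hl hl' u, Prod.mk.injEq]
    refine ⟨?_, by ring⟩
    linear_combination (s.scale γ α β u * t.scale γ α β u * (s.value γ L M).1 *
      (t.value γ L M).1 * α) * hl

/-- The number of regions inside a tangle that lie to the West or East of its crossings, or those to
the North or South for `b = false`. -/
def Tangle.innerRegions : Bool → Tangle → ℕ
  | _, crossing _ => 0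
  | b, reflect s => s.innerRegions !b
  | b, add s t => s.innerRegions b + t.innerRegions b + b.toNat

theorem Tangle.scale_one (t : Tangle) (Y : K) :
    t.scale 1 1 Y (fun _ => 1) = Y ^ t.innerRegions true ∧
      t.scale 1 Y 1 (fun _ => 1) = Y ^ t.innerRegions false := by
  induction t with
  | crossing e => simp [scale, innerRegions]
  | reflect s ih =>
    have : (fun e : Bool => (1 : K) * bif e then 1 else 1) = fun _ => 1 := by
      funext e; cases e <;> simp
    simp only [scale, innerRegions, inv_one, this]
    exact ⟨ih.2, ih.1⟩
  | add s t ihs iht =>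
    simp only [scale, innerRegions, ihs, iht]
    exact ⟨by simp [pow_add], by simp [pow_add]⟩

theorem Tangle.rawValue_delete {K : Type} [CommRing K] (t : Tangle) :
    t.rawValue (2 : K) 1 (fun _ => (1, 0)) = (2 ^ t.innerRegions true, 0) ∧
      t.rawValue (1 : K) 2 (fun _ => (0, 1)) = (0, 2 ^ t.innerRegions false) := by
  induction t with
  | crossing e => simp [rawValue, innerRegions]
  | reflect s ih =>
    have h1 : Prod.swap ∘ (fun _ : Bool => ((1 : K), (0 : K))) = fun _ => (0, 1) := rfl
    have h2 : Prod.swap ∘ (fun _ : Bool => ((0 : K), (1 : K))) = fun _ => (1, 0) := rfl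
    simp [rawValue, innerRegions, h1, h2, ih]
  | add s t ihs iht =>
    simp only [rawValue, innerRegions, ihs, iht, pow_add, Bool.toNat]
    exact ⟨Prod.ext (by simp; ring) (by simp), Prod.ext (by simp) (by simp)⟩

theorem Tangle.rawValue_contract {K : Type} [CommRing K] (t : Tangle) :
    t.rawValue (2 : K) 1 (fun _ => (0, 1)) = (0, 1) ∧
      t.rawValue (1 : K) 2 (fun _ => (1, 0)) = (1, 0) := by
  induction t with
  | crossing e => simp [rawValue]
  | reflect s ih =>
    have h1 : Prod.swap ∘ (fun _ : Bool => ((1 : K), (0 : K))) = fun _ => (0, 1) := rfl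
    have h2 : Prod.swap ∘ (fun _ : Bool => ((0 : K), (1 : K))) = fun _ => (1, 0) := rfl
    simp [rawValue, h1, h2, ih]
  | add s t ihs iht => simp [rawValue, ihs, iht]

theorem Tangle.exists_scale_eq_zpow (t : Tangle) {B : K} (hB : B ≠ 0) :
    ∃ m : ℤ, t.scale (B ^ 4)⁻¹ B B⁻¹ (fun e => bif e then 1 else B ^ 2) = B ^ m := by
  induction t generalizing B with
  | crossing e =>
    cases e
    · exact ⟨2, by simp only [scale, cond_false]; norm_cast⟩
    · exact ⟨0, by simp [scale]⟩
  | reflect s ih =>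
    obtain ⟨m, hm⟩ := ih (inv_ne_zero hB)
    refine ⟨-m, ?_⟩
    have hu : (fun e : Bool => (bif e then 1 else B ^ 2) * bif e then 1 else (B ^ 4)⁻¹) =
        fun e => bif e then 1 else B⁻¹ ^ 2 := by
      funext e
      cases e
      · simp only [cond_false]; field_simp
      · simp
    rw [zpow_neg, ← inv_zpow, ← hm, scale, hu]
    simp only [inv_pow, inv_inv]
  | add s t ihs iht =>
    obtain ⟨m, hm⟩ := ihs hB
    obtain ⟨m', hm'⟩ := iht hB
    refine ⟨m + m' - 1, ?_⟩
    rw [scale, hm, hm', zpow_sub₀ hB, zpow_add₀ hB, zpow_one, div_eq_mul_inv]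

theorem Tangle.value_row (γ x M : K) (e : Bool) (n : ℕ) :
    ((row e n).value γ (x - 1) M).2 = 1 ∧
      1 + (x - 1) * ((row e n).value γ (x - 1) M).1 =
        (1 + (x - 1) * bif e then 1 else γ) ^ (n + 1) := by
  induction n with
  | zero => simp [row, value]
  | succ n ih =>
    simp only [row, value, ih.1]
    exact ⟨by ring, by rw [pow_succ, ← ih.2]; ring⟩

/-- The value of an integer tangle, the rows of negative crossings being treated on an equal footing
with those of positive crossings if `γ = -x⁻¹`. -/
theorem Tangle.value_twist {γ x : K} (M : K) {n : ℤ} (hx : x - 1 ≠ 0)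
    (h : 1 ≤ n ∨ n ≠ 0 ∧ x ≠ 0 ∧ γ = -x⁻¹) :
    (twist n).value γ (x - 1) M = (geom x n, 1) := by
  obtain ⟨h2, h1⟩ := value_row γ x M (decide (0 < n)) (n.natAbs - 1)
  refine Prod.ext ?_ h2
  rw [geom, eq_div_iff hx, twist, mul_comm, eq_sub_iff_add_eq', h1]
  have hn : n.natAbs - 1 + 1 = n.natAbs := by omega
  rw [hn]
  by_cases h0 : 0 < n
  · rw [decide_eq_true h0, cond_true, mul_one, add_sub_cancel]
    conv_rhs => rw [← Int.natAbs_of_nonneg h0.le]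
    rw [zpow_natCast]
  · obtain ⟨-, hx0, rfl⟩ := h.resolve_left (by omega)
    rw [decide_eq_false h0, cond_false]
    have hx' : 1 + (x - 1) * -x⁻¹ = x⁻¹ := by field_simp; ring
    rw [hx', inv_pow, ← zpow_natCast, ← zpow_neg, Int.natCast_natAbs, abs_of_nonpos (by omega), neg_neg]

end Value

/-! ### The classes of explicit lists of joins -/

/-- Bit masks of the sets `m`, `c₁`, …, `cₖ` with `m` and the `cᵢ` that meet it replaced by their
union. -/
def insertMask (m : ℕ) (l : List ℕ) : List ℕ :=
  (l.filter fun c => !(c &&& m == 0)).foldr (fun c d => c ||| d) m :: l.filter fun c => c &&& m == 0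

/-- Bit masks of the classes of a list of joins, added to the classes with the masks `l`. -/
def insertJoins : List (ℕ × ℕ) → List ℕ → List ℕ
  | [], l => l
  | p :: K, l => insertMask (2 ^ p.1 ||| 2 ^ p.2) (insertJoins K l)

/-- The numbers of classes of all the states of a list of crossings, in lexicographic order. -/
def Kind.classCounts (κ : Kind) : List (ℕ × ℕ × ℕ × ℕ) → List ℕ → List ℕ
  | [], l => [l.length]
  | c :: Q, l => κ.classCounts Q (insertJoins (κ.fst c.1 c.2.1 c.2.2.1 c.2.2.2) l) ++
      κ.classCounts Q (insertJoins (κ.snd c.1 c.2.1 c.2.2.1 c.2.2.2) l)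

/-- The bit masks of `l` describe the classes of the list `J` of joins, the points of which are
numbered by `φ`. -/
structure Represents (φ : ℕ → Arc) (l : List ℕ) (J : List (Arc × Arc)) : Prop where
  disjoint : l.Pairwise fun c d => ∀ i, c.testBit i → ¬ d.testBit i
  nonempty : ∀ c ∈ l, ∃ i, c.testBit i
  support : ∀ a, a ∈ support J ↔ ∃ c ∈ l, ∃ i, c.testBit i ∧ φ i = a
  const : ∀ (β : Type) (h : Arc → β), (∀ p ∈ J, h p.1 = h p.2) ↔
    ∀ c ∈ l, ∀ i j, c.testBit i → c.testBit j → h (φ i) = h (φ j)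

theorem Represents.nil (φ : ℕ → Arc) : Represents φ [] [] :=
  ⟨List.Pairwise.nil, by simp, by simp, by simp⟩

theorem testBit_foldr_or (m : ℕ) (l : List ℕ) (i : ℕ) :
    (l.foldr (fun c d => c ||| d) m).testBit i ↔ m.testBit i ∨ ∃ c ∈ l, c.testBit i := by
  induction l with
  | nil => simp
  | cons c l ih => simp [ih]; tauto

theorem and_eq_zero_iff_forall_testBit (c m : ℕ) :
    c &&& m = 0 ↔ ∀ i, c.testBit i → ¬ m.testBit i := by
  constructor
  · intro h i h1 h2
    have := congrArg (fun n => n.testBit i) h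
    simp [h1, h2] at this
  · intro h
    refine Nat.eq_of_testBit_eq fun i => ?_
    have := h i
    simpa using this

theorem Represents.cons {φ : ℕ → Arc} {l : List ℕ} {J : List (Arc × Arc)} (h : Represents φ l J)
    (p : ℕ × ℕ) :
    Represents φ (insertMask (2 ^ p.1 ||| 2 ^ p.2) l) ((φ p.1, φ p.2) :: J) := by
  set m := 2 ^ p.1 ||| 2 ^ p.2 with hm
  have hbit : ∀ i, m.testBit i ↔ i = p.1 ∨ i = p.2 := fun i => by
    simp [hm, Nat.testBit_two_pow]; tauto
  have hmem0 : ∀ c, c ∈ l.filter (fun c => c &&& m == 0) ↔ c ∈ l ∧ ∀ i, c.testBit i → ¬ m.testBit i :=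
    fun c => by rw [List.mem_filter, beq_iff_eq, and_eq_zero_iff_forall_testBit]
  have hmem1 : ∀ c, c ∈ l.filter (fun c => !(c &&& m == 0)) ↔
      c ∈ l ∧ ∃ i, c.testBit i ∧ m.testBit i := fun c => by
    rw [List.mem_filter, Bool.not_eq_true', beq_eq_false_iff_ne, Ne, and_eq_zero_iff_forall_testBit]
    push Not
    rfl
  have hdis : ∀ c ∈ l, ∀ d ∈ l, c ≠ d → ∀ i, c.testBit i → ¬ d.testBit i := by
    have hs : Std.Symm fun c d : ℕ => ∀ i, c.testBit i → ¬ d.testBit i :=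
      ⟨fun c d hcd i hd hc => hcd i hc hd⟩
    exact fun c hc d hd => h.disjoint.forall hc hd
  constructor
  · rw [insertMask, List.pairwise_cons]
    refine ⟨fun d hd i hi hdi => ?_, h.disjoint.filter _⟩
    rw [hmem0] at hd
    rcases (testBit_foldr_or _ _ _).1 hi with hi | ⟨c, hc, hci⟩
    · exact hd.2 i hdi hi
    · rw [hmem1] at hc
      obtain ⟨hc, j, hj, hmj⟩ := hc
      refine hdis c hc d hd.1 ?_ i hci hdi
      rintro rfl
      exact hd.2 j hj hmj
  · intro c hc
    rcases List.mem_cons.1 hc with rfl | hc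
    · exact ⟨p.1, (testBit_foldr_or _ _ _).2 (Or.inl ((hbit _).2 (Or.inl rfl)))⟩
    · exact h.nonempty c ((hmem0 c).1 hc).1
  · intro a
    rw [support_cons, Set.mem_union, h.support]
    constructor
    · rintro (ha | ⟨c, hc, i, hi, rfl⟩)
      · refine ⟨_, List.mem_cons_self, ?_⟩
        rcases ha with rfl | rfl
        · exact ⟨p.1, (testBit_foldr_or _ _ _).2 (Or.inl ((hbit _).2 (Or.inl rfl))), rfl⟩
        · exact ⟨p.2, (testBit_foldr_or _ _ _).2 (Or.inl ((hbit _).2 (Or.inr rfl))), rfl⟩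
      · by_cases hcm : ∀ i, c.testBit i → ¬ m.testBit i
        · exact ⟨c, List.mem_cons_of_mem _ ((hmem0 c).2 ⟨hc, hcm⟩), i, hi, rfl⟩
        · push Not at hcm
          exact ⟨_, List.mem_cons_self, i,
            (testBit_foldr_or _ _ _).2 (Or.inr ⟨c, (hmem1 c).2 ⟨hc, hcm⟩, hi⟩), rfl⟩
    · rintro ⟨c, hc, i, hi, rfl⟩
      rcases List.mem_cons.1 hc with rfl | hc
      · rcases (testBit_foldr_or _ _ _).1 hi with hi | ⟨c, hc, hci⟩
        · left; rcases (hbit i).1 hi with rfl | rfl <;> simp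
        · exact Or.inr ⟨c, ((hmem1 c).1 hc).1, i, hci, rfl⟩
      · exact Or.inr ⟨c, ((hmem0 c).1 hc).1, i, hi, rfl⟩
  · intro β f
    rw [List.forall_mem_cons, h.const]
    constructor
    · rintro ⟨hp, hl⟩ c hc
      rcases List.mem_cons.1 hc with rfl | hc
      · have key : ∀ i, ((l.filter fun c => !(c &&& m == 0)).foldr (fun c d => c ||| d) m).testBit i →
            f (φ i) = f (φ p.1) := by
          have hb : ∀ i, m.testBit i → f (φ i) = f (φ p.1) := fun i hi => by
            rcases (hbit i).1 hi with rfl | rfl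
            · rfl
            · exact hp.symm
          intro i hi
          rcases (testBit_foldr_or _ _ _).1 hi with hi | ⟨c, hc, hci⟩
          · exact hb i hi
          · obtain ⟨hc, j, hj, hmj⟩ := (hmem1 c).1 hc
            exact (hl c hc i j hci hj).trans (hb j hmj)
        exact fun i j hi hj => (key i hi).trans (key j hj).symm
      · exact hl c ((hmem0 c).1 hc).1
    · intro hl
      have hhead := hl _ List.mem_cons_self
      refine ⟨hhead _ _ ((testBit_foldr_or _ _ _).2 (Or.inl ((hbit _).2 (Or.inl rfl))))
        ((testBit_foldr_or _ _ _).2 (Or.inl ((hbit _).2 (Or.inr rfl)))), fun c hc i j hi hj => ?_⟩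
      by_cases hcm : ∀ i, c.testBit i → ¬ m.testBit i
      · exact hl c (List.mem_cons_of_mem _ ((hmem0 c).2 ⟨hc, hcm⟩)) i j hi hj
      · push Not at hcm
        exact hhead i j ((testBit_foldr_or _ _ _).2 (Or.inr ⟨c, (hmem1 c).2 ⟨hc, hcm⟩, hi⟩))
          ((testBit_foldr_or _ _ _).2 (Or.inr ⟨c, (hmem1 c).2 ⟨hc, hcm⟩, hj⟩))

theorem Represents.append {φ : ℕ → Arc} {l : List ℕ} {J : List (Arc × Arc)} (h : Represents φ l J)
    (K : List (ℕ × ℕ)) : Represents φ (insertJoins K l) (mapJoins φ K ++ J) := by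
  induction K with
  | nil => exact h
  | cons p K ih => exact ih.cons p

theorem Represents.loopCount_eq {φ : ℕ → Arc} (hφ : Function.Injective φ) {l : List ℕ}
    {J : List (Arc × Arc)} (h : Represents φ l J) : loopCount J = l.length := by
  classical
  have hnodup : l.Nodup := by
    refine (List.pairwise_iff_forall_sublist.2 ?_)
    rintro c d hcd rfl
    obtain ⟨i, hi⟩ := h.nonempty c (hcd.subset List.mem_cons_self)
    exact List.pairwise_iff_forall_sublist.1 h.disjoint hcd i hi hi
  have hdis : ∀ c ∈ l, ∀ d ∈ l, ∀ i, c.testBit i → d.testBit i → c = d := by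
    have hs : Std.Symm fun c d : ℕ => ∀ i, c.testBit i → ¬ d.testBit i :=
      ⟨fun c d hcd i hd hc => hcd i hc hd⟩
    intro c hc d hd i hci hdi
    by_contra hcd
    exact h.disjoint.forall hc hd hcd i hci hdi
  -- The mask containing a point.
  let f : Arc → ℕ := fun a => if ha : ∃ c ∈ l, ∃ i, c.testBit i ∧ φ i = a then ha.choose else 0
  have hf : ∀ c ∈ l, ∀ i, c.testBit i → f (φ i) = c := by
    intro c hc i hi
    have ha : ∃ d ∈ l, ∃ j, d.testBit j ∧ φ j = φ i := ⟨c, hc, i, hi, rfl⟩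
    obtain ⟨hd, j, hj, hij⟩ := ha.choose_spec
    simp only [f, dif_pos ha]
    rw [hφ hij] at hj
    exact hdis _ hd _ hc i hj hi
  rw [loopCount_eq_classCount, classCount_eq_ncard (h := f)]
  · have : f '' _root_.support J = {c | c ∈ l} := by
      ext c
      constructor
      · rintro ⟨a, ha, rfl⟩
        obtain ⟨c, hc, i, hi, rfl⟩ := (h.support a).1 ha
        rw [hf c hc i hi]
        exact hc
      · intro hc
        obtain ⟨i, hi⟩ := h.nonempty c hc
        exact ⟨φ i, (h.support _).2 ⟨c, hc, i, hi, rfl⟩, hf c hc i hi⟩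
    rw [this, ← List.coe_toFinset, Set.ncard_coe_finset, List.toFinset_card_of_nodup hnodup]
  · intro a ha b hb
    obtain ⟨c, hc, i, hi, rfl⟩ := (h.support a).1 ha
    obtain ⟨d, hd, j, hj, rfl⟩ := (h.support b).1 hb
    constructor
    · refine apply_eq_of_joinClass_eq ((h.const _ _).2 fun c hc i j hi hj => ?_)
      rw [hf c hc i hi, hf c hc j hj]
    · rw [hf c hc i hi, hf d hd j hj]
      rintro rfl
      exact (h.const _ (joinClass J)).1 (fun _ => joinClass_eq_of_mem) c hc i j hi hj

section StateWeights

variable {K : Type} [CommRing K]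

/-- The weights of all states of a list of crossings, in lexicographic order. -/
def stateWeights : List (K × K) → List K
  | [] => [1]
  | w :: ws => (stateWeights ws).map (w.1 * ·) ++ (stateWeights ws).map (w.2 * ·)

theorem length_stateWeights (ws : List (K × K)) : (stateWeights ws).length = 2 ^ ws.length := by
  induction ws with
  | nil => rfl
  | cons w ws ih => simp [stateWeights, ih, pow_succ]; ring

theorem Kind.length_classCounts (κ : Kind) (Q : List (ℕ × ℕ × ℕ × ℕ)) (l : List ℕ) :
    (κ.classCounts Q l).length = 2 ^ Q.length := by
  induction Q generalizing l with
  | nil => rfl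
  | cons c Q ih => simp [classCounts, ih, pow_succ]; ring

theorem stateSum_eq_sum_stateWeights (g : ℕ → K) (κ : Kind) {φ : ℕ → Arc} (hφ : Function.Injective φ)
    (Q : List (ℕ × ℕ × ℕ × ℕ)) (ws : List (K × K)) (hQ : ws.length = Q.length) {l : List ℕ}
    {J : List (Arc × Arc)} (h : Represents φ l J) :
    stateSum g (List.zipWith
      (fun c w => κ.resolve (φ c.1) (φ c.2.1) (φ c.2.2.1) (φ c.2.2.2) w) Q ws) J =
      (List.zipWith (fun a n => a * g n) (stateWeights ws) (κ.classCounts Q l)).sum := by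
  induction Q generalizing ws l J with
  | nil =>
    obtain rfl := List.length_eq_zero_iff.1 hQ
    simp [stateSum, stateWeights, Kind.classCounts, h.loopCount_eq hφ]
  | cons c Q ih =>
    obtain ⟨w, ws, rfl⟩ := List.exists_cons_of_length_eq_add_one hQ
    have hlen : ws.length = Q.length := by simpa using hQ
    have h1 := ih ws hlen (h.append (κ.fst c.1 c.2.1 c.2.2.1 c.2.2.2))
    have h2 := ih ws hlen (h.append (κ.snd c.1 c.2.1 c.2.2.1 c.2.2.2))
    rw [mapJoins_fst] at h1
    rw [mapJoins_snd] at h2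
    rw [List.zipWith_cons_cons, stateSum, Kind.resolve, h1, h2, stateWeights, Kind.classCounts,
      List.zipWith_append (by simp [length_stateWeights, Kind.length_classCounts, hlen]),
      List.sum_append, List.zipWith_map_left, List.zipWith_map_left]
    have pull : ∀ (z : K) (A : List K) (N : List ℕ), (List.zipWith (fun a n => z * a * g n) A N).sum =
        z * (List.zipWith (fun a n => a * g n) A N).sum := fun z A N => by
      induction A generalizing N with
      | nil => simp
      | cons a A ihA =>
        cases N with
        | nil => simp
        | cons n N => simp only [List.zipWith_cons_cons, List.sum_cons, ihA]; ring
    rw [pull, pull]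

end StateWeights

/-! ### The basic polyhedron with nine vertices -/

/-- The arcs around the vertices of the basic polyhedron `9*`, the arc `([i], j)` being numbered by
`3 i + j`. -/
def nineVertices : List (ℕ × ℕ × ℕ × ℕ) :=
  [(8, 3, 0, 2), (3, 12, 15, 6), (11, 9, 12, 17), (6, 4, 1, 0), (4, 13, 16, 7), (9, 10, 13, 15),
    (7, 5, 2, 1), (5, 14, 17, 8), (10, 11, 14, 16)]

/-- The number of vertices in the second state, for all states of `n` vertices in lexicographic
order. -/
def secondCounts : ℕ → List ℕ
  | 0 => [0]
  | n + 1 => secondCounts n ++ (secondCounts n).map (· + 1)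

/-- For every state of `9*` the numbers of additional components of the two spanning subgraphs of the
checkerboard graphs. They are the corank of the first one and, since the two subgraphs are dual, its
nullity. -/
def nineExponents : List (ℕ × ℕ) :=
  List.zipWith (fun m s => (m - 1, m + s - 5)) (Kind.we.classCounts nineVertices [])
    (secondCounts 9)

set_option maxRecDepth 10000 in
theorem classCounts_nineVertices (κ : Kind) : κ.classCounts nineVertices [] =
    nineExponents.map fun e => κ.enclosed * e.1 + κ.dual.enclosed * e.2 + 1 := by
  cases κ <;> decide +kernel

-- it guarantees that the differences of natural numbers in `nineExponents` are not truncated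
set_option maxRecDepth 10000 in
theorem five_le_classCounts_add_secondCounts :
    (List.zipWith (fun m s => Nat.ble 1 m && Nat.ble 5 (m + s)) (Kind.we.classCounts nineVertices [])
      (secondCounts 9)).all id = true := by
  decide +kernel

/-- The value of `9*` with given coefficients of the two states at all vertices. -/
def nineEval {K : Type} [CommRing K] (L M : K) (ws : List (K × K)) : K :=
  (List.zipWith (fun a e => a * (L ^ e.1 * M ^ e.2)) (stateWeights ws) nineExponents).sum

section Nine

variable {K : Type} [CommRing K]

theorem sum_zipWith_mul {α β : Type} (z : K) (f : α → β → K) (A : List α) (B : List β) :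
    (List.zipWith (fun a b => z * f a b) A B).sum = z * (List.zipWith f A B).sum := by
  induction A generalizing B with
  | nil => simp
  | cons a A ih =>
    cases B with
    | nil => simp
    | cons b B => simp only [List.zipWith_cons_cons, List.sum_cons, ih, mul_add]

theorem stateSum_nine {g : ℕ → K} {q : K} (hg : ∀ n, 1 ≤ n → g (n + 1) = q * g n) (κ : Kind)
    {φ : ℕ → Arc} (hφ : Function.Injective φ) (ws : List (K × K)) (hws : ws.length = 9) :
    stateSum g (List.zipWith (fun c w => κ.resolve (φ c.1) (φ c.2.1) (φ c.2.2.1) (φ c.2.2.2) w)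
      nineVertices ws) [] = g 1 * nineEval (κ.loopFactor q) (κ.dual.loopFactor q) ws := by
  rw [stateSum_eq_sum_stateWeights g κ hφ _ _ hws (Represents.nil φ), classCounts_nineVertices,
    List.zipWith_map_right, nineEval, ← sum_zipWith_mul]
  congr 2
  funext a e
  rw [weight_add hg, Kind.loopFactor, Kind.loopFactor]
  ring

theorem sum_zipWith_replicate_zero {β : Type} (f : β → K) (k : ℕ) (E : List β) :
    (List.zipWith (fun a e => a * f e) (List.replicate k 0) E).sum = 0 := by
  induction k generalizing E with
  | zero => simp
  | succ k ih => cases E <;> simp [List.replicate_succ, ih]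

theorem stateWeights_first (us : List K) : stateWeights (us.map fun u => (u, 0)) =
    us.prod :: List.replicate (2 ^ us.length - 1) 0 := by
  induction us with
  | nil => rfl
  | cons u us ih =>
    simp [stateWeights, ih, ← List.replicate_succ, Nat.sub_add_cancel Nat.one_le_two_pow]
    have := Nat.one_le_two_pow (n := us.length)
    rw [pow_succ]
    omega

theorem stateWeights_second (us : List K) : stateWeights (us.map fun u => (0, u)) =
    List.replicate (2 ^ us.length - 1) 0 ++ [us.prod] := by
  induction us with
  | nil => rfl
  | cons u us ih =>
    have h : 2 ^ (u :: us).length - 1 = (2 ^ us.length - 1) + 1 + (2 ^ us.length - 1) := by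
      have := Nat.one_le_two_pow (n := us.length)
      rw [List.length_cons, pow_succ]; omega
    rw [h, List.replicate_add, List.replicate_add]
    simp [stateWeights, ih]

set_option maxRecDepth 10000 in
theorem nineExponents_head : nineExponents.take 1 = [(4, 0)] := by decide +kernel

set_option maxRecDepth 10000 in
theorem nineExponents_last : nineExponents.drop 511 = [(0, 5)] := by decide +kernel

theorem nineEval_first (L M : K) (us : List K) :
    nineEval L M (us.map fun u => (u, 0)) = us.prod * L ^ 4 := by
  rw [nineEval, stateWeights_first, ← List.take_append_drop 1 nineExponents, nineExponents_head]
  simp [sum_zipWith_replicate_zero (fun e : ℕ × ℕ => L ^ e.1 * M ^ e.2)]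

theorem nineEval_second (L M : K) (us : List K) (hus : us.length = 9) :
    nineEval L M (us.map fun u => (0, u)) = us.prod * M ^ 5 := by
  have hlen : nineExponents.length = 512 := by
    rw [← List.length_map, ← classCounts_nineVertices .we, Kind.length_classCounts]
    rfl
  rw [nineEval, stateWeights_second, ← List.take_append_drop 511 nineExponents, nineExponents_last,
    List.zipWith_append (by rw [List.length_replicate, List.length_take, hlen, hus]; rfl), List.sum_append,
    sum_zipWith_replicate_zero (fun e : ℕ × ℕ => L ^ e.1 * M ^ e.2)]
  simp

/-- The exponents of `9*` for the states of the last seven vertices, with their multiplicities, if the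
first two vertices are in given states. -/
def nineTerms : List (List (ℕ × ℕ × ℕ)) :=
  [[(1, 4, 0), (7, 3, 0), (3, 2, 1), (21, 2, 0), (2, 1, 2), (14, 1, 1), (32, 1, 0), (1, 0, 3),
     (7, 0, 2), (19, 0, 1), (21, 0, 0)],
    [(1, 3, 0), (2, 2, 1), (7, 2, 0), (1, 1, 3), (6, 1, 2), (16, 1, 1), (19, 1, 0), (1, 0, 4),
     (7, 0, 3), (20, 0, 2), (29, 0, 1), (19, 0, 0)],
    [(1, 3, 0), (1, 2, 1), (7, 2, 0), (2, 1, 2), (11, 1, 1), (20, 1, 0), (1, 0, 4), (7, 0, 3),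
     (21, 0, 2), (33, 0, 1), (24, 0, 0)],
    [(1, 2, 1), (1, 2, 0), (1, 1, 3), (5, 1, 2), (10, 1, 1), (6, 1, 0), (1, 0, 5), (7, 0, 4),
     (21, 0, 3), (34, 0, 2), (30, 0, 1), (11, 0, 0)]]

/-- Terms with multiplicities as a list with repetitions. -/
def expandTerms (T : List (ℕ × ℕ × ℕ)) : List (ℕ × ℕ) :=
  T.flatMap fun t => List.replicate t.1 t.2

set_option maxRecDepth 10000 in
theorem perm_nineExponents : ∀ i < 4,
    ((nineExponents.drop (128 * i)).take 128).isPerm (expandTerms (nineTerms.getD i [])) = true := by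
  decide +kernel

theorem sum_map_expandTerms (L M : K) (T : List (ℕ × ℕ × ℕ)) :
    ((expandTerms T).map fun e => L ^ e.1 * M ^ e.2).sum =
      (T.map fun t => t.1 * (L ^ t.2.1 * M ^ t.2.2)).sum := by
  induction T with
  | nil => rfl
  | cons t T ih => simp_all [expandTerms, List.flatMap_cons]

theorem stateWeights_replicate_one (n : ℕ) :
    stateWeights (List.replicate n ((1 : K), (1 : K))) = List.replicate (2 ^ n) 1 := by
  induction n with
  | zero => rfl
  | succ n ih => simp [List.replicate_succ, stateWeights, ih, pow_succ, mul_two]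

theorem sum_zipWith_replicate {β : Type} (f : β → K) (z : K) (k : ℕ) (E : List β) :
    (List.zipWith (fun a e => a * f e) (List.replicate k z) E).sum = z * ((E.take k).map f).sum := by
  induction k generalizing E with
  | zero => simp
  | succ k ih => cases E <;> simp [List.replicate_succ, ih, mul_add]

/-- The value of `9*` with two tangles inserted. -/
theorem nineEval_two (L M : K) (u v : K × K) :
    nineEval L M (u :: v :: List.replicate 7 (1, 1)) =
      u.1 * v.1 * (L ^ 4 + 7 * L ^ 3 + 3 * L ^ 2 * M + 21 * L ^ 2 + 2 * L * M ^ 2 + 14 * L * M +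
        32 * L + M ^ 3 + 7 * M ^ 2 + 19 * M + 21) +
      u.1 * v.2 * (L ^ 3 + 2 * L ^ 2 * M + 7 * L ^ 2 + L * M ^ 3 + 6 * L * M ^ 2 + 16 * L * M +
        19 * L + M ^ 4 + 7 * M ^ 3 + 20 * M ^ 2 + 29 * M + 19) +
      u.2 * v.1 * (L ^ 3 + L ^ 2 * M + 7 * L ^ 2 + 2 * L * M ^ 2 + 11 * L * M + 20 * L + M ^ 4 +
        7 * M ^ 3 + 21 * M ^ 2 + 33 * M + 24) +
      u.2 * v.2 * (L ^ 2 * M + L ^ 2 + L * M ^ 3 + 5 * L * M ^ 2 + 10 * L * M + 6 * L + M ^ 5 +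
        7 * M ^ 4 + 21 * M ^ 3 + 34 * M ^ 2 + 30 * M + 11) := by
  have hlen : nineExponents.length = 512 := by
    rw [← List.length_map, ← classCounts_nineVertices .we, Kind.length_classCounts]
    rfl
  have block : ∀ i < 4, ∀ z : K, (List.zipWith (fun a (e : ℕ × ℕ) => a * (L ^ e.1 * M ^ e.2))
      (List.replicate 128 z) ((nineExponents.drop (128 * i)).take 128)).sum =
      z * ((nineTerms.getD i []).map fun t => t.1 * (L ^ t.2.1 * M ^ t.2.2)).sum := by
    intro i hi z
    rw [sum_zipWith_replicate (fun e : ℕ × ℕ => L ^ e.1 * M ^ e.2), List.take_take, min_self,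
      ((List.isPerm_iff.1 (perm_nineExponents i hi)).map _).sum_eq, sum_map_expandTerms]
  have hsplit : nineExponents = (nineExponents.drop (128 * 0)).take 128 ++
      ((nineExponents.drop (128 * 1)).take 128 ++ ((nineExponents.drop (128 * 2)).take 128 ++
        (nineExponents.drop (128 * 3)).take 128)) := by
    have h3 : (nineExponents.drop (128 * 3)).take 128 = nineExponents.drop (128 * 3) :=
      List.take_of_length_le (by simp [hlen])
    have h2 : nineExponents.drop (128 * 2) = (nineExponents.drop (128 * 2)).take 128 ++
        nineExponents.drop (128 * 3) := by
      conv_lhs => rw [← List.take_append_drop 128 (nineExponents.drop (128 * 2)), List.drop_drop]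
    have h1 : nineExponents.drop (128 * 1) = (nineExponents.drop (128 * 1)).take 128 ++
        nineExponents.drop (128 * 2) := by
      conv_lhs => rw [← List.take_append_drop 128 (nineExponents.drop (128 * 1)), List.drop_drop]
    rw [h3, ← h2, ← h1]
    exact (List.take_append_drop 128 nineExponents).symm
  have hw : stateWeights (u :: v :: List.replicate 7 ((1 : K), (1 : K))) =
      List.replicate 128 (u.1 * v.1) ++ (List.replicate 128 (u.1 * v.2) ++
        (List.replicate 128 (u.2 * v.1) ++ List.replicate 128 (u.2 * v.2))) := by
    rw [stateWeights, stateWeights, stateWeights_replicate_one]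
    simp only [List.map_append, List.map_replicate, mul_one, List.append_assoc]
    rfl
  rw [nineEval, hw, hsplit, List.zipWith_append (by simp [hlen]), List.zipWith_append (by simp [hlen]),
    List.zipWith_append (by simp [hlen]), List.sum_append, List.sum_append, List.sum_append,
    block 0 (by norm_num), block 1 (by norm_num), block 2 (by norm_num), block 3 (by norm_num)]
  simp only [nineTerms, List.getD_cons_zero, List.getD_cons_succ, List.map_cons, List.map_nil,
    List.sum_cons, List.sum_nil]
  push_cast
  ring

end Nine

theorem stateWeights_scale {K : Type} [Field K] {α β : K} (hα : α ≠ 0) (ts : List (K × K × K)) :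
    stateWeights (ts.map fun t => (t.1 * α * t.2.1, t.1 * β * t.2.2)) =
      List.zipWith (fun a s => (ts.map Prod.fst).prod * α ^ ts.length * ((β / α) ^ s * a))
        (stateWeights (ts.map Prod.snd)) (secondCounts ts.length) := by
  induction ts with
  | nil => simp [stateWeights, secondCounts]
  | cons t ts ih =>
    have hlen : ∀ n, (secondCounts n).length = 2 ^ n := fun n => by
      induction n with
      | zero => rfl
      | succ n ih => simp [secondCounts, ih, pow_succ]; ring
    simp only [List.map_cons, stateWeights, ih, List.length_cons, secondCounts]
    rw [List.zipWith_append (by simp [length_stateWeights, hlen]), List.zipWith_map_left,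
      List.zipWith_map, List.map_zipWith, List.map_zipWith]
    congr 2 <;> funext a s <;> simp only [List.prod_cons, pow_succ] <;> field_simp

theorem nineEval_scale {K : Type} [Field K] {L M l l' α β : K} (hα : α ≠ 0) (hβ : β ≠ 0)
    (hl : l * α = β * L) (hl' : l' * β = α * M) (ts : List (K × K × K)) (hts : ts.length = 9) :
    nineEval l l' (ts.map fun t => (t.1 * α * t.2.1, t.1 * β * t.2.2)) =
      (ts.map Prod.fst).prod * α ^ 5 * β ^ 4 * nineEval L M (ts.map Prod.snd) := by
  have key : ∀ (z : K) (A : List K) (C S : List ℕ),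
      (List.zipWith (fun m s => Nat.ble 1 m && Nat.ble 5 (m + s)) C S).all id = true →
      (List.zipWith (fun a (e : ℕ × ℕ) => a * (l ^ e.1 * l' ^ e.2))
        (List.zipWith (fun a s => z * ((β / α) ^ s * a)) A S)
        (List.zipWith (fun m s => (m - 1, m + s - 5)) C S)).sum =
      z * (β / α) ^ 4 * (List.zipWith (fun a (e : ℕ × ℕ) => a * (L ^ e.1 * M ^ e.2)) A
        (List.zipWith (fun m s => (m - 1, m + s - 5)) C S)).sum := by
    intro z A C S
    induction C generalizing A S with
    | nil => simp
    | cons m C ih =>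
      cases S with
      | nil => simp
      | cons s S =>
        cases A with
        | nil => simp
        | cons a A =>
          intro h
          simp only [List.zipWith_cons_cons, List.all_cons, Bool.and_eq_true, id, Nat.ble_eq] at h
          obtain ⟨⟨h1, h5⟩, h⟩ := h
          simp only [List.zipWith_cons_cons, List.sum_cons, ih A S h, mul_add, add_left_inj]
          have e : m - 1 + s = (m + s - 5) + 4 := by omega
          have hl1 : l = β / α * L := by field_simp; rw [hl]
          have hl2 : l' = (β / α)⁻¹ * M := by field_simp; rw [← hl']
          have hρ : β / α ≠ 0 := div_ne_zero hβ hα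
          rw [hl1, hl2, mul_pow, mul_pow, inv_pow]
          have : (β / α) ^ (m - 1) * (β / α) ^ s = (β / α) ^ (m + s - 5) * (β / α) ^ 4 := by
            rw [← pow_add, e, pow_add]
          field_simp at this ⊢
          linear_combination (z * a * L ^ (m - 1) * M ^ (m + s - 5)) * this
  rw [nineEval, stateWeights_scale hα, hts, nineExponents,
    key _ _ _ _ five_le_classCounts_add_secondCounts, nineEval, nineExponents]
  congr 1
  field_simp

/-! ### Diagrams made of tangles -/

/-- The three ways in which tangles are put together to a diagram. -/
inductive Shape
  | link (t : Tangle)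
  | prism (n : ℕ) (l : List Tangle)
  | nine (l : List Tangle)

namespace Shape

/-- The diagram of a shape. -/
def diagram : Shape → Diagram
  | link t => linkOf t
  | prism n l => antiprism n l
  | nine l => nineStar l

/-- Antiprisms with fewer than four vertices are excluded. -/
def Valid : Shape → Prop
  | prism n _ => 2 ≤ n
  | _ => True

/-- The tangles at the vertices, each reflected if necessary. -/
def tangles : Shape → List Tangle
  | link t => [t]
  | prism n l => (List.range (2 * n)).map fun i =>
      if i % 2 = 0 then reflect (l.getD i (crossing true)) else l.getD i (crossing true)
  | nine l => reflect (l.getD 0 (crossing true)) :: l.getD 1 (crossing true) ::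
      [crossing true, reflect (crossing true), crossing true, crossing true,
        reflect (crossing true), crossing true, crossing true]

/-- The value of a diagram as a function of the values of the tangles at the vertices. -/
def eval {K : Type} [CommRing K] (L M : K) : Shape → List (K × K) → K
  | link _, ws => (ws.headD 0).1 + M * (ws.headD 0).2
  | prism _ _, ws => TLThree.closure L M ws
  | nine _, ws => nineEval L M ws

/-- The degree in the first coefficients, up to multiples of the degrees of `L` and `M`. -/
def firstDegree : Shape → ℕ
  | link _ => 1
  | prism n _ => n
  | nine _ => 5

/-- The degree in the second coefficients, up to multiples of the degrees of `L` and `M`. -/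
def secondDegree : Shape → ℕ
  | link _ => 0
  | prism n _ => n
  | nine _ => 4

/-- The value of a diagram. -/
def value {K : Type} [Field K] (γ L M : K) (S : Shape) : K :=
  S.eval L M (S.tangles.map (Tangle.value γ L M))

section StateSum

variable {K : Type} [CommRing K] {g : ℕ → K} {q : K}

theorem stateSum_linkOf (hg : ∀ n, 1 ≤ n → g (n + 1) = q * g n) (κ : Kind) (w : Bool → K × K)
    (t : Tangle) : stateSum g ((linkOf t).map (κ.resolveCrossing w)) [] =
      g 1 * (link t).eval (κ.loopFactor q) (κ.dual.loopFactor q)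
        [t.rawValue (κ.loopFactor q) (κ.dual.loopFactor q) w] := by
  have := stateSum_places hg κ w 1 [⟨t, [0], ([], 0), ([], 1), ([], 1), ([], 0)⟩]
    (by simp [Place.Within]) (by simp) [] (by simp)
  rw [List.flatMap_singleton] at this
  refine this.trans ?_
  let φ : ℕ → Arc := fun i => ([], i)
  have key : ∀ {n : ℕ} {I : List (ℕ × ℕ)}, Eliminates 0 2 (n + 1) I [] →
      g (loopCount (mapJoins φ I ++ [])) = q ^ n * g 1 := by
    intro n I hI
    rw [loopCount_eliminate hI (by norm_num) (φ := φ) (by simp [φ]) (by simp)]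
    have h0 : loopCount (mapJoins φ [] ++ []) = 0 := by
      rw [loopCount_eq_classCount]; simp [mapJoins, classCount]
    rw [h0, zero_add, weight_add hg]
  have h1 : Eliminates 0 2 (0 + 1) (κ.fst 0 1 1 0) [] := by cases κ <;> decide
  have h2 : Eliminates 0 2 (κ.dual.enclosed + 1) (κ.snd 0 1 1 0) [] := by cases κ <;> decide
  have e1 := key h1
  have e2 := key h2
  rw [mapJoins_fst] at e1
  rw [mapJoins_snd] at e2
  simp only [List.map_cons, List.map_nil, Place.resolve, Kind.resolve, stateSum, eval,
    List.headD_cons]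
  rw [e1, e2, Kind.loopFactor, Kind.loopFactor]
  ring

theorem stateSum_antiprism (hg : ∀ n, 1 ≤ n → g (n + 1) = q * g n) (κ : Kind) (w : Bool → K × K)
    {n : ℕ} (hn : 2 ≤ n) (l : List Tangle) :
    stateSum g ((antiprism n l).map (κ.resolveCrossing w)) [] =
      g 1 * (prism n l).eval (κ.loopFactor q) (κ.dual.loopFactor q)
        ((prism n l).tangles.map (rawValue (κ.loopFactor q) (κ.dual.loopFactor q) w)) := by
  let z : ℕ → Arc := fun j => ([], 2 * (j % (2 * n)))
  let z' : ℕ → Arc := fun j => ([], 2 * (j % (2 * n)) + 1)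
  let P : ℕ → Place := fun i =>
    if i % 2 = 0 then ⟨reflect (l.getD i (crossing true)), [i], z' (i + 2 * n - 2), z' i, z i,
      z (i + 2 * n - 1)⟩
    else ⟨l.getD i (crossing true), [i], z i, z' i, z' (i + 2 * n - 2), z (i + 2 * n - 1)⟩
  have hP : antiprism n l = ((List.range (2 * n)).map P).flatMap Place.crossings := by
    rw [List.flatMap_map, antiprism]
    congr 1
    funext i
    simp only [P]
    split_ifs <;> rfl
  have hπ : ∀ i, (P i).π = [i] := fun i => by simp only [P]; split_ifs <;> rfl
  rw [hP, stateSum_places hg κ w 1, List.map_map]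
  · let v : ℕ → K × K := fun i => rawValue (κ.loopFactor q) (κ.dual.loopFactor q) w
      (if i % 2 = 0 then reflect (l.getD i (crossing true)) else l.getD i (crossing true))
    have hv : Place.resolve κ q w ∘ P = prismPlace n κ v := by
      funext i
      simp only [Function.comp, P, prismPlace, v]
      split_ifs <;> rfl
    rw [hv, stateSum_closedBraid hg κ v hn, eval, tangles, List.map_map]
    rfl
  · intro p hp
    obtain ⟨i, -, rfl⟩ := List.mem_map.1 hp
    refine ⟨by rw [hπ]; rfl, ?_⟩
    simp only [P]
    split_ifs <;> simp [z, z']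
  · rw [List.map_map, show Place.π ∘ P = fun i => [i] from funext hπ]
    exact List.nodup_range.map fun i j hij => by simpa using hij
  · simp

theorem stateSum_nineStar (hg : ∀ n, 1 ≤ n → g (n + 1) = q * g n) (κ : Kind) (w : Bool → K × K)
    (l : List Tangle) : stateSum g ((nineStar l).map (κ.resolveCrossing w)) [] =
      g 1 * (nine l).eval (κ.loopFactor q) (κ.dual.loopFactor q)
        ((nine l).tangles.map (rawValue (κ.loopFactor q) (κ.dual.loopFactor q) w)) := by
  let P : ℕ → List Place := fun j =>
    let k := (j + 2) % 3
    [⟨reflect (if j = 0 then l.getD 0 (crossing true) else crossing true), [0, j], ([2], k), ([1], j),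
        ([0], j), ([0], k)⟩,
      ⟨if j = 0 then l.getD 1 (crossing true) else crossing true, [1, j], ([1], j), ([4], j), ([5], j),
        ([2], j)⟩,
      ⟨crossing true, [2, j], ([3], k), ([3], j), ([4], j), ([5], k)⟩]
  have hP : nineStar l = ((List.range 3).flatMap P).flatMap Place.crossings := by
    rw [List.flatMap_assoc, nineStar]
    congr 1
    funext j
    simp only [P, List.flatMap_cons, List.flatMap_nil, List.append_nil, List.append_assoc]
    rfl
  rw [hP, stateSum_places hg κ w 2]
  · have hφ : Function.Injective fun i : ℕ => (([i / 3], i % 3) : Arc) := by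
      intro i j hij
      simp only [Prod.mk.injEq, List.cons.injEq, and_true] at hij
      omega
    exact stateSum_nine hg κ hφ ((nine l).tangles.map
      (rawValue (κ.loopFactor q) (κ.dual.loopFactor q) w)) rfl
  · intro p hp
    obtain ⟨j, -, hp⟩ := List.mem_flatMap.1 hp
    simp only [P, List.mem_cons, List.not_mem_nil, or_false] at hp
    rcases hp with rfl | rfl | rfl <;> simp [Place.Within]
  · rw [List.map_flatMap]
    change ([[0, 0], [1, 0], [2, 0], [0, 1], [1, 1], [2, 1], [0, 2], [1, 2], [2, 2]] :
      List (List ℕ)).Nodup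
    decide
  · simp

/-- The state sum of a diagram in terms of the state sums of its tangles. -/
theorem stateSum_diagram (hg : ∀ n, 1 ≤ n → g (n + 1) = q * g n) (κ : Kind) (w : Bool → K × K)
    (S : Shape) (hS : S.Valid) : stateSum g (S.diagram.map (κ.resolveCrossing w)) [] =
      g 1 * S.eval (κ.loopFactor q) (κ.dual.loopFactor q)
        (S.tangles.map (rawValue (κ.loopFactor q) (κ.dual.loopFactor q) w)) := by
  cases S with
  | link t => exact stateSum_linkOf hg κ w t
  | prism n l => exact stateSum_antiprism hg κ w hS l
  | nine l => exact stateSum_nineStar hg κ w l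

end StateSum

/-! ### Homogeneity of the values -/

theorem braid_first {K : Type} [CommRing K] (L M : K) (n : ℕ) (us : List K)
    (hus : us.length = 2 * n) (s : K) :
    TLThree.braid L M ⟨0, 0, s, 0, 0⟩ (us.map fun u => (u, 0)) =
      ⟨0, 0, s * us.prod * L ^ n, 0, 0⟩ := by
  induction n generalizing us s with
  | zero =>
    obtain rfl := List.length_eq_zero_iff.1 hus
    simp [TLThree.braid]
  | succ n ih =>
    match us, hus with
    | a :: b :: us, hus =>
      have := ih us (by simp at hus; omega) (s * (a * b) * L)
      simp only [List.map_cons, TLThree.braid, TLThree.mulFirst, TLThree.mulSecond, mul_zero,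
        add_zero, zero_mul, zero_add]
      rw [show b * (L * (a * s)) = s * (a * b) * L by ring, this]
      simp only [List.prod_cons, TLThree.mk.injEq, and_true, true_and]
      ring

theorem braid_second {K : Type} [CommRing K] (L M : K) (n : ℕ) (us : List K)
    (hus : us.length = 2 * n) (s : K) :
    TLThree.braid L M ⟨0, s, 0, 0, 0⟩ (us.map fun u => (0, u)) =
      ⟨0, s * us.prod * M ^ n, 0, 0, 0⟩ := by
  induction n generalizing us s with
  | zero =>
    obtain rfl := List.length_eq_zero_iff.1 hus
    simp [TLThree.braid]
  | succ n ih =>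
    match us, hus with
    | a :: b :: us, hus =>
      have := ih us (by simp at hus; omega) (s * (a * b) * M)
      simp only [List.map_cons, TLThree.braid, TLThree.mulFirst, TLThree.mulSecond, mul_zero,
        add_zero, zero_mul, zero_add]
      rw [show b * (a * (M * s)) = s * (a * b) * M by ring, this]
      simp only [List.prod_cons, TLThree.mk.injEq, and_true, true_and]
      ring

/-- If the second coefficients vanish, only the first state of every vertex contributes. With
`eval_second` this counts the regions of either colour and shows that the checkerboard graphs are
connected. -/
theorem eval_first {K : Type} [CommRing K] (L M : K) (S : Shape) (hS : S.Valid) (us : List K)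
    (hus : us.length = S.tangles.length) :
    S.eval L M (us.map fun u => (u, 0)) = us.prod * L ^ S.secondDegree := by
  cases S with
  | link t =>
    obtain ⟨u, rfl⟩ := List.length_eq_one_iff.1 hus
    simp [eval, secondDegree]
  | prism n l =>
    obtain ⟨n, rfl⟩ : ∃ m, n = m + 1 := ⟨n - 1, by have : 2 ≤ n := hS; omega⟩
    simp only [tangles, List.length_map, List.length_range] at hus
    match us, hus with
    | a :: b :: us, hus =>
      have := braid_first L M n us (by simp at hus; omega) (b * a)
      simp only [eval, TLThree.closure, List.map_cons, TLThree.braid, TLThree.mulFirst,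
        TLThree.mulSecond, mul_zero, add_zero, zero_mul, zero_add, mul_one, this, TLThree.trace,
        List.prod_cons, secondDegree]
      ring
  | nine l => exact nineEval_first L M us

theorem eval_second {K : Type} [CommRing K] (L M : K) (S : Shape) (hS : S.Valid) (us : List K)
    (hus : us.length = S.tangles.length) :
    S.eval L M (us.map fun u => (0, u)) = us.prod * M ^ S.firstDegree := by
  cases S with
  | link t =>
    obtain ⟨u, rfl⟩ := List.length_eq_one_iff.1 hus
    simp [eval, firstDegree, mul_comm]
  | prism n l =>
    obtain ⟨n, rfl⟩ : ∃ m, n = m + 1 := ⟨n - 1, by have : 2 ≤ n := hS; omega⟩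
    simp only [tangles, List.length_map, List.length_range] at hus
    match us, hus with
    | a :: b :: us, hus =>
      have := braid_second L M n us (by simp at hus; omega) (b * a)
      simp only [eval, TLThree.closure, List.map_cons, TLThree.braid, TLThree.mulFirst,
        TLThree.mulSecond, mul_zero, add_zero, zero_mul, zero_add, mul_one, this, TLThree.trace,
        List.prod_cons, firstDegree]
      ring
  | nine l => exact nineEval_second L M us hus

section Scale

variable {K : Type} [Field K] {L M l l' α β : K}

theorem braid_scale (hα : α ≠ 0) (hβ : β ≠ 0) (hl : l * α = β * L) (hl' : l' * β = α * M) (n : ℕ)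
    (ts : List (K × K × K)) (hts : ts.length = 2 * n) (c : K) (v : TLThree K) :
    TLThree.braid l l' ⟨c * v.one, c * (β / α * v.e1), c * (α / β * v.e2), c * v.e12, c * v.e21⟩
        (ts.map fun t => (t.1 * α * t.2.1, t.1 * β * t.2.2)) =
      let V := TLThree.braid L M v (ts.map Prod.snd)
      let C := c * (ts.map Prod.fst).prod * α ^ n * β ^ n
      ⟨C * V.one, C * (β / α * V.e1), C * (α / β * V.e2), C * V.e12, C * V.e21⟩ := by
  induction n generalizing ts c v with
  | zero =>
    obtain rfl := List.length_eq_zero_iff.1 hts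
    simp [TLThree.braid]
  | succ n ih =>
    match ts, hts with
    | a :: b :: ts, hts =>
      have hl1 : l = β / α * L := by field_simp; rw [hl]
      have hl2 : l' = α / β * M := by field_simp; rw [hl']
      have := ih ts (by simp at hts; omega) (c * (a.1 * b.1) * α * β)
        ((v.mulFirst M a.2).mulSecond L b.2)
      simp only [List.map_cons, TLThree.braid]
      convert this using 2
      · simp only [TLThree.mulFirst, TLThree.mulSecond, TLThree.mk.injEq]
        rw [hl1, hl2]
        refine ⟨?_, ?_, ?_, ?_, ?_⟩ <;> field_simp
      all_goals
        simp only [List.prod_cons]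
        ring

/-- The value is homogeneous of bidegree (`firstDegree`, `secondDegree`), if `L` has the bidegree `(-1, 1)`
and `M` the bidegree `(1, -1)`. -/
theorem eval_scale (hα : α ≠ 0) (hβ : β ≠ 0) (hl : l * α = β * L) (hl' : l' * β = α * M) (S : Shape)
    (ts : List (K × K × K)) (hts : ts.length = S.tangles.length) :
    S.eval l l' (ts.map fun t => (t.1 * α * t.2.1, t.1 * β * t.2.2)) =
      (ts.map Prod.fst).prod * α ^ S.firstDegree * β ^ S.secondDegree *
        S.eval L M (ts.map Prod.snd) := by
  cases S with
  | link t =>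
    obtain ⟨u, rfl⟩ := List.length_eq_one_iff.1 hts
    simp only [eval, firstDegree, secondDegree, List.map_cons, List.map_nil, List.headD_cons,
      List.prod_cons, List.prod_nil]
    linear_combination (u.1 * u.2.2) * hl'
  | prism n ws =>
    simp only [tangles, List.length_map, List.length_range] at hts
    have := braid_scale hα hβ hl hl' n ts hts 1 ⟨1, 0, 0, 0, 0⟩
    simp only [mul_zero, mul_one, one_mul] at this
    simp only [eval, firstDegree, secondDegree, TLThree.closure, this, TLThree.trace]
    have hl1 : l = β / α * L := by field_simp; rw [hl]
    have hl2 : l' = α / β * M := by field_simp; rw [hl']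
    rw [hl1, hl2]
    field_simp
  | nine ws => exact nineEval_scale hα hβ hl hl' ts hts

end Scale

end Shape

/-! ### Tutte and Jones polynomials as values -/

namespace Shape

theorem eval_rawValue {K : Type} [Field K] {γ L M l l' α β : K} (hγ : γ ≠ 0) (hα : α ≠ 0)
    (hβ : β ≠ 0) (hl : l * α = β * L) (hl' : l' * β = α * M) (u : Bool → K) (S : Shape) :
    S.eval l l' (S.tangles.map
        (rawValue l l' fun e => (u e * α * bif e then 1 else γ, u e * β))) =
      (S.tangles.map (scale γ α β u)).prod * α ^ S.firstDegree * β ^ S.secondDegree *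
        S.value γ L M := by
  have := eval_scale hα hβ hl hl' S
    (S.tangles.map fun t => (t.scale γ α β u, t.value γ L M)) (List.length_map _)
  simp only [List.map_map] at this
  rw [value, show (Tangle.value γ L M) = Prod.snd ∘ fun t => (t.scale γ α β u, t.value γ L M) from rfl]
  refine Eq.trans ?_ this
  congr 2
  funext t
  exact rawValue_eq t hγ hl hl' u

/-- The value of a diagram in terms of `x` and `y` for a colour. -/
def colourValue {K : Type} [Field K] (γ x y : K) (S : Shape) : Colour → K
  | .WE => S.value γ (x - 1) (y - 1)
  | .NS => S.value γ⁻¹ (y - 1) (x - 1)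

theorem prod_map_pow {K : Type} [CommMonoid K] (Y : K) (f : Tangle → ℕ) (T : List Tangle) :
    (T.map fun t => Y ^ f t).prod = Y ^ (T.map f).sum := by
  induction T with
  | nil => simp
  | cons t T ih => simp [ih, pow_add]

/-- The Tutte polynomial of a checkerboard graph is the value of the diagram. -/
theorem aeval_tutte {K : Type} [Field K] {x y : K} (hx : x - 1 ≠ 0) (hy : y - 1 ≠ 0) (S : Shape)
    (hS : S.Valid) (k : Colour) :
    MvPolynomial.aeval ![x, y] (tutte (taitGraph k S.diagram)) = S.colourValue 1 x y k := by
  obtain ⟨X, rfl⟩ : ∃ X, x = X + 1 := ⟨x - 1, by ring⟩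
  obtain ⟨Y, rfl⟩ : ∃ Y, y = Y + 1 := ⟨y - 1, by ring⟩
  rw [add_sub_cancel_right] at hx hy
  have hg2 : ∀ n, 1 ≤ n → (fun n => (2 : ℤ) ^ n) (n + 1) = 2 * (fun n => (2 : ℤ) ^ n) n :=
    fun n _ => pow_succ' 2 n
  have hg : ∀ n, 1 ≤ n → (fun n => (X * Y) ^ n) (n + 1) = X * Y * (fun n => (X * Y) ^ n) n :=
    fun n _ => pow_succ' _ n
  cases k
  · have key := tutte_taitGraph .WE S.diagram
      (1 + (S.tangles.map (innerRegions true)).sum + S.secondDegree) ?_ ?_ X Y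
    · rw [Colour.kind, stateSum_diagram hg _ _ S hS] at key
      have hw := eval_rawValue (γ := 1) (L := X) (M := Y) (l := X * Y) (l' := 1) (α := 1) (β := Y)
        one_ne_zero one_ne_zero hy (by ring) (by ring) (fun _ => 1) S
      have hw' : (fun e : Bool => ((1 : K) * 1 * bif e then 1 else 1, 1 * Y)) = fun _ => (1, Y) := by
        funext e; simp
      have hs : (S.tangles.map (scale 1 1 Y fun _ => 1)).prod =
          Y ^ (S.tangles.map (innerRegions true)).sum := by
        rw [← prod_map_pow]
        exact congrArg _ (List.map_congr_left fun t _ => (scale_one t Y).1)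
      rw [hw'] at hw
      simp only [Kind.loopFactor, Kind.enclosed, Kind.dual, pow_one, pow_zero, Colour.weight, hw,
        hs, one_pow, mul_one] at key
      have h0 : X * Y ^ (1 + (S.tangles.map (innerRegions true)).sum + S.secondDegree) ≠ 0 :=
        mul_ne_zero hx (pow_ne_zero _ hy)
      refine mul_left_cancel₀ h0 (key.trans ?_)
      rw [colourValue, add_sub_cancel_right, add_sub_cancel_right]
      ring
    · rw [Colour.kind, stateSum_diagram hg2 _ _ S hS]
      simp only [Kind.loopFactor, Kind.enclosed, Kind.dual, pow_one, pow_zero, Colour.weight]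
      have := eval_first (2 : ℤ) 1 S hS (S.tangles.map fun t => 2 ^ t.innerRegions true) (by simp)
      rw [List.map_map] at this
      rw [show rawValue (2 : ℤ) 1 (fun _ => (1, 0)) =
        (fun u => (u, 0)) ∘ fun t : Tangle => 2 ^ t.innerRegions true from
          funext fun t => (rawValue_delete t).1, this, prod_map_pow]
      ring
    · rw [Colour.kind, stateSum_diagram hg2 _ _ S hS]
      simp only [Kind.loopFactor, Kind.enclosed, Kind.dual, pow_one, pow_zero, Colour.weight]
      have := eval_second (2 : ℤ) 1 S hS (S.tangles.map fun _ => 1) (by simp)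
      rw [List.map_map] at this
      rw [show rawValue (2 : ℤ) 1 (fun _ => (0, 1)) = (fun u => (0, u)) ∘ fun _ : Tangle => 1 from
          funext fun t => (rawValue_contract t).1, this]
      simp
  · have key := tutte_taitGraph .NS S.diagram
      (1 + (S.tangles.map (innerRegions false)).sum + S.firstDegree) ?_ ?_ X Y
    · rw [Colour.kind, stateSum_diagram hg _ _ S hS] at key
      have hw := eval_rawValue (γ := 1) (L := Y) (M := X) (l := 1) (l' := X * Y) (α := Y) (β := 1)
        one_ne_zero hy one_ne_zero (by ring) (by ring) (fun _ => 1) S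
      have hw' : (fun e : Bool => ((1 : K) * Y * bif e then 1 else 1, (1 : K) * 1)) =
          fun _ => (Y, 1) := by
        funext e; simp
      have hs : (S.tangles.map (scale 1 Y 1 fun _ => 1)).prod =
          Y ^ (S.tangles.map (innerRegions false)).sum := by
        rw [← prod_map_pow]
        exact congrArg _ (List.map_congr_left fun t _ => (scale_one t Y).2)
      rw [hw'] at hw
      simp only [Kind.loopFactor, Kind.enclosed, Kind.dual, pow_one, pow_zero, Colour.weight, hw,
        hs, one_pow, mul_one] at key
      have h0 : X * Y ^ (1 + (S.tangles.map (innerRegions false)).sum + S.firstDegree) ≠ 0 :=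
        mul_ne_zero hx (pow_ne_zero _ hy)
      refine mul_left_cancel₀ h0 (key.trans ?_)
      rw [colourValue, inv_one, add_sub_cancel_right, add_sub_cancel_right]
      ring
    · rw [Colour.kind, stateSum_diagram hg2 _ _ S hS]
      simp only [Kind.loopFactor, Kind.enclosed, Kind.dual, pow_one, pow_zero, Colour.weight]
      have := eval_second (1 : ℤ) 2 S hS (S.tangles.map fun t => 2 ^ t.innerRegions false) (by simp)
      rw [List.map_map] at this
      rw [show rawValue (1 : ℤ) 2 (fun _ => (0, 1)) =
        (fun u => (0, u)) ∘ fun t : Tangle => 2 ^ t.innerRegions false from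
          funext fun t => (rawValue_delete t).2, this, prod_map_pow]
      ring
    · rw [Colour.kind, stateSum_diagram hg2 _ _ S hS]
      simp only [Kind.loopFactor, Kind.enclosed, Kind.dual, pow_one, pow_zero, Colour.weight]
      have := eval_first (1 : ℤ) 2 S hS (S.tangles.map fun _ => 1) (by simp)
      rw [List.map_map] at this
      rw [show rawValue (1 : ℤ) 2 (fun _ => (1, 0)) = (fun u => (u, 0)) ∘ fun _ : Tangle => 1 from
          funext fun t => (rawValue_contract t).2, this]
      simp

end Shape

section Bracket

variable {K : Type} [Field K]

theorem bracketAux_eq_stateSum (A : K) (D : Diagram) (J : List (Arc × Arc)) :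
    bracketAux A D J = stateSum (fun n => (-A ^ 2 - (A ^ 2)⁻¹) ^ (n - 1))
      (D.map (Kind.loops.resolveCrossing fun e => bif e then (A, A⁻¹) else (A⁻¹, A))) J := by
  induction D generalizing J with
  | nil => rfl
  | cons c D ih =>
    simp only [bracketAux, List.map_cons, stateSum, ih]
    obtain ⟨a, b, c, d, _ | _⟩ := c
    · exact add_comm _ _
    · rfl

theorem bracket_mirror (A : K) (D : Diagram) : bracket A D.mirror = bracket A⁻¹ D := by
  rw [bracket, bracket, bracketAux_eq_stateSum, bracketAux_eq_stateSum, Diagram.mirror, List.map_map]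
  have h : -A⁻¹ ^ 2 - (A⁻¹ ^ 2)⁻¹ = -A ^ 2 - (A ^ 2)⁻¹ := by
    rw [inv_pow, inv_inv]; ring
  rw [h]
  congr 2
  funext c
  obtain ⟨a, b, c, d, _ | _⟩ := c <;> simp [Kind.resolveCrossing]

theorem bracket_diagram {B : K} (hB : B ≠ 0) (S : Shape) (hS : S.Valid) :
    ∃ m : ℤ, bracket B S.diagram = B ^ m * S.value (B ^ 4)⁻¹ (-B ^ 4 - 1) (-(B ^ 4)⁻¹ - 1) := by
  set δ := -B ^ 2 - (B ^ 2)⁻¹ with hδ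
  have hg : ∀ n, 1 ≤ n → (fun n => δ ^ (n - 1)) (n + 1) = δ * (fun n => δ ^ (n - 1)) n := by
    intro n hn
    obtain ⟨n, rfl⟩ : ∃ m, n = m + 1 := ⟨n - 1, by omega⟩
    exact pow_succ' δ n
  have hw := Shape.eval_rawValue (γ := (B ^ 4)⁻¹) (L := -B ^ 4 - 1) (M := -(B ^ 4)⁻¹ - 1) (l := δ)
    (l' := δ) (α := B) (β := B⁻¹) (inv_ne_zero (pow_ne_zero 4 hB)) hB (inv_ne_zero hB)
    (by rw [hδ]; field_simp) (by rw [hδ]; field_simp; ring) (fun e => bif e then 1 else B ^ 2) S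
  have hw' : (fun e : Bool => ((bif e then 1 else B ^ 2) * B * bif e then 1 else (B ^ 4)⁻¹,
      (bif e then 1 else B ^ 2) * B⁻¹)) = fun e => bif e then (B, B⁻¹) else (B⁻¹, B) := by
    funext e
    cases e
    · simp only [cond_false, Prod.mk.injEq]
      constructor <;> field_simp
    · simp
  rw [hw'] at hw
  have hprod : ∀ T : List Tangle, ∃ m : ℤ,
      (T.map (scale (B ^ 4)⁻¹ B B⁻¹ fun e => bif e then 1 else B ^ 2)).prod = B ^ m := by
    intro T
    induction T with
    | nil => exact ⟨0, by simp⟩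
    | cons t T ih =>
      obtain ⟨m, hm⟩ := ih
      obtain ⟨m', hm'⟩ := t.exists_scale_eq_zpow hB
      exact ⟨m' + m, by rw [List.map_cons, List.prod_cons, hm, hm', zpow_add₀ hB]⟩
  obtain ⟨m, hm⟩ := hprod S.tangles
  refine ⟨m + S.firstDegree - S.secondDegree, ?_⟩
  rw [bracket, bracketAux_eq_stateSum, Shape.stateSum_diagram hg _ _ S hS]
  simp only [Kind.loopFactor, Kind.enclosed, Kind.dual, pow_one, hw, hm, Nat.sub_self, pow_zero,
    one_mul]
  rw [zpow_sub₀ hB, zpow_add₀ hB, zpow_natCast, zpow_natCast, inv_pow, div_eq_mul_inv]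

theorem eqUpToUnit_jones_bracket (A : K) (D : Diagram) (o : List (Bool × Bool)) :
    EqUpToUnit A (jones A D o) (bracket A D) := by
  refine ⟨3 * -writhe D o, ?_⟩
  rw [jones, neg_eq_neg_one_mul, mul_zpow, ← zpow_natCast, ← zpow_mul, Nat.cast_ofNat]
  rcases Int.even_or_odd (-writhe D o) with h | h
  · left; rw [h.neg_one_zpow, one_mul]
  · right; rw [h.neg_one_zpow]; ring

theorem eqUpToUnit_jones_value {A : K} (hA : A ≠ 0) (S : Shape) (hS : S.Valid) (k : Colour)
    (o : List (Bool × Bool)) : EqUpToUnit A (jones A (k.normalize S.diagram) o)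
      (S.colourValue (A ^ 4) (-(A ^ 4)⁻¹) (-A ^ 4) k) := by
  obtain ⟨m, hm⟩ := eqUpToUnit_jones_bracket A (k.normalize S.diagram) o
  have h : ∃ m : ℤ, bracket A (k.normalize S.diagram) =
      A ^ m * S.colourValue (A ^ 4) (-(A ^ 4)⁻¹) (-A ^ 4) k := by
    cases k
    · obtain ⟨m, hm⟩ := bracket_diagram (inv_ne_zero hA) S hS
      refine ⟨-m, ?_⟩
      simp only [Colour.normalize, bracket_mirror, hm, Shape.colourValue, inv_pow, inv_inv, zpow_neg,
        inv_zpow]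
    · obtain ⟨m, hm⟩ := bracket_diagram hA S hS
      exact ⟨m, hm⟩
  obtain ⟨m', hm'⟩ := h
  refine ⟨m + m', ?_⟩
  rw [zpow_add₀ hA, mul_assoc, ← hm']
  exact hm

end Bracket

/-! ### The formulas without denominators -/

section Geom

variable {K : Type} [Field K] {x y : K}

theorem geom_one (hx : x - 1 ≠ 0) : geom x 1 = 1 := by
  rw [geom, zpow_one, div_self hx]

theorem zpow_eq_geom (hx : x - 1 ≠ 0) (n : ℤ) : x ^ n = 1 + (x - 1) * geom x n := by
  rw [geom, mul_div_cancel₀ _ hx]; ring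

theorem geom_add (h0 : x ≠ 0) (hx : x - 1 ≠ 0) (m n : ℤ) :
    geom x (m + n) = geom x m + geom x n + (x - 1) * geom x m * geom x n := by
  have : (x - 1) * geom x (m + n) =
      (x - 1) * (geom x m + geom x n + (x - 1) * geom x m * geom x n) := by
    have := zpow_add₀ h0 m n
    rw [zpow_eq_geom hx, zpow_eq_geom hx, zpow_eq_geom hx] at this
    linear_combination this
  exact mul_left_cancel₀ hx this

theorem geom_two (h0 : x ≠ 0) (hx : x - 1 ≠ 0) : geom x 2 = x + 1 := by
  rw [show (2 : ℤ) = 1 + 1 by norm_num, geom_add h0 hx, geom_one hx]; ring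

theorem geom_three (h0 : x ≠ 0) (hx : x - 1 ≠ 0) : geom x 3 = x ^ 2 + x + 1 := by
  rw [show (3 : ℤ) = 2 + 1 by norm_num, geom_add h0 hx, geom_one hx, geom_two h0 hx]; ring

theorem geom_four (h0 : x ≠ 0) (hx : x - 1 ≠ 0) : geom x 4 = x ^ 3 + x ^ 2 + x + 1 := by
  rw [show (4 : ℤ) = 3 + 1 by norm_num, geom_add h0 hx, geom_one hx, geom_three h0 hx]; ring

theorem geom_sub_one (h0 : x ≠ 0) (hx : x - 1 ≠ 0) (n : ℤ) :
    geom x (n - 1) = (geom x n - 1) * x⁻¹ := by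
  have := geom_add h0 hx (n - 1) 1
  rw [sub_add_cancel, geom_one hx] at this
  rw [this]
  field_simp
  ring

theorem T_p_q_r_eq (h0 : x ≠ 0) (hx : x - 1 ≠ 0) (p q r : ℤ) : T_p_q_r x y p q r =
    geom x p * geom x q + geom x p * geom x r + geom x q * geom x r +
      (x - 1) * geom x p * geom x q * geom x r + (y - 1) * (geom x p + geom x q + geom x r) +
      (y - 1) ^ 2 := by
  simp only [T_p_q_r, zpow_eq_geom hx, geom_add h0 hx, geom_one hx]
  field_simp
  ring

theorem T_p1q_eq (hx : x - 1 ≠ 0) (p q : ℤ) : T_p1q x y p q =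
    x * geom x p * geom x q + y * (geom x p + geom x q + y - 1) := by
  simp only [T_p1q, zpow_eq_geom hx]
  field_simp
  ring

theorem T_pqr_eq (h0 : x ≠ 0) (hx : x - 1 ≠ 0) (hy : y - 1 ≠ 0) (p q r : ℤ) : T_pqr x y p q r =
    geom x p * geom x r * (x - 1 + geom y q) +
      (1 + (y - 1) * geom y q) * (geom x p + geom x r + y - 1) := by
  simp only [T_pqr, zpow_eq_geom hx, zpow_eq_geom hy, geom_add h0 hx, geom_one hx]
  field_simp
  ring

theorem T_dot_p_eq (h0 : x ≠ 0) (hx : x - 1 ≠ 0) (p : ℤ) : T_dot_p x y p =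
    geom x p * (x ^ 3 + 2 * x ^ 2 + y ^ 2 + 2 * x * y + y + x) + x * (x + 1) + y + 2 * x * y +
      2 * y ^ 2 + y ^ 3 := by
  simp only [T_dot_p, zpow_eq_geom hx, geom_add h0 hx, geom_one hx]
  field_simp
  ring

theorem T_dot_p_col_q_eq (hx : x - 1 ≠ 0) (p q : ℤ) : T_dot_p_col_q x y p q =
    geom x q * (geom x p * (x ^ 3 + x ^ 2 + x + y) + (x + y) ^ 2) + geom x p * (x + y) ^ 2 + x + y +
      y ^ 2 + y ^ 3 := by
  simp only [T_dot_p_col_q, zpow_eq_geom hx]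
  field_simp
  ring

theorem T_dot_p_dot_q_eq (h0 : y ≠ 0) (hy : y - 1 ≠ 0) (p q : ℤ) : T_dot_p_dot_q x y p q =
    geom x p * ((x - 1) * (1 + 2 * x + x ^ 2 + y) + x + y + 1 +
      geom y q * (x + x ^ 2 + y + x * y + y ^ 2)) + 2 * y * geom y (q + 2) - y - y ^ (q + 2) +
      x * y * geom y q + x * y + x + x ^ 2 := by
  simp only [T_dot_p_dot_q, zpow_eq_geom hy, geom_add h0 hy]
  field_simp
  ring

theorem bar_bar_bar_eq (h0 : y ≠ 0) (hy : y - 1 ≠ 0) (q r s : ℤ) : bar_bar_bar x y q r s =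
    T_p y x r * T_p y x s + geom y q * T_p y x (r + s) := by
  rw [bar_bar_bar, geom_sub_one h0 hy]
  field_simp
  ring

theorem T_pqrs_eq (h0 : y ≠ 0) (hy : y - 1 ≠ 0) (p q r s : ℤ) : T_pqrs x y p q r s =
    geom y s * T_pqr x y p q r + x ^ r * T_p x y (p + 1) + x ^ r * (geom y q - 1) * T_p x y p := by
  rw [T_pqrs, geom_sub_one h0 hy]
  field_simp

theorem T_nine_dot_p0_eq (h0 : y ≠ 0) (hy : y - 1 ≠ 0) (p : ℤ) : T_nine_dot_p0 x y p =
    (geom y p - 1) * (x + 2 * x ^ 2 + x ^ 3 + y + 4 * x * y + 3 * x ^ 2 * y + 3 * y ^ 2 +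
      5 * x * y ^ 2 + 4 * y ^ 3 + 2 * x * y ^ 3 + 3 * y ^ 4 + y ^ 5) + 4 * x + 8 * x ^ 2 +
      5 * x ^ 3 + x ^ 4 + 4 * y + 13 * x * y + 7 * x ^ 2 * y + 9 * y ^ 2 + 9 * x * y ^ 2 + 8 * y ^ 3 +
      2 * x * y ^ 3 + 4 * y ^ 4 + y ^ 5 := by
  rw [T_nine_dot_p0, geom_sub_one h0 hy]
  field_simp

end Geom

/-! ### The values of the families -/

theorem twist_one : twist 1 = crossing true := rfl

theorem Shape.value_link {K : Type} [Field K] (γ L M : K) (t : Tangle) :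
    (Shape.link t).value γ L M = (t.value γ L M).1 + M * (t.value γ L M).2 := rfl

theorem Shape.value_prism_three {K : Type} [Field K] (γ L M : K) (l : List Tangle) :
    (Shape.prism 3 l).value γ L M = TLThree.closure L M
      [((l.getD 0 (crossing true)).value γ⁻¹ M L).swap, (l.getD 1 (crossing true)).value γ L M,
        ((l.getD 2 (crossing true)).value γ⁻¹ M L).swap, (l.getD 3 (crossing true)).value γ L M,
        ((l.getD 4 (crossing true)).value γ⁻¹ M L).swap, (l.getD 5 (crossing true)).value γ L M] :=
  rfl

theorem Shape.value_prism_four {K : Type} [Field K] (γ L M : K) (l : List Tangle) :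
    (Shape.prism 4 l).value γ L M = TLThree.closure L M
      [((l.getD 0 (crossing true)).value γ⁻¹ M L).swap, (l.getD 1 (crossing true)).value γ L M,
        ((l.getD 2 (crossing true)).value γ⁻¹ M L).swap, (l.getD 3 (crossing true)).value γ L M,
        ((l.getD 4 (crossing true)).value γ⁻¹ M L).swap, (l.getD 5 (crossing true)).value γ L M,
        ((l.getD 6 (crossing true)).value γ⁻¹ M L).swap, (l.getD 7 (crossing true)).value γ L M] :=
  rfl

theorem Shape.value_nine {K : Type} [Field K] (γ L M : K) (l : List Tangle) :
    (Shape.nine l).value γ L M = nineEval L M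
      (((l.getD 0 (crossing true)).value γ⁻¹ M L).swap :: (l.getD 1 (crossing true)).value γ L M ::
        List.replicate 7 (1, 1)) := rfl

/-- The integer `n` may be substituted for a parameter: the tangle `n` has the values that are given by
the formulas. -/
abbrev TwistValue {K : Type} [Field K] (γ x y : K) (n : ℤ) : Prop :=
  (twist n).value γ (x - 1) (y - 1) = (geom x n, 1) ∧
    (twist n).value γ⁻¹ (y - 1) (x - 1) = (geom y n, 1)

/-- The diagrams of a family have the value that is given by the formula. -/
def Family.HasValue (f : Family) : Prop :=
  ∀ v, ∃ S : Shape, S.Valid ∧ f.diagram v = S.diagram ∧ ∀ {K : Type} [Field K] (γ x y : K), x ≠ 0 →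
    y ≠ 0 → x - 1 ≠ 0 → y - 1 ≠ 0 → (∀ i, TwistValue γ x y (v i)) →
      S.colourValue γ x y f.colour = f.formula x y v

theorem hasValue_family1 {k : Colour} {D : ℤ → Diagram}
    {T : ∀ {K : Type} [Field K], K → K → ℤ → K}
    (h : ∀ p, ∃ S : Shape, S.Valid ∧ D p = S.diagram ∧ ∀ {K : Type} [Field K] (γ x y : K),
      x ≠ 0 → y ≠ 0 → x - 1 ≠ 0 → y - 1 ≠ 0 → TwistValue γ x y p →
        S.colourValue γ x y k = T x y p) : (family1 k D T).HasValue := by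
  intro (v : Fin 1 → ℤ)
  obtain ⟨S, h1, h2, h3⟩ := h (v 0)
  exact ⟨S, h1, h2, fun γ x y hx hy hx1 hy1 hv =>
    h3 γ x y hx hy hx1 hy1 (hv (0 : Fin 1))⟩

theorem hasValue_family2 {k : Colour} {D : ℤ → ℤ → Diagram}
    {T : ∀ {K : Type} [Field K], K → K → ℤ → ℤ → K}
    (h : ∀ p q, ∃ S : Shape, S.Valid ∧ D p q = S.diagram ∧ ∀ {K : Type} [Field K] (γ x y : K),
      x ≠ 0 → y ≠ 0 → x - 1 ≠ 0 → y - 1 ≠ 0 → TwistValue γ x y p → TwistValue γ x y q →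
        S.colourValue γ x y k = T x y p q) : (family2 k D T).HasValue := by
  intro (v : Fin 2 → ℤ)
  obtain ⟨S, h1, h2, h3⟩ := h (v 0) (v 1)
  exact ⟨S, h1, h2, fun γ x y hx hy hx1 hy1 hv =>
    h3 γ x y hx hy hx1 hy1 (hv (0 : Fin 2)) (hv (1 : Fin 2))⟩

theorem hasValue_family3 {k : Colour} {D : ℤ → ℤ → ℤ → Diagram}
    {T : ∀ {K : Type} [Field K], K → K → ℤ → ℤ → ℤ → K}
    (h : ∀ p q r, ∃ S : Shape, S.Valid ∧ D p q r = S.diagram ∧ ∀ {K : Type} [Field K] (γ x y : K),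
      x ≠ 0 → y ≠ 0 → x - 1 ≠ 0 → y - 1 ≠ 0 → TwistValue γ x y p → TwistValue γ x y q → TwistValue γ x y r →
        S.colourValue γ x y k = T x y p q r) : (family3 k D T).HasValue := by
  intro (v : Fin 3 → ℤ)
  obtain ⟨S, h1, h2, h3⟩ := h (v 0) (v 1) (v 2)
  exact ⟨S, h1, h2, fun γ x y hx hy hx1 hy1 hv =>
    h3 γ x y hx hy hx1 hy1 (hv (0 : Fin 3)) (hv (1 : Fin 3)) (hv (2 : Fin 3))⟩

theorem hasValue_family4 {k : Colour} {D : ℤ → ℤ → ℤ → ℤ → Diagram}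
    {T : ∀ {K : Type} [Field K], K → K → ℤ → ℤ → ℤ → ℤ → K}
    (h : ∀ p q r s, ∃ S : Shape, S.Valid ∧ D p q r s = S.diagram ∧ ∀ {K : Type} [Field K] (γ x y : K),
      x ≠ 0 → y ≠ 0 → x - 1 ≠ 0 → y - 1 ≠ 0 → TwistValue γ x y p → TwistValue γ x y q → TwistValue γ x y r → TwistValue γ x y s →
        S.colourValue γ x y k = T x y p q r s) : (family4 k D T).HasValue := by
  intro (v : Fin 4 → ℤ)
  obtain ⟨S, h1, h2, h3⟩ := h (v 0) (v 1) (v 2) (v 3)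
  exact ⟨S, h1, h2, fun γ x y hx hy hx1 hy1 hv =>
    h3 γ x y hx hy hx1 hy1 (hv (0 : Fin 4)) (hv (1 : Fin 4)) (hv (2 : Fin 4)) (hv (3 : Fin 4))⟩

theorem hasValue_family5 {k : Colour} {D : ℤ → ℤ → ℤ → ℤ → ℤ → Diagram}
    {T : ∀ {K : Type} [Field K], K → K → ℤ → ℤ → ℤ → ℤ → ℤ → K}
    (h : ∀ p q r s t, ∃ S : Shape, S.Valid ∧ D p q r s t = S.diagram ∧ ∀ {K : Type} [Field K] (γ x y : K),
      x ≠ 0 → y ≠ 0 → x - 1 ≠ 0 → y - 1 ≠ 0 → TwistValue γ x y p → TwistValue γ x y q → TwistValue γ x y r → TwistValue γ x y s → TwistValue γ x y t →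
        S.colourValue γ x y k = T x y p q r s t) : (family5 k D T).HasValue := by
  intro (v : Fin 5 → ℤ)
  obtain ⟨S, h1, h2, h3⟩ := h (v 0) (v 1) (v 2) (v 3) (v 4)
  exact ⟨S, h1, h2, fun γ x y hx hy hx1 hy1 hv =>
    h3 γ x y hx hy hx1 hy1 (hv (0 : Fin 5)) (hv (1 : Fin 5)) (hv (2 : Fin 5)) (hv (3 : Fin 5)) (hv (4 : Fin 5))⟩

set_option maxHeartbeats 0 in
-- every family is one more polynomial identity for the same chain of rewriting steps
set_option linter.unusedSimpArgs false in
/-- Both sides are rational functions of the numbers `[n]_x` and `[n]_y` for the parameters `n`, and of `x`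
and `y`: the powers of `x` and `y` and the `[n]` of sums of parameters are expressed by them. After the
removal of denominators every formula becomes an identity of polynomials. -/
theorem hasValue_of_mem_families : ∀ f ∈ families, f.HasValue := by
  unfold families
  repeat' (first
    | exact List.forall_mem_nil _
    | refine List.forall_mem_cons.2 ⟨?_, ?_⟩)
  all_goals
    first
      | refine hasValue_family1 ?_
      | refine hasValue_family2 ?_
      | refine hasValue_family3 ?_
      | refine hasValue_family4 ?_
      | refine hasValue_family5 ?_
    intros
    first
      | refine ⟨.link _, trivial, rfl, ?_⟩
      | refine ⟨.prism 3 _, by simp [Shape.Valid], rfl, ?_⟩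
      | refine ⟨.prism 4 _, by simp [Shape.Valid], rfl, ?_⟩
      | refine ⟨.nine _, trivial, rfl, ?_⟩
    intro K _ γ x y hx hy hx1 hy1
    intros
    simp only [*, Shape.colourValue, Shape.value_link, Shape.value_prism_three, Shape.value_prism_four,
      Shape.value_nine, nineEval_two, TLThree.closure, TLThree.braid, TLThree.mulFirst, TLThree.mulSecond,
      TLThree.trace, rational, product, ramify, List.map_cons, List.map_nil, List.foldl_cons,
      List.foldl_nil, List.getD_cons_zero, List.getD_cons_succ, List.getD_nil, Tangle.value, twist_one, Prod.swap,
      Prod.fst_swap, Prod.snd_swap, inv_inv, cond_true, mul_one, one_mul, mul_zero, zero_mul, add_zero, zero_add,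
      T_p, T_pq, chain_bar_bar, chain_bar_bar_bar, Gprime_chain_bar_par, Gprime_chain_bar_bar,
      T_p11q, T_pq1r, T_p1_q_r, T_p_q_r_plus, T_p111q, T_dot_p1, T_dot_p_col_q0, T_dot_p_dot_q0,
      T_p1_q1_r, T_p1_q_r_plus, T_p11_q_r, T_p1q1r, T_p_q_r_s, T_p1111q, T_pq11r, T_pq_r_s,
      T_p_q_r_plus_s, T_Lp_qR_Lr_sR, T_pq1rs, T_pqr1s, T_p1q11r, T_pq111r, T_p11111q, T_p1_q1_r1,
      T_p1q_r_s, T_pq1_r_s, T_p111_q_r, T_p1_q_r_s, T_pq_r1_s, T_p11_q1_r, T_p1_q_r_plus_s,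
      T_p_q_r_s_plus, T_pq_r_s_plus, T_p11_q_r_plus, T_Lp_q_plusR_Lr_sR, T_Lp_qR1Lr_sR,
      T_p1_q1_r_plus, T_Lp1_qR_Lr_sR, T_dot_pq, T_dot_p11, T_dot_p1_col_q, T_dot_p1_dot_q,
      T_dot_p1_col_q0, T_dot_p1_dot_q0, T_dot_p_dot_q0_dot_r, T_p_col_q0_col_r0, T_p0_col_q0_col_r0,
      T_dot_p_dot_q_dot_r, T_p_col_q_col_r, T_dot_p_dot_q_dot_r0, T_p_col_q_col_r0, T_dot_Lp_qR,
      T_eight_p, T_eight_p0, T_pqrst, T_p1qr1s, T_pq11rs, T_pq1r1s, T_pqr11s, T_p11q11r, T_p1q111r,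
      T_pq1111r, T_p111111q, T_p_q_r_s_t, T_p1_q_r1_s, T_pqr_s_t, T_p11q_r_s, T_p1q1_r_s,
      T_pq11_r_s, T_p1111_q_r, T_pq_rs_t, T_p11_q11_r, T_pq_r1_s1, T_p11_q1_r1, T_pq_r_s_t,
      T_p11_q_r_s, T_p1_q1_r_s, T_p1q_r1_s, T_pq1_r1_s, T_p111_q1_r, T_p11_qr_s, T_p_q_r_s_plus_t,
      T_pq_r_s_plus_t, T_p11_q_r_plus_s, T_p1_q1_r_plus_s, T_p1_q1_r1_plus, T_p1q_r_s_plus,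
      T_pq1_r_s_plus, T_p111_q_r_plus, T_p1_q_r_s_plus, T_pq_r1_s_plus, T_p11_q1_r_plus,
      T_Lpq_rR_Ls_tR, T_Lp11_qR_Lr_sR, T_Lp1_q1R_Lr_sR, T_Lp1_qR_Lr1_sR, T_Lp_q_rR_Ls_tR,
      T_Lp1_q_plusR_Lr_sR, T_Lp_q_plusR_Lr1_sR, T_Lp_q_plusR_Lr_s_plusR, T_Lp_q_plus_rR_Ls_tR,
      T_Lp_qRrLs_tR, T_Lp1_qR1Lr_sR, T_Lp_qR11Lr_sR, T_Lp_q_plusR1Lr_sR, T_Lp_qR_r_Ls_tR, T_dot_p1q,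
      T_dot_pq1, T_dot_p111, T_dot_pq_col_r, T_dot_pq_dot_r, T_dot_pq_col_r0, T_dot_pq_dot_r0,
      T_dot_p11_col_q, T_dot_p11_dot_q, T_dot_p11_col_q0, T_dot_p11_dot_q0, T_dot_p1_dot_q0_dot_r,
      T_dot_p1_col_q1, T_dot_p1_dot_q1, T_dot_p1_col_q10, T_dot_p1_dot_q10, T_dot_p10_dot_q_dot_r,
      T_dot_p_dot_q_dot_r0_dot_s0, T_dot_p1_dot_q_dot_r, T_dot_p_dot_q10_dot_r,
      T_dot_p_dot_q1_dot_r, T_dot_p_dot_q1_dot_r0, T_dot_p1_dot_q_dot_r0, T_p10_col_q0_col_r0,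
      T_p1_col_q_col_r, T_p1_col_q0_col_r0, T_p_col_q_col_r10, T_p1_col_q_col_r0,
      T_p10_col_q_col_r0, T_dot_p_dot_q_dot_r_dot_s, T_dot_p_dot_q_dot_r_dot_s0,
      T_dot_p_dot_q0_dot_r_dot_s0, T_p0_dot_q_dot_r0_dot_s0, T_p0_dot_q_dot_r_dot_s0,
      T_p_dot_q0_dot_r_dot_s0, T_p_dot_q_dot_r0_dot_s, T_p_dot_q_dot_r0_dot_s0,
      T_p_dot_q_dot_r_dot_s, T_p_dot_q_dot_r_dot_s0, T_dot_Lp1_qR, T_dot_Lp_qR1, T_dot_Lp_q_plusR,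
      T_dot_Lp_qR_dot_r, T_dot_Lp_qR_dot_r0, T_dot_Lp_qR_col_r, T_dot_Lp_qR_col_r0,
      T_eight_p0_colcol_q0, T_eight_p0_coldot_q0, T_eight_p0_col_q0, T_eight_p0_dot_q0, T_eight_p1,
      T_eight_p10, T_eight_p_colcol_q, T_eight_p_coldot_q, T_eight_p_col_q, T_eight_p_dot_q,
      T_eight_p_colcol_q0, T_eight_p_coldot_q0, T_eight_p_col_q0, T_eight_p_dot_q0, T_nine_dot_p,
      T_nine_p,
      T_p_q_r_eq hx hx1, T_p_q_r_eq hy hy1, T_p1q_eq hx1, T_p1q_eq hy1, T_pqr_eq hx hx1 hy1,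
      T_pqr_eq hy hy1 hx1, T_dot_p_eq hx hx1, T_dot_p_eq hy hy1, T_dot_p_col_q_eq hx1, T_dot_p_col_q_eq hy1,
      T_dot_p_dot_q_eq hx hx1, T_dot_p_dot_q_eq hy hy1, bar_bar_bar_eq hx hx1, bar_bar_bar_eq hy hy1,
      T_pqrs_eq hx hx1, T_pqrs_eq hy hy1, T_nine_dot_p0_eq hy hy1,
      zpow_eq_geom hx1, zpow_eq_geom hy1, geom_add hx hx1, geom_add hy hy1, geom_sub_one hx hx1,
      geom_sub_one hy hy1, geom_one hx1, geom_one hy1, geom_two hx hx1, geom_two hy hy1,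
      geom_three hx hx1, geom_three hy hy1, geom_four hx hx1, geom_four hy hy1]
    first
      | ring1
      | field_simp; ring1

/-! ### The wheels -/

/-- The sums of the `n`-th powers of the roots of `z² - (1 + x + y) z + x y`. -/
def wheelPowerSum {K : Type} [CommRing K] (x y : K) : ℕ → K
  | 0 => 2
  | 1 => 1 + x + y
  | n + 2 => (1 + x + y) * wheelPowerSum x y (n + 1) - x * y * wheelPowerSum x y n

theorem map_wheelPowerSum {K F : Type} [CommRing K] [CommRing F] (f : K →+* F) (x y : K) (n : ℕ) :
    f (wheelPowerSum x y n) = wheelPowerSum (f x) (f y) n := by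
  induction n using Nat.twoStepInduction with
  | zero => exact map_ofNat f 2
  | one => simp [wheelPowerSum]
  | more n h0 h1 => simp [wheelPowerSum, h0, h1]

theorem wheelPowerSum_comm {K : Type} [CommRing K] (x y : K) (n : ℕ) :
    wheelPowerSum x y n = wheelPowerSum y x n := by
  induction n using Nat.twoStepInduction with
  | zero => rfl
  | one => simp only [wheelPowerSum]; ring
  | more n h0 h1 => simp only [wheelPowerSum, h0, h1]; ring

theorem wheelFormula_eq {K : Type} [Field K] [CharZero K] {x y s : K}
    (hs : s ^ 2 = (1 + x + y) ^ 2 - 4 * x * y) (n : ℕ) :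
    wheelFormula x y s n = wheelPowerSum x y n + (x * y - x - y - 1) := by
  rw [wheelFormula]
  congr 1
  induction n using Nat.twoStepInduction with
  | zero => norm_num [wheelPowerSum]
  | one => simp only [wheelPowerSum, pow_one]; ring
  | more n h0 h1 =>
    rw [wheelPowerSum, ← h0, ← h1]
    have e : ∀ z : K, z ^ 2 = (1 + x + y) * z - x * y →
        z ^ (n + 2) = (1 + x + y) * z ^ (n + 1) - x * y * z ^ n := fun z hz => by
      rw [pow_add, hz]; ring
    rw [e _ (by linear_combination hs / 4), e ((1 + x + y - s) / 2) (by linear_combination hs / 4)]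
    ring

/-- Multiplication by the two vertices of an antiprism that are crossings `1`. -/
def TLThree.wheelStep {K : Type} [CommRing K] (L M : K) (v : TLThree K) : TLThree K :=
  (v.mulFirst M (1, 1)).mulSecond L (1, 1)

theorem braid_replicate_one {K : Type} [CommRing K] (L M : K) (n : ℕ) (v : TLThree K) :
    TLThree.braid L M v (List.replicate (2 * n) (1, 1)) = (TLThree.wheelStep L M)^[n] v := by
  induction n generalizing v with
  | zero => rfl
  | succ n ih =>
    rw [Function.iterate_succ_apply, ← ih]
    rfl

/-- The product of the two generators acts on the Temperley-Lieb algebra with the eigenvalues `1` and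
the roots of `z² - (1 + x + y) z + x y`, which determines the traces of its powers. -/
theorem closure_replicate_one {K : Type} [CommRing K] (x y : K) (n : ℕ) :
    TLThree.closure (x - 1) (y - 1) (List.replicate (2 * n) (1, 1)) =
      wheelPowerSum x y n + (x * y - x - y - 1) := by
  rw [TLThree.closure, braid_replicate_one]
  set T := TLThree.wheelStep (x - 1) (y - 1) with hT
  have rec3 : ∀ w : TLThree K, (T (T (T w))).trace (x - 1) (y - 1) =
      (2 + x + y) * (T (T w)).trace (x - 1) (y - 1) -
        (1 + x + y + x * y) * (T w).trace (x - 1) (y - 1) +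
        x * y * w.trace (x - 1) (y - 1) := by
    intro w
    simp only [hT, TLThree.wheelStep, TLThree.mulFirst, TLThree.mulSecond, TLThree.trace]
    ring
  have key : ∀ n, (T^[n] ⟨1, 0, 0, 0, 0⟩).trace (x - 1) (y - 1) =
        wheelPowerSum x y n + (x * y - x - y - 1) ∧
      (T^[n + 1] ⟨1, 0, 0, 0, 0⟩).trace (x - 1) (y - 1) =
        wheelPowerSum x y (n + 1) + (x * y - x - y - 1) ∧
      (T^[n + 2] ⟨1, 0, 0, 0, 0⟩).trace (x - 1) (y - 1) =
        wheelPowerSum x y (n + 2) + (x * y - x - y - 1) := by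
    intro n
    induction n with
    | zero =>
      simp only [hT, Function.iterate_succ_apply', Function.iterate_zero, id, TLThree.wheelStep,
        TLThree.mulFirst, TLThree.mulSecond, TLThree.trace, wheelPowerSum]
      refine ⟨?_, ?_, ?_⟩ <;> ring
    | succ n ih =>
      obtain ⟨h0, h1, h2⟩ := ih
      refine ⟨h1, h2, ?_⟩
      simp only [Function.iterate_succ_apply'] at h0 h1 h2 ⊢
      rw [rec3, h0, h1, h2]
      simp only [wheelPowerSum]
      ring
  exact (key n).1

theorem Shape.colourValue_prism_nil {K : Type} [Field K] (γ x y : K) (n : ℕ) (k : Colour) :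
    (Shape.prism n []).colourValue γ x y k = wheelPowerSum x y n + (x * y - x - y - 1) := by
  have h : ∀ γ L M : K, (Shape.prism n []).value γ L M =
      TLThree.closure L M (List.replicate (2 * n) (1, 1)) := by
    intro γ L M
    rw [Shape.value, Shape.eval, Shape.tangles, List.map_map]
    congr 1
    refine List.eq_replicate_iff.2 ⟨by simp, fun w hw => ?_⟩
    obtain ⟨i, -, rfl⟩ := List.mem_map.1 hw
    simp only [Function.comp, List.getD_nil]
    split_ifs <;> rfl
  cases k
  · rw [colourValue, h, closure_replicate_one]
  · rw [colourValue, h, closure_replicate_one, wheelPowerSum_comm]; ring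

theorem map_eq_aeval {F : Type} [CommRing F] (f : MvPolynomial (Fin 2) ℤ →+* F)
    (p : MvPolynomial (Fin 2) ℤ) :
    f p = MvPolynomial.aeval ![f (MvPolynomial.X 0), f (MvPolynomial.X 1)] p := by
  refine RingHom.congr_fun (g := (MvPolynomial.aeval ![f (.X 0), f (.X 1)]).toRingHom)
    (MvPolynomial.ringHom_ext (fun n => by simp) fun i => ?_) p
  fin_cases i <;> simp

theorem generic_ne_zero (i : Fin 2) :
    algebraMap (MvPolynomial (Fin 2) ℤ) (FractionRing (MvPolynomial (Fin 2) ℤ))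
      (MvPolynomial.X i) ≠ 0 ∧
    algebraMap (MvPolynomial (Fin 2) ℤ) (FractionRing (MvPolynomial (Fin 2) ℤ))
      (MvPolynomial.X i) - 1 ≠ 0 := by
  have inj := IsFractionRing.injective (MvPolynomial (Fin 2) ℤ)
    (FractionRing (MvPolynomial (Fin 2) ℤ))
  refine ⟨fun h => MvPolynomial.X_ne_zero i (inj (h.trans (map_zero _).symm)), fun h => ?_⟩
  rw [← map_one (algebraMap (MvPolynomial (Fin 2) ℤ) (FractionRing (MvPolynomial (Fin 2) ℤ))),
    sub_eq_zero] at h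
  have := congrArg (MvPolynomial.eval fun _ => (0 : ℤ)) (inj h)
  simp at this

theorem tutte_antiprism (n : ℕ) (hn : 2 ≤ n) (k : Colour) :
    tutte (taitGraph k (antiprism n [])) = wheelPowerSum (MvPolynomial.X 0) (MvPolynomial.X 1) n +
      (MvPolynomial.X 0 * MvPolynomial.X 1 - MvPolynomial.X 0 - MvPolynomial.X 1 - 1) := by
  apply IsFractionRing.injective (MvPolynomial (Fin 2) ℤ) (FractionRing (MvPolynomial (Fin 2) ℤ))
  rw [map_eq_aeval]
  refine (Shape.aeval_tutte (generic_ne_zero 0).2 (generic_ne_zero 1).2 (.prism n []) hn k).trans ?_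
  rw [Shape.colourValue_prism_nil]
  simp only [map_add, map_sub, map_mul, map_one, map_wheelPowerSum]

theorem ratFunc_ne_zero {A : RatFunc ℚ} (hA : A = RatFunc.X) : A ≠ 0 ∧ A ^ 4 + 1 ≠ 0 := by
  subst hA
  refine ⟨RatFunc.X_ne_zero, fun h => ?_⟩
  rw [← RatFunc.algebraMap_X, ← map_pow, ← map_one (algebraMap (Polynomial ℚ) (RatFunc ℚ)),
    ← map_add] at h
  have := congrArg (Polynomial.eval 0) (RatFunc.algebraMap_injective ℚ (h.trans (map_zero _).symm))
  simp at this

theorem Shape.exists_of_mem_families {f : Family} (hf : f ∈ families) {v : Fin f.arity → ℤ} :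
    ∃ S : Shape, S.Valid ∧ f.diagram v = S.diagram ∧ ∀ {K : Type} [Field K] (γ x y : K), x ≠ 0 →
      y ≠ 0 → x - 1 ≠ 0 → y - 1 ≠ 0 → (∀ i, 1 ≤ v i) ∨ (∀ i, v i ≠ 0) ∧ x * y = 1 ∧ γ = -y →
        S.colourValue γ x y f.colour = f.formula x y v := by
  obtain ⟨S, h1, h2, h3⟩ := hasValue_of_mem_families f hf v
  refine ⟨S, h1, h2, fun γ x y hx hy hx1 hy1 hv => h3 γ x y hx hy hx1 hy1 fun i => ?_⟩
  constructor
  · refine value_twist _ hx1 (hv.imp (fun h => h i) fun h => ⟨h.1 i, hx, ?_⟩)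
    rw [h.2.2, eq_inv_of_mul_eq_one_right h.2.1]
  · refine value_twist _ hy1 (hv.imp (fun h => h i) fun h => ⟨h.1 i, hy, ?_⟩)
    rw [h.2.2, inv_neg]

theorem mainTheorem10 :
    (∀ f ∈ families,
      -- the formula for the Tutte polynomials of the graphs of the family
      (∀ v : Fin f.arity → ℤ, (∀ i, 1 ≤ v i) →
        algebraMap (MvPolynomial (Fin 2) ℤ) (FractionRing (MvPolynomial (Fin 2) ℤ))
            (tutte (taitGraph f.colour (f.diagram v))) =
          f.formula (K := FractionRing (MvPolynomial (Fin 2) ℤ))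
            (algebraMap (MvPolynomial (Fin 2) ℤ) _ (MvPolynomial.X 0))
            (algebraMap (MvPolynomial (Fin 2) ℤ) _ (MvPolynomial.X 1)) v) ∧
      -- the Jones polynomials of the alternating members, from the Tutte polynomials
      (∀ (A t : RatFunc ℚ), A = RatFunc.X → t = (A ^ 4)⁻¹ →
        ∀ v : Fin f.arity → ℤ, (∀ i, 1 ≤ v i) →
        ∀ o, IsOrientation (f.colour.normalize (f.diagram v)) o →
          EqUpToUnit A (jones A (f.colour.normalize (f.diagram v)) o)
            (MvPolynomial.aeval ![-t, -t⁻¹] (tutte (taitGraph f.colour (f.diagram v))))) ∧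
      -- the Jones polynomials of all members, alternating or not, from the formula
      (∀ (A t : RatFunc ℚ), A = RatFunc.X → t = (A ^ 4)⁻¹ →
        ∀ v : Fin f.arity → ℤ, (∀ i, v i ≠ 0) →
        ∀ o, IsOrientation (f.colour.normalize (f.diagram v)) o →
          EqUpToUnit A (jones A (f.colour.normalize (f.diagram v)) o)
            (f.formula (-t) (-t⁻¹) v))) ∧
    -- the antiprismatic basic polyhedra, whose graphs are the wheels
    (∀ (n : ℕ), 3 ≤ n → ∀ k : Colour,
      (∀ (K : Type) [Field K] [CharZero K] (x y s : K), s ^ 2 = (1 + x + y) ^ 2 - 4 * x * y →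
        MvPolynomial.aeval ![x, y] (tutte (taitGraph k (antiprism n []))) =
          wheelFormula x y s n) ∧
      (∀ (K : Type) [Field K] [CharZero K] (A t s : K), A ≠ 0 → t = (A ^ 4)⁻¹ →
        s ^ 2 = (1 - t - t⁻¹) ^ 2 - 4 →
        ∀ o, IsOrientation (k.normalize (antiprism n [])) o →
          EqUpToUnit A (jones A (k.normalize (antiprism n [])) o)
            (wheelFormula (-t) (-t⁻¹) s n))) := by
  have jonesFormula : ∀ f ∈ families, ∀ (A t : RatFunc ℚ), A = RatFunc.X → t = (A ^ 4)⁻¹ →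
      ∀ v : Fin f.arity → ℤ, (∀ i, v i ≠ 0) → ∀ o,
        EqUpToUnit A (jones A (f.colour.normalize (f.diagram v)) o) (f.formula (-t) (-t⁻¹) v) := by
    rintro f hf A t hA rfl v hv o
    obtain ⟨hA0, hA1⟩ := ratFunc_ne_zero hA
    obtain ⟨S, h1, h2, h3⟩ := Shape.exists_of_mem_families hf (v := v)
    have h4 : A ^ 4 ≠ 0 := pow_ne_zero 4 hA0
    have := h3 (A ^ 4) (-(A ^ 4)⁻¹) (-A ^ 4) (neg_ne_zero.2 (inv_ne_zero h4)) (neg_ne_zero.2 h4) ?_ ?_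
      (Or.inr ⟨hv, by field_simp, (neg_neg _).symm⟩)
    · rw [h2, inv_inv, ← this]
      exact eqUpToUnit_jones_value hA0 S h1 _ o
    · intro h
      apply hA1
      field_simp at h
      linear_combination -h
    · exact fun h => hA1 (by linear_combination -h)
  refine ⟨fun f hf => ⟨fun v hv => ?_, fun A t hA ht v hv o _ => ?_,
    fun A t hA ht v hv o _ => jonesFormula f hf A t hA ht v hv o⟩, fun n hn k => ⟨?_, ?_⟩⟩
  · obtain ⟨S, h1, h2, h3⟩ := Shape.exists_of_mem_families hf (v := v)
    obtain ⟨hx, hx1⟩ := generic_ne_zero 0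
    obtain ⟨hy, hy1⟩ := generic_ne_zero 1
    rw [map_eq_aeval, h2, Shape.aeval_tutte hx1 hy1 S h1, h3 1 _ _ hx hy hx1 hy1 (Or.inl hv)]
  · have key := jonesFormula f hf A t hA ht v (fun i => by have := hv i; omega) o
    obtain ⟨hA0, hA1⟩ := ratFunc_ne_zero hA
    obtain ⟨S, h1, h2, h3⟩ := Shape.exists_of_mem_families hf (v := v)
    have h4 : A ^ 4 ≠ 0 := pow_ne_zero 4 hA0
    subst ht
    have hx1 : -(A ^ 4)⁻¹ - 1 ≠ 0 := by
      intro h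
      apply hA1
      field_simp at h
      linear_combination -h
    have hy1 : -(A ^ 4)⁻¹⁻¹ - 1 ≠ 0 := by
      rw [inv_inv]
      exact fun h => hA1 (by linear_combination -h)
    rw [← h3 1 _ _ (neg_ne_zero.2 (inv_ne_zero h4)) (neg_ne_zero.2 (inv_ne_zero (inv_ne_zero h4)))
      hx1 hy1 (Or.inl hv), ← Shape.aeval_tutte hx1 hy1 S h1, ← h2] at key
    rwa [show RatFunc.instAlgebraOfPolynomial ℚ ℤ = Ring.toIntAlgebra (RatFunc ℚ) from
      Subsingleton.elim _ _]
  · intro K _ _ x y s hs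
    rw [tutte_antiprism n (by omega), wheelFormula_eq hs]
    have := map_wheelPowerSum (MvPolynomial.aeval (R := ℤ) ![x, y]).toRingHom (MvPolynomial.X 0)
      (MvPolynomial.X 1) n
    simp at this ⊢
    exact this
  · rintro K _ _ A t s hA rfl hs o -
    have h4 : A ^ 4 ≠ 0 := pow_ne_zero 4 hA
    rw [wheelFormula_eq (by rw [hs]; field_simp; ring)]
    have := eqUpToUnit_jones_value hA (.prism n []) (by show 2 ≤ n; omega) k o
    rw [Shape.colourValue_prism_nil] at this
    rw [inv_inv]
    exact this
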